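/- **Conventions.** Manifolds are smooth and without boundary; $D_{(ab)}$ denotes symmetrization with weight $\tfrac12$, and $A\otimes_s B=\tfrac12(A\otimes B+B\otimes A)$. The curvature of a connection $D$ is $R^D(X,W)Z=(D_XD_W-D_WD_X-D_{[X,W]})Z$, with components $R^a{}_{bcd}=dx^a\big(R^D(\partial_c,\partial_d)\partial_b\big)$ and Ricci tensor $R_{bd}=R^a{}_{bad}$. For a semi-Riemannian metric $g$, $\mathrm{Riem}$ and $\mathrm{Ric}$ are the Riemann tensor $R_{\alpha\beta\gamma\delta}=g_{\alpha\mu}R^\mu{}_{\beta\gamma\delta}$ and the Ricci tensor of its Levi-Civita connection. **Hypersurface data.** Let $\mathcal N$ be an $\mathfrak n$-dimensional manifold with a smooth symmetric $2$-covariant tensor $\gamma$, a smooth covector $\ell$, a smooth function $\ell^{(2)}$ and a smooth symmetric $2$-covariant tensor $Y$, such that the symmetric tensor $$\mathcal A_p\big((W,a),(Z,b)\big)=\gamma(W,Z)+a\,\ell(Z)+b\,\ell(W)+ab\,\ell^{(2)}$$ on $T_p\mathcal N\times\mathbb R$ is non-degenerate at every $p$. Then $\{\mathcal N,\gamma,\ell,\ell^{(2)},Y\}$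 is called hypersurface data. The inverse of $\mathcal A$ has the form $\big((\alpha,a),(\beta,b)\big)\mapsto P(\alpha,\beta)+a\,n(\beta)+b\,n(\alpha)+ab\,n^{(2)}$, which defines the symmetric contravariant tensor $P^{ab}$, the vector field $n$ and the function $n^{(2)}$. Put $$F=\tfrac12 d\ell\ \ \big(F_{ab}=\tfrac12(\partial_a\ell_b-\partial_b\ell_a)\big),\quad s=F(n,\cdot),\quad U=\tfrac12\pounds_n\gamma+\ell\otimes_s dn^{(2)},\quad r=Y(n,\cdot),\quad \kappa_n=-Y(n,n).$$ Let $\mathring\nabla$ be the unique torsion-free connection on $\mathcal N$ with $\mathring\nabla_a\gamma_{bc}=-U_{ab}\ell_c-U_{ac}\ell_b$ and $\mathring\nabla_a\ell_b+\mathring\nabla_b\ell_a=-2\ell^{(2)}U_{ab}$, and let $\mathring R_{bd}$ be its Ricci tensor. With $\mathrm{tr}_PT=P^{ac}T_{ac}$, the constraint tensor of the data is $$\begin{aligned}\mathcal R_{bd}={}&\mathring R_{(bd)}-2\pounds_nY_{bd}-\big(2\kappa_n+\mathrm{tr}_PU-n^{(2)}(n(\ell^{(2)})-\mathrm{tr}_PY)\big)Y_{bd}+\mathring\nabla_{(b}\big(s_{d)}+2r_{d)}\big)\\&-2r_br_d+4r_{(b}s_{d)}-s_bs_d-(\mathrm{tr}_PY)\,U_{bd}+2P^{ac}U_{a(b}\big(2Y_{d)c}+F_{d)c}\big)\\&+n^{(2)}\Big(\big(s_{(b}-3r_{(b}\big)\mathring\nabla_{d)}\ell^{(2)}+P^{ac}\big((Y_{ab}+F_{ab})(Y_{cd}+F_{cd})-2F_{ab}F_{cd}\big)\Big).\end{aligned}$$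 **Embedded data.** The data is embedded in a semi-Riemannian manifold $(\mathcal M,g)$ of dimension $\mathfrak n+1$ with embedding $\phi$ and rigging $\zeta$ if $\phi:\mathcal N\to\mathcal M$ is a smooth embedding, $\zeta$ is a smooth vector field along $\phi(\mathcal N)$ that is everywhere transversal to $\phi(\mathcal N)$, and $$\phi^\star g=\gamma,\qquad \phi^\star\big(g(\zeta,\cdot)\big)=\ell,\qquad \phi^\star\big(g(\zeta,\zeta)\big)=\ell^{(2)},\qquad \tfrac12\phi^\star(\pounds_\zeta g)=Y,$$ where the last pull-back does not depend on how $\zeta$ is extended off $\phi(\mathcal N)$. **Proposition 4.3.** Let $\{\mathcal N,\gamma,\ell,\ell^{(2)},Y\}$ be hypersurface data embedded in $(\mathcal M,g)$ with embedding $\phi$ and rigging $\zeta$. Let $\boldsymbol\nu$ be the unique normal covector along $\phi(\mathcal N)$ with $\boldsymbol\nu(\zeta)=1$, and let $\nu$ be the vector with $g(\nu,\cdot)=\boldsymbol\nu$. Then $$\phi^\star\big(\mathrm{Ric}-g(\nu,\nu)\,\mathrm{Riem}(\zeta,\cdot,\zeta,\cdot)\big)=\mathcal R .$$ In particular, at every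 point $p$ at which $\phi(\mathcal N)$ is null, that is, at which the radical of $\gamma|_p$ is one-dimensional, $\phi^\star\mathrm{Ric}|_p=\mathcal R|_p$. -/

import Mathlib

open scoped Manifold ContDiff Topology

noncomputable section

namespace HypData

/-! ### Tensor calculus in coordinates -/

/-- The coordinate space `ℝᵐ` in which charts of `m`-dimensional manifolds take values. -/
abbrev Coord (m : ℕ) : Type := EuclideanSpace ℝ (Fin m)

/-- The partial derivative `∂_a f` at `x`. -/
def pd {m : ℕ} (a : Fin m) (f : Coord m → ℝ) (x : Coord m) : ℝ :=
  fderiv ℝ f x (EuclideanSpace.single a 1)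

/-- Components `(£_V T)_{ab}` of the Lie derivative of a 2-covariant tensor field `T`
along a vector field `V`. -/
def lie2 {m : ℕ} (V : Coord m → Fin m → ℝ) (T : Coord m → Fin m → Fin m → ℝ)
    (x : Coord m) (a b : Fin m) : ℝ :=
  ∑ c, (V x c * pd c (fun y => T y a b) x + T x c b * pd a (fun y => V y c) x
    + T x a c * pd b (fun y => V y c) x)

/-- Components `D_a θ_b` of the covariant derivative of a covector field. A connection `D` is given
by its symbols `Γ x a b c = Γ^a_{bc}`, with `D_{∂_b} ∂_c = Γ^a_{bc} ∂_a`. -/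
def covDerivForm {m : ℕ} (Γ : Coord m → Fin m → Fin m → Fin m → ℝ) (θ : Coord m → Fin m → ℝ)
    (x : Coord m) (a b : Fin m) : ℝ :=
  pd a (fun y => θ y b) x - ∑ c, Γ x c a b * θ x c

/-- Components `D_a T_{bc}` of the covariant derivative of a 2-covariant tensor field. -/
def covDerivTensor {m : ℕ} (Γ : Coord m → Fin m → Fin m → Fin m → ℝ)
    (T : Coord m → Fin m → Fin m → ℝ) (x : Coord m) (a b c : Fin m) : ℝ :=
  pd a (fun y => T y b c) x - ∑ d, (Γ x d a b * T x d c + Γ x d a c * T x b d)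

/-- Components `R^a_{bcd}` of the curvature tensor of a connection, with the convention
`R^a_{bcd} = dx^a (R(∂_c, ∂_d) ∂_b)`, `R(X, W) Z = (D_X D_W - D_W D_X - D_{[X,W]}) Z`. -/
def curvature {m : ℕ} (Γ : Coord m → Fin m → Fin m → Fin m → ℝ) (x : Coord m)
    (a b c d : Fin m) : ℝ :=
  pd c (fun y => Γ y a d b) x - pd d (fun y => Γ y a c b) x
    + ∑ f, (Γ x a c f * Γ x f d b - Γ x a d f * Γ x f c b)

/-- Components `R_{bd} = R^a_{bad}` of the Ricci tensor of a connection. -/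
def ricci {m : ℕ} (Γ : Coord m → Fin m → Fin m → Fin m → ℝ) (x : Coord m) (b d : Fin m) : ℝ :=
  ∑ a, curvature Γ x a b a d

/-- Christoffel symbols of the Levi-Civita connection of a (semi-Riemannian) metric. -/
def christoffel {m : ℕ} (G : Coord m → Fin m → Fin m → ℝ) (x : Coord m)
    (a b c : Fin m) : ℝ :=
  (1 / 2) * ∑ d, (Matrix.of (G x))⁻¹ a d * (pd b (fun y => G y c d) x + pd c (fun y => G y b d) x
    - pd d (fun y => G y b c) x)

/-- Components `R_{abcd} = g_{af} R^f_{bcd}` of the Riemann tensor of a metric. -/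
def riemannLow {m : ℕ} (G : Coord m → Fin m → Fin m → ℝ) (x : Coord m)
    (a b c d : Fin m) : ℝ :=
  ∑ f, G x a f * curvature (christoffel G) x f b c d

/-- Components `(F^⋆ £_Z G)_{ab}` of the pull-back by a map `F` of the Lie derivative of a
2-covariant tensor field `G` along a vector field `Z` that is defined along `F` only.
See `pullbackLie_eq`: for each extension of `Z` off the image of `F` this is the pull-back
of the usual Lie derivative. -/
def pullbackLie {n m : ℕ} (G : Coord m → Fin m → Fin m → ℝ) (F : Coord n → Coord m)
    (Z : Coord n → Fin m → ℝ) (x : Coord n) (a b : Fin n) : ℝ :=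
  ∑ μ, ∑ ν,
    ((∑ lam, Z x lam * pd lam (fun y => G y μ ν) (F x))
        * pd a (fun y => F y μ) x * pd b (fun y => F y ν) x
      + G (F x) μ ν * (pd a (fun y => Z y μ) x * pd b (fun y => F y ν) x
        + pd a (fun y => F y μ) x * pd b (fun y => Z y ν) x))

/-! ### Hypersurface data in coordinates -/

/-- Component functions of `γ`, `ℓ`, `ℓ⁽²⁾`, `Y` in a coordinate system. -/
structure LocalData (n : ℕ) where
  γ : Coord n → Fin n → Fin n → ℝ
  ell : Coord n → Fin n → ℝ
  ell2 : Coord n → ℝ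
  Y : Coord n → Fin n → Fin n → ℝ

namespace LocalData

variable {n : ℕ} (D : LocalData n)

/-- The matrix of the tensor `𝓐` on `T_pN × ℝ`. -/
def A (x : Coord n) : Matrix (Fin n ⊕ Unit) (Fin n ⊕ Unit) ℝ :=
  Matrix.fromBlocks (Matrix.of (D.γ x)) (Matrix.of fun a _ => D.ell x a)
    (Matrix.of fun _ b => D.ell x b) (Matrix.of fun _ _ => D.ell2 x)

/-- The tensor `P^{ab}`, a block of the inverse of `𝓐`. -/
def P (x : Coord n) (a b : Fin n) : ℝ := (D.A x)⁻¹ (Sum.inl a) (Sum.inl b)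

/-- The vector `n^a`, a block of the inverse of `𝓐`. -/
def nvec (x : Coord n) (a : Fin n) : ℝ := (D.A x)⁻¹ (Sum.inl a) (Sum.inr ())

/-- The scalar `n⁽²⁾`, a block of the inverse of `𝓐`. -/
def n2 (x : Coord n) : ℝ := (D.A x)⁻¹ (Sum.inr ()) (Sum.inr ())

/-- `U = ½ £_n γ + ℓ ⊗ₛ dn⁽²⁾`. -/
def U (x : Coord n) (a b : Fin n) : ℝ :=
  (1 / 2) * lie2 D.nvec D.γ x a b
    + (1 / 2) * (D.ell x a * pd b D.n2 x + D.ell x b * pd a D.n2 x)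

/-- `F = ½ dℓ`. -/
def F (x : Coord n) (a b : Fin n) : ℝ :=
  (1 / 2) * (pd a (fun y => D.ell y b) x - pd b (fun y => D.ell y a) x)

/-- `s = F(n, ·)`. -/
def s (x : Coord n) (b : Fin n) : ℝ := ∑ a, D.nvec x a * D.F x a b

/-- `r = Y(n, ·)`. -/
def r (x : Coord n) (b : Fin n) : ℝ := ∑ a, D.nvec x a * D.Y x a b

/-- `κ_n = -Y(n, n)`. -/
def kappa (x : Coord n) : ℝ := -∑ a, ∑ b, D.nvec x a * D.nvec x b * D.Y x a b

/-- The symbols of the metric hypersurface connection `∇°`. See `connection_spec` and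
`connection_unique`: they are the unique solution of the equations that define `∇°`
(`IsMetricHypersurfaceConnection`), by `HypersurfaceData.isRegularAt` in each chart of `N`. -/
def connection (x : Coord n) (c a b : Fin n) : ℝ :=
  (1 / 2) * ∑ d, D.P x c d * (pd a (fun y => D.γ y b d) x + pd b (fun y => D.γ y a d) x
      - pd d (fun y => D.γ y a b) x)
    + (1 / 2) * D.nvec x c * (pd a (fun y => D.ell y b) x + pd b (fun y => D.ell y a) x)

/-- The trace `tr_P T = P^{ac} T_{ac}`. -/
def trP (T : Coord n → Fin n → Fin n → ℝ) (x : Coord n) : ℝ :=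
  ∑ a, ∑ c, D.P x a c * T x a c

/-- The derivative `n(ℓ⁽²⁾)`. -/
def nell2 (x : Coord n) : ℝ := ∑ a, D.nvec x a * pd a D.ell2 x

/-- The components `𝓡_{bd}` of the constraint tensor:
`R°_{(bd)} - 2 £_n Y_{bd} - (2 κ_n + tr_P U - n⁽²⁾ (n(ℓ⁽²⁾) - tr_P Y)) Y_{bd}
+ ∇°_{(b} (s_{d)} + 2 r_{d)}) - 2 r_b r_d + 4 r_{(b} s_{d)} - s_b s_d - (tr_P Y) U_{bd}
+ 2 P^{ac} U_{a(b} (2 Y_{d)c} + F_{d)c}) + n⁽²⁾ ((s_{(b} - 3 r_{(b}) ∇°_{d)} ℓ⁽²⁾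
+ P^{ac} ((Y_{ab} + F_{ab}) (Y_{cd} + F_{cd}) - 2 F_{ab} F_{cd}))`. -/
def constraint (x : Coord n) (b d : Fin n) : ℝ :=
  (1 / 2) * (ricci D.connection x b d + ricci D.connection x d b)
    - 2 * lie2 D.nvec D.Y x b d
    - (2 * D.kappa x + D.trP D.U x - D.n2 x * (D.nell2 x - D.trP D.Y x)) * D.Y x b d
    + (1 / 2) * (covDerivForm D.connection (fun y f => D.s y f + 2 * D.r y f) x b d
      + covDerivForm D.connection (fun y f => D.s y f + 2 * D.r y f) x d b)
    - 2 * D.r x b * D.r x d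
    + 2 * (D.r x b * D.s x d + D.r x d * D.s x b)
    - D.s x b * D.s x d
    - D.trP D.Y x * D.U x b d
    + ∑ a, ∑ c, D.P x a c * (D.U x a b * (2 * D.Y x d c + D.F x d c)
      + D.U x a d * (2 * D.Y x b c + D.F x b c))
    + D.n2 x * ((1 / 2) * ((D.s x b - 3 * D.r x b) * pd d D.ell2 x
        + (D.s x d - 3 * D.r x d) * pd b D.ell2 x)
      + ∑ a, ∑ c, D.P x a c * ((D.Y x a b + D.F x a b) * (D.Y x c d + D.F x c d)
        - 2 * D.F x a b * D.F x c d))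

/-- The equations that define the metric hypersurface connection, for symbols `Γ`, at the
point `x`: vanishing torsion, `∇°_a γ_{bc} = -U_{ab} ℓ_c - U_{ac} ℓ_b` and
`∇°_a ℓ_b + ∇°_b ℓ_a = -2 ℓ⁽²⁾ U_{ab}`. -/
structure IsMetricHypersurfaceConnection (Γ : Coord n → Fin n → Fin n → Fin n → ℝ)
    (x : Coord n) : Prop where
  torsionFree : ∀ c a b, Γ x c a b = Γ x c b a
  deriv_γ : ∀ a b c, covDerivTensor Γ D.γ x a b c
    = -D.U x a b * D.ell x c - D.U x a c * D.ell x b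
  deriv_ell : ∀ a b, covDerivForm Γ D.ell x a b + covDerivForm Γ D.ell x b a
    = -2 * D.ell2 x * D.U x a b

end LocalData
end HypData
namespace HypData

theorem pd_comp {n m : ℕ} {f : Coord m → ℝ} {F : Coord n → Coord m} {x : Coord n}
    (hf : DifferentiableAt ℝ f (F x)) (hF : DifferentiableAt ℝ F x) (a : Fin n) :
    pd a (fun y => f (F y)) x = ∑ lam, pd lam f (F x) * pd a (fun y => F y lam) x := by
  have h1 : pd a (fun y => f (F y)) x
      = fderiv ℝ f (F x) (fderiv ℝ F x (EuclideanSpace.single a 1)) := by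
    unfold pd
    rw [show (fun y => f (F y)) = f ∘ F from rfl, fderiv_comp x hf hF]
    rfl
  have h2 : ∀ lam, pd a (fun y => F y lam) x
      = (fderiv ℝ F x (EuclideanSpace.single a 1)) lam := by
    intro lam
    have := ((EuclideanSpace.proj (𝕜 := ℝ) lam : Coord m →L[ℝ] ℝ).hasFDerivAt.comp x
      hF.hasFDerivAt).fderiv
    unfold pd
    rw [show (fun y => F y lam) = (EuclideanSpace.proj (𝕜 := ℝ) lam : Coord m →L[ℝ] ℝ) ∘ F from rfl,
      this]
    rfl
  rw [h1]
  set v := fderiv ℝ F x (EuclideanSpace.single a 1)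
  have h3 : v = ∑ lam, v lam • EuclideanSpace.single lam (1 : ℝ) := by
    ext i
    simp [Finset.sum_apply, Pi.single_apply]
  conv_lhs => rw [h3, map_sum]
  refine Finset.sum_congr rfl fun lam _ => ?_
  rw [map_smul, h2, smul_eq_mul, mul_comm]
  rfl

/-- If the vector field `Z` along `F` is the restriction of a vector field `W` near `F x`, then
`pullbackLie G F Z` is the pull-back by `F` of the Lie derivative of `G` along `W`. -/
theorem pullbackLie_eq {n m : ℕ} (G : Coord m → Fin m → Fin m → ℝ)
    {F : Coord n → Coord m} {Z : Coord n → Fin m → ℝ} {W : Coord m → Fin m → ℝ} {x : Coord n}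
    (hF : DifferentiableAt ℝ F x) (hW : ∀ μ, DifferentiableAt ℝ (fun y => W y μ) (F x))
    (hZ : ∀ᶠ y in 𝓝 x, Z y = W (F y)) (a b : Fin n) :
    pullbackLie G F Z x a b = ∑ μ, ∑ ν, lie2 W G (F x) μ ν
      * pd a (fun y => F y μ) x * pd b (fun y => F y ν) x := by
  have hz : Z x = W (F x) := hZ.self_of_nhds
  have hd : ∀ (c : Fin n) μ, pd c (fun y => Z y μ) x
      = ∑ lam, pd lam (fun y => W y μ) (F x) * pd c (fun y => F y lam) x := by
    intro c μ
    rw [← pd_comp (f := fun y => W y μ) (hW μ) hF c]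
    unfold pd
    rw [Filter.EventuallyEq.fderiv_eq (hZ.mono fun y hy => congrFun hy μ)]
  simp only [pullbackLie, lie2, hd, hz]
  set w := fun lam => W (F x) lam
  set dG := fun lam μ ν => pd lam (fun y => G y μ ν) (F x)
  set dW := fun lam μ => pd lam (fun y => W y μ) (F x)
  set p := fun μ => pd a (fun y => F y μ) x
  set q := fun ν => pd b (fun y => F y ν) x
  change (∑ μ, ∑ ν, ((∑ lam, w lam * dG lam μ ν) * p μ * q ν + G (F x) μ ν *
    ((∑ lam, dW lam μ * p lam) * q ν + p μ * ∑ lam, dW lam ν * q lam)))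
    = ∑ μ, ∑ ν, (∑ c, (w c * dG c μ ν + G (F x) c ν * dW μ c + G (F x) μ c * dW ν c)) * p μ * q ν
  simp only [Finset.sum_add_distrib, add_mul, mul_add, Finset.mul_sum, Finset.sum_mul]
  rw [add_assoc]
  congr 1
  congr 1
  · calc ∑ μ, ∑ ν, ∑ i, G (F x) μ ν * (dW i μ * p i * q ν)
        = ∑ μ, ∑ i, ∑ ν, G (F x) μ ν * (dW i μ * p i * q ν) :=
          Finset.sum_congr rfl fun _ _ => Finset.sum_comm
      _ = ∑ i, ∑ μ, ∑ ν, G (F x) μ ν * (dW i μ * p i * q ν) := Finset.sum_comm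
      _ = ∑ i, ∑ ν, ∑ μ, G (F x) μ ν * (dW i μ * p i * q ν) :=
          Finset.sum_congr rfl fun _ _ => Finset.sum_comm
      _ = _ := by
          refine Finset.sum_congr rfl fun i _ => Finset.sum_congr rfl fun ν _ =>
            Finset.sum_congr rfl fun μ _ => by ring
  · refine Finset.sum_congr rfl fun μ _ => ?_
    rw [Finset.sum_comm]
    refine Finset.sum_congr rfl fun i _ => Finset.sum_congr rfl fun ν _ => by ring

namespace LocalData

variable {n : ℕ} (D : LocalData n)

theorem A_transpose {x : Coord n} (hs : ∀ a b, D.γ x a b = D.γ x b a) :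
    (D.A x).transpose = D.A x := by
  ext i j
  rcases i with i | i <;> rcases j with j | j <;>
    simp [A, Matrix.transpose_apply, Matrix.fromBlocks]
  exact hs j i

theorem A_inv_symm {x : Coord n} (hs : ∀ a b, D.γ x a b = D.γ x b a) (i j : Fin n ⊕ Unit) :
    (D.A x)⁻¹ i j = (D.A x)⁻¹ j i := by
  have : ((D.A x)⁻¹).transpose = (D.A x)⁻¹ := by
    rw [Matrix.transpose_nonsing_inv, D.A_transpose hs]
  exact congrFun (congrFun this j) i

/-- `γ_{ab} n^b + n⁽²⁾ ℓ_a = 0`. -/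
theorem γ_nvec {x : Coord n} (hA : (D.A x).det ≠ 0) (a : Fin n) :
    ∑ b, D.γ x a b * D.nvec x b + D.n2 x * D.ell x a = 0 := by
  have h := congrFun (congrFun (Matrix.mul_nonsing_inv (D.A x) hA.isUnit) (Sum.inl a)) (Sum.inr ())
  simp [Matrix.mul_apply, Fintype.sum_sum_type] at h
  rw [← h]
  simp [A, nvec, n2, mul_comm]

/-- `ℓ_a n^a + n⁽²⁾ ℓ⁽²⁾ = 1`. -/
theorem ell_nvec {x : Coord n} (hA : (D.A x).det ≠ 0) :
    ∑ a, D.ell x a * D.nvec x a + D.n2 x * D.ell2 x = 1 := by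
  have h := congrFun (congrFun (Matrix.mul_nonsing_inv (D.A x) hA.isUnit) (Sum.inr ())) (Sum.inr ())
  simp [Matrix.mul_apply, Fintype.sum_sum_type] at h
  rw [← h]
  simp [A, nvec, n2, mul_comm]

/-- `P^{ab} ℓ_b + ℓ⁽²⁾ n^a = 0`. -/
theorem P_ell {x : Coord n} (hA : (D.A x).det ≠ 0) (a : Fin n) :
    ∑ b, D.P x a b * D.ell x b + D.ell2 x * D.nvec x a = 0 := by
  have h := congrFun (congrFun (Matrix.nonsing_inv_mul (D.A x) hA.isUnit) (Sum.inl a)) (Sum.inr ())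
  simp [Matrix.mul_apply, Fintype.sum_sum_type] at h
  rw [← h]
  simp [A, nvec, P, mul_comm]

/-- `P^{ab} γ_{bc} + n^a ℓ_c = δ^a_c`. -/
theorem P_γ {x : Coord n} (hA : (D.A x).det ≠ 0) (a c : Fin n) :
    ∑ b, D.P x a b * D.γ x b c + D.nvec x a * D.ell x c = if a = c then 1 else 0 := by
  have h := congrFun (congrFun (Matrix.nonsing_inv_mul (D.A x) hA.isUnit) (Sum.inl a)) (Sum.inl c)
  simp [Matrix.mul_apply, Fintype.sum_sum_type, Matrix.one_apply] at h
  rw [← h]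
  simp [A, nvec, P]

theorem differentiableAt_det {ι : Type*} [Fintype ι] [DecidableEq ι]
    {B : Coord n → Matrix ι ι ℝ} {x : Coord n}
    (hB : ∀ i j, DifferentiableAt ℝ (fun y => B y i j) x) :
    DifferentiableAt ℝ (fun y => (B y).det) x := by
  simp only [Matrix.det_apply']
  refine DifferentiableAt.fun_sum fun σ _ => DifferentiableAt.mul (by fun_prop) ?_
  have := (HasFDerivAt.finsetProd (u := Finset.univ)
    fun i _ => (hB (σ i) i).hasFDerivAt).differentiableAt
  convert this using 1

theorem differentiableAt_inv {ι : Type*} [Fintype ι] [DecidableEq ι]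
    {B : Coord n → Matrix ι ι ℝ} {x : Coord n}
    (hB : ∀ i j, DifferentiableAt ℝ (fun y => B y i j) x) (h0 : (B x).det ≠ 0) (i j : ι) :
    DifferentiableAt ℝ (fun y => (B y)⁻¹ i j) x := by
  simp only [Matrix.inv_def, Matrix.smul_apply, Ring.inverse_eq_inv', smul_eq_mul,
    Matrix.adjugate_apply]
  refine ((differentiableAt_det hB).inv h0).mul (differentiableAt_det fun k l => ?_)
  by_cases hk : k = j
  · subst hk
    simp
  · simpa [Matrix.updateRow_ne hk] using hB k l

/-- Component functions that are differentiable at `x`, with `γ` symmetric and `𝓐`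
non-degenerate near `x`. -/
structure IsRegularAt (x : Coord n) : Prop where
  diff_γ : ∀ a b, DifferentiableAt ℝ (fun y => D.γ y a b) x
  diff_ell : ∀ a, DifferentiableAt ℝ (fun y => D.ell y a) x
  diff_ell2 : DifferentiableAt ℝ D.ell2 x
  symm : ∀ᶠ y in 𝓝 x, ∀ a b, D.γ y a b = D.γ y b a
  nondegenerate : ∀ᶠ y in 𝓝 x, (D.A y).det ≠ 0

variable {D}

theorem IsRegularAt.diff_A {x : Coord n} (h : D.IsRegularAt x) (i j : Fin n ⊕ Unit) :
    DifferentiableAt ℝ (fun y => D.A y i j) x := by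
  rcases i with i | i <;> rcases j with j | j
  · exact h.diff_γ i j
  · exact h.diff_ell i
  · exact h.diff_ell j
  · exact h.diff_ell2

theorem IsRegularAt.U_eq {x : Coord n} (h : D.IsRegularAt x) (a b : Fin n) :
    D.U x a b = -(1 / 2) * ∑ c, D.nvec x c * (pd a (fun y => D.γ y b c) x
        + pd b (fun y => D.γ y a c) x - pd c (fun y => D.γ y a b) x)
      - (1 / 2) * D.n2 x * (pd a (fun y => D.ell y b) x + pd b (fun y => D.ell y a) x) := by
  have hn : ∀ c, DifferentiableAt ℝ (fun y => D.nvec y c) x := fun c =>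
    differentiableAt_inv h.diff_A h.nondegenerate.self_of_nhds _ _
  have hn2 : DifferentiableAt ℝ D.n2 x :=
    differentiableAt_inv h.diff_A h.nondegenerate.self_of_nhds _ _
  have key : ∀ a b, ∑ c, (D.γ x b c * pd a (fun y => D.nvec y c) x
      + D.nvec x c * pd a (fun y => D.γ y b c) x)
      + (D.n2 x * pd a (fun y => D.ell y b) x + D.ell x b * pd a D.n2 x) = 0 := by
    intro a b
    have e : (fun y => ∑ c, D.γ y b c * D.nvec y c + D.n2 y * D.ell y b) =ᶠ[𝓝 x]
        fun _ => (0 : ℝ) := h.nondegenerate.mono fun y hy => D.γ_nvec hy b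
    have e' := congrArg (fun L : Coord n →L[ℝ] ℝ => L (EuclideanSpace.single a (1 : ℝ))) (e.fderiv_eq (𝕜 := ℝ))
    have hc : ∀ c ∈ Finset.univ, DifferentiableAt ℝ (fun y => D.γ y b c * D.nvec y c) x :=
      fun c _ => (h.diff_γ b c).mul (hn c)
    rw [fderiv_fun_add (DifferentiableAt.fun_sum hc) (hn2.fun_mul (h.diff_ell b)), fderiv_fun_sum hc,
      fderiv_fun_mul hn2 (h.diff_ell b)] at e'
    simp only [fderiv_fun_mul (h.diff_γ b _) (hn _)] at e'
    simpa [pd] using! e'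
  have hsym : ∀ a b c, pd c (fun y => D.γ y a b) x = pd c (fun y => D.γ y b a) x := by
    intro a b c
    unfold pd
    rw [Filter.EventuallyEq.fderiv_eq (f₁ := fun y => D.γ y a b) (h.symm.mono fun y hy => hy a b)]
  have hs0 : ∀ a b, D.γ x a b = D.γ x b a := h.symm.self_of_nhds
  have k1 := key a b
  have k2 := key b a
  simp only [U, lie2]
  simp only [Finset.sum_add_distrib, Finset.sum_sub_distrib, mul_add, mul_sub] at k1 k2 ⊢
  have t1 : ∑ c, D.γ x c b * pd a (fun y => D.nvec y c) x
      = ∑ c, D.γ x b c * pd a (fun y => D.nvec y c) x :=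
    Finset.sum_congr rfl fun c _ => by rw [hs0]
  rw [t1]
  linear_combination (1 / 2) * k1 + (1 / 2) * k2

theorem IsRegularAt.γ_connection {x : Coord n} (h : D.IsRegularAt x) (e a b : Fin n) :
    ∑ d, D.γ x e d * D.connection x d a b = (1 / 2) * (pd a (fun y => D.γ y b e) x
      + pd b (fun y => D.γ y a e) x - pd e (fun y => D.γ y a b) x) + D.ell x e * D.U x a b := by
  have hA := h.nondegenerate.self_of_nhds
  have hT := h.symm.self_of_nhds
  have hs0 : ∀ a b, D.γ x a b = D.γ x b a := hT
  have hP : ∀ c, ∑ d, D.γ x e d * D.P x d c = (if c = e then 1 else 0)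
      - D.nvec x c * D.ell x e := by
    intro c
    rw [← D.P_γ hA c e]
    simp only [add_sub_cancel_right]
    refine Finset.sum_congr rfl fun d _ => ?_
    rw [hs0 e d, mul_comm]
    congr 1
    exact D.A_inv_symm hT _ _
  have hn := D.γ_nvec hA e
  set K := fun d => pd a (fun y => D.γ y b d) x + pd b (fun y => D.γ y a d) x
      - pd d (fun y => D.γ y a b) x
  set L := pd a (fun y => D.ell y b) x + pd b (fun y => D.ell y a) x
  have hU : D.U x a b = -(1 / 2) * ∑ c, D.nvec x c * K c - (1 / 2) * D.n2 x * L := h.U_eq a b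
  have e1 : ∑ d, D.γ x e d * D.connection x d a b
      = (1 / 2) * ∑ c, (∑ d, D.γ x e d * D.P x d c) * K c
        + (1 / 2) * (∑ d, D.γ x e d * D.nvec x d) * L := by
    change ∑ d, D.γ x e d * ((1 / 2) * ∑ c, D.P x d c * K c + (1 / 2) * D.nvec x d * L) = _
    simp only [mul_add, Finset.sum_add_distrib, Finset.mul_sum, Finset.sum_mul]
    rw [Finset.sum_comm]
    congr 1
    · exact Finset.sum_congr rfl fun c _ => Finset.sum_congr rfl fun d _ => by ring
    · exact Finset.sum_congr rfl fun d _ => by ring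
  have e2 : ∑ c, (∑ d, D.γ x e d * D.P x d c) * K c
      = K e - D.ell x e * ∑ c, D.nvec x c * K c := by
    simp only [hP, sub_mul, Finset.sum_sub_distrib, ite_mul, one_mul, zero_mul,
      Finset.sum_ite_eq', Finset.mem_univ, if_true, Finset.mul_sum]
    congr 1
    exact Finset.sum_congr rfl fun c _ => by ring
  rw [e1, e2, hU]
  change _ = (1 / 2) * K e + _
  linear_combination (1 / 2) * L * hn

theorem IsRegularAt.ell_connection {x : Coord n} (h : D.IsRegularAt x) (a b : Fin n) :
    ∑ d, D.ell x d * D.connection x d a b = (1 / 2) * (pd a (fun y => D.ell y b) x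
      + pd b (fun y => D.ell y a) x) + D.ell2 x * D.U x a b := by
  have hA := h.nondegenerate.self_of_nhds
  have hT := h.symm.self_of_nhds
  have hP : ∀ c, ∑ d, D.ell x d * D.P x d c = - (D.ell2 x * D.nvec x c) := by
    intro c
    rw [eq_neg_iff_add_eq_zero, ← D.P_ell hA c]
    congr 1
    refine Finset.sum_congr rfl fun d _ => ?_
    rw [mul_comm]
    congr 1
    exact D.A_inv_symm hT _ _
  have hn := D.ell_nvec hA
  set K := fun d => pd a (fun y => D.γ y b d) x + pd b (fun y => D.γ y a d) x
      - pd d (fun y => D.γ y a b) x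
  set L := pd a (fun y => D.ell y b) x + pd b (fun y => D.ell y a) x
  have hU : D.U x a b = -(1 / 2) * ∑ c, D.nvec x c * K c - (1 / 2) * D.n2 x * L := h.U_eq a b
  have e1 : ∑ d, D.ell x d * D.connection x d a b
      = (1 / 2) * ∑ c, (∑ d, D.ell x d * D.P x d c) * K c
        + (1 / 2) * (∑ d, D.ell x d * D.nvec x d) * L := by
    change ∑ d, D.ell x d * ((1 / 2) * ∑ c, D.P x d c * K c + (1 / 2) * D.nvec x d * L) = _
    simp only [mul_add, Finset.sum_add_distrib, Finset.mul_sum, Finset.sum_mul]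
    rw [Finset.sum_comm]
    congr 1
    · exact Finset.sum_congr rfl fun c _ => Finset.sum_congr rfl fun d _ => by ring
    · exact Finset.sum_congr rfl fun d _ => by ring
  have e2 : ∑ c, (∑ d, D.ell x d * D.P x d c) * K c
      = - D.ell2 x * ∑ c, D.nvec x c * K c := by
    simp only [hP, Finset.mul_sum]
    exact Finset.sum_congr rfl fun c _ => by ring
  rw [e1, e2, hU]
  linear_combination (1 / 2) * L * hn

theorem connection_spec {x : Coord n} (h : D.IsRegularAt x) :
    D.IsMetricHypersurfaceConnection D.connection x := by
  have hs0 : ∀ a b, D.γ x a b = D.γ x b a := h.symm.self_of_nhds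
  have hsym : ∀ a b c, pd c (fun y => D.γ y a b) x = pd c (fun y => D.γ y b a) x := by
    intro a b c
    unfold pd
    rw [Filter.EventuallyEq.fderiv_eq (f₁ := fun y => D.γ y a b) (h.symm.mono fun y hy => hy a b)]
  have flip : ∀ a b c, ∑ d, D.connection x d a b * D.γ x d c
      = ∑ d, D.γ x c d * D.connection x d a b := fun a b c =>
    Finset.sum_congr rfl fun d _ => by rw [hs0 d c, mul_comm]
  have flip' : ∀ a b c, ∑ d, D.connection x d a b * D.γ x c d
      = ∑ d, D.γ x c d * D.connection x d a b := fun a b c =>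
    Finset.sum_congr rfl fun d _ => by rw [mul_comm]
  refine ⟨fun c a b => ?_, fun a b c => ?_, fun a b => ?_⟩
  · simp only [connection]
    congr 1
    · congr 1
      refine Finset.sum_congr rfl fun d _ => ?_
      rw [hsym a b d]
      ring
    · ring
  · simp only [covDerivTensor, Finset.sum_add_distrib, flip, flip', h.γ_connection]
    rw [hsym c b a]
    ring
  · have f : ∀ a b, ∑ d, D.connection x d a b * D.ell x d
        = ∑ d, D.ell x d * D.connection x d a b := fun a b =>
      Finset.sum_congr rfl fun d _ => mul_comm _ _
    have uU : D.U x b a = D.U x a b := by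
      rw [h.U_eq, h.U_eq]
      simp only [hsym b a]
      congr 1
      · congr 1
        refine Finset.sum_congr rfl fun c _ => by ring
      · ring
    simp only [covDerivForm, f, h.ell_connection, uU]
    ring

theorem connection_unique {x : Coord n} (h : D.IsRegularAt x)
    {Γ : Coord n → Fin n → Fin n → Fin n → ℝ} (hΓ : D.IsMetricHypersurfaceConnection Γ x) :
    Γ x = D.connection x := by
  have hA := h.nondegenerate.self_of_nhds
  have hs0 : ∀ a b, D.γ x a b = D.γ x b a := h.symm.self_of_nhds
  have h0 := connection_spec h
  -- the difference of two solutions is annihilated by `γ` and `ℓ`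
  have hsplit : ∀ {Γ : Coord n → Fin n → Fin n → Fin n → ℝ},
      D.IsMetricHypersurfaceConnection Γ x → ∀ a b c,
      ∑ d, D.γ x c d * Γ x d a b = (1 / 2) * (pd a (fun y => D.γ y b c) x
        + pd b (fun y => D.γ y c a) x - pd c (fun y => D.γ y a b) x) + D.ell x c *
          ((1 / 2) * (D.U x a b + D.U x b a))
        + D.ell x b * ((1 / 2) * (D.U x a c - D.U x c a))
        + D.ell x a * ((1 / 2) * (D.U x b c - D.U x c b)) := by
    intro Γ hΓ a b c
    have e1 := hΓ.deriv_γ a b c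
    have e2 := hΓ.deriv_γ b c a
    have e3 := hΓ.deriv_γ c a b
    simp only [covDerivTensor, Finset.sum_add_distrib] at e1 e2 e3
    have f : ∀ a b c, ∑ d, Γ x d a b * D.γ x d c = ∑ d, D.γ x c d * Γ x d a b := fun a b c =>
      Finset.sum_congr rfl fun d _ => by rw [hs0 d c, mul_comm]
    have f' : ∀ a b c, ∑ d, Γ x d a b * D.γ x c d = ∑ d, D.γ x c d * Γ x d a b := fun a b c =>
      Finset.sum_congr rfl fun d _ => by rw [mul_comm]
    have t : ∀ a b c, ∑ d, D.γ x c d * Γ x d b a = ∑ d, D.γ x c d * Γ x d a b := fun a b c =>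
      Finset.sum_congr rfl fun d _ => by rw [hΓ.torsionFree d b a]
    simp only [f, f'] at e1 e2 e3
    rw [t a b c] at e2
    rw [t a c b] at e3
    rw [t b c a] at e3
    linear_combination -(1 / 2) * e1 - (1 / 2) * e2 + (1 / 2) * e3
  have hsplit' : ∀ {Γ : Coord n → Fin n → Fin n → Fin n → ℝ},
      D.IsMetricHypersurfaceConnection Γ x → ∀ a b,
      ∑ d, D.ell x d * Γ x d a b = (1 / 2) * (pd a (fun y => D.ell y b) x
        + pd b (fun y => D.ell y a) x) + D.ell2 x * D.U x a b := by
    intro Γ hΓ a b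
    have e1 := hΓ.deriv_ell a b
    simp only [covDerivForm] at e1
    have f : ∀ a b, ∑ d, Γ x d a b * D.ell x d = ∑ d, D.ell x d * Γ x d a b := fun a b =>
      Finset.sum_congr rfl fun d _ => mul_comm _ _
    have t : ∑ d, D.ell x d * Γ x d b a = ∑ d, D.ell x d * Γ x d a b :=
      Finset.sum_congr rfl fun d _ => by rw [hΓ.torsionFree d b a]
    rw [f, f, t] at e1
    linear_combination -(1 / 2) * e1
  funext c a b
  have recon : ∀ V : Fin n → ℝ, V c = ∑ e, D.P x c e * (∑ d, D.γ x e d * V d)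
      + D.nvec x c * ∑ d, D.ell x d * V d := by
    intro V
    have e1 : ∑ d, (∑ e, D.P x c e * D.γ x e d + D.nvec x c * D.ell x d) * V d = V c := by
      simp [D.P_γ hA]
    rw [← e1]
    simp only [add_mul, Finset.sum_add_distrib, Finset.sum_mul, Finset.mul_sum]
    rw [Finset.sum_comm]
    congr 1
    · exact Finset.sum_congr rfl fun _ _ => Finset.sum_congr rfl fun _ _ => by ring
    · exact Finset.sum_congr rfl fun _ _ => by ring
  have r1 := recon fun d => Γ x d a b
  have r2 := recon fun d => D.connection x d a b
  simp only [hsplit hΓ, hsplit' hΓ] at r1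
  simp only [hsplit h0, hsplit' h0] at r2
  exact r1.trans r2.symm

end LocalData
end HypData

namespace HypData

/-! ### Manifolds -/

section Charts

variable {m : ℕ} {M : Type*} [TopologicalSpace M] [ChartedSpace (Coord m) M]

/-- The coordinate vector `∂_a` of the chart `e`, at the point with coordinates `x`. -/
def coordVec (e : OpenPartialHomeomorph M (Coord m)) (x : Coord m) (a : Fin m) :
    TangentSpace (𝓡 m) (e.symm x) :=
  mfderiv (𝓡 m) (𝓡 m) e.symm x (EuclideanSpace.single a (1 : ℝ) : Coord m)

/-- The components in the chart `e` of a tangent vector `v` at `q`. -/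
def comps (e : OpenPartialHomeomorph M (Coord m)) (q : M) (v : TangentSpace (𝓡 m) q) : Coord m :=
  mfderiv (𝓡 m) (𝓡 m) e q v

/-- The chart `e` belongs to the smooth structure, and `q` lies in its domain. -/
def IsChartAt (e : OpenPartialHomeomorph M (Coord m)) (q : M) : Prop :=
  e ∈ IsManifold.maximalAtlas (𝓡 m) ∞ M ∧ q ∈ e.source

end Charts

/-- A smooth symmetric 2-covariant tensor field. -/
structure SymTensorField (m : ℕ) (M : Type*) [TopologicalSpace M] [ChartedSpace (Coord m) M]
    [IsManifold (𝓡 m) ∞ M] where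
  val (q : M) : TangentSpace (𝓡 m) q →L[ℝ] TangentSpace (𝓡 m) q →L[ℝ] ℝ
  symm (q : M) (v w : TangentSpace (𝓡 m) q) : val q v w = val q w v
  contMDiff : ContMDiff (𝓡 m) ((𝓡 m).prod 𝓘(ℝ, Coord m →L[ℝ] Coord m →L[ℝ] ℝ)) ∞
    (fun q => Bundle.TotalSpace.mk' (Coord m →L[ℝ] Coord m →L[ℝ] ℝ)
      (E := fun q : M => TangentSpace (𝓡 m) q →L[ℝ] TangentSpace (𝓡 m) q →L[ℝ] ℝ) q (val q))

namespace SymTensorField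

variable {m : ℕ} {M : Type*} [TopologicalSpace M] [ChartedSpace (Coord m) M]
  [IsManifold (𝓡 m) ∞ M] (T : SymTensorField m M)

/-- The component functions `T_{ab} = T(∂_a, ∂_b)` in the chart `e`. -/
def inChart (e : OpenPartialHomeomorph M (Coord m)) (x : Coord m) (a b : Fin m) : ℝ :=
  T.val (e.symm x) (coordVec e x a) (coordVec e x b)

end SymTensorField

/-- A semi-Riemannian metric: a smooth, symmetric and non-degenerate 2-covariant tensor field. -/
structure SemiRiemannianMetric (m : ℕ) (M : Type*) [TopologicalSpace M]
    [ChartedSpace (Coord m) M] [IsManifold (𝓡 m) ∞ M] extends SymTensorField m M where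
  nondegenerate (q : M) (v : TangentSpace (𝓡 m) q) : (∀ w, val q v w = 0) → v = 0

namespace SemiRiemannianMetric

variable {m : ℕ} {M : Type*} [TopologicalSpace M] [ChartedSpace (Coord m) M]
  [IsManifold (𝓡 m) ∞ M] (g : SemiRiemannianMetric m M)

/-- The Ricci tensor `Ric(v, w)` at `q`, computed in the chart `e`. -/
def ric (e : OpenPartialHomeomorph M (Coord m)) (q : M) (v w : TangentSpace (𝓡 m) q) : ℝ :=
  ∑ b, ∑ d, ricci (christoffel (g.inChart e)) (e q) b d * comps e q v b * comps e q w d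

/-- The covariant Riemann tensor `Riem(v₁, v₂, v₃, v₄) = R_{abcd} v₁^a v₂^b v₃^c v₄^d` at `q`,
computed in the chart `e`. -/
def riem (e : OpenPartialHomeomorph M (Coord m)) (q : M)
    (v₁ v₂ v₃ v₄ : TangentSpace (𝓡 m) q) : ℝ :=
  ∑ a, ∑ b, ∑ c, ∑ d, riemannLow (g.inChart e) (e q) a b c d
    * comps e q v₁ a * comps e q v₂ b * comps e q v₃ c * comps e q v₄ d

end SemiRiemannianMetric

/-- Metric hypersurface data `{N, γ, ℓ, ℓ⁽²⁾}`: smooth fields such that the symmetric tensor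
`𝓐((W, a), (Z, b)) = γ(W, Z) + a ℓ(Z) + b ℓ(W) + a b ℓ⁽²⁾` on `T_pN × ℝ` is non-degenerate
at every point. -/
structure MetricHypersurfaceData (n : ℕ) (N : Type*) [TopologicalSpace N]
    [ChartedSpace (Coord n) N] [IsManifold (𝓡 n) ∞ N] where
  γ : SymTensorField n N
  ell (p : N) : TangentSpace (𝓡 n) p →L[ℝ] ℝ
  ell2 : N → ℝ
  contMDiff_ell : ContMDiff (𝓡 n) ((𝓡 n).prod 𝓘(ℝ, Coord n →L[ℝ] ℝ)) ∞
    (fun p => Bundle.TotalSpace.mk' (Coord n →L[ℝ] ℝ)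
      (E := fun p : N => TangentSpace (𝓡 n) p →L[ℝ] ℝ) p (ell p))
  contMDiff_ell2 : ContMDiff (𝓡 n) 𝓘(ℝ, ℝ) ∞ ell2
  nondegenerate (p : N) (W : TangentSpace (𝓡 n) p) (a : ℝ) :
    (∀ (Z : TangentSpace (𝓡 n) p) (b : ℝ),
      γ.val p W Z + a * ell p Z + b * ell p W + a * b * ell2 p = 0) → W = 0 ∧ a = 0

/-- Hypersurface data `{N, γ, ℓ, ℓ⁽²⁾, Y}`. -/
structure HypersurfaceData (n : ℕ) (N : Type*) [TopologicalSpace N]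
    [ChartedSpace (Coord n) N] [IsManifold (𝓡 n) ∞ N] extends MetricHypersurfaceData n N where
  Y : SymTensorField n N

namespace HypersurfaceData

variable {n : ℕ} {N : Type*} [TopologicalSpace N] [ChartedSpace (Coord n) N]
  [IsManifold (𝓡 n) ∞ N] (D : HypersurfaceData n N)

/-- The component functions of the data in the chart `e`. -/
def inChart (e : OpenPartialHomeomorph N (Coord n)) : LocalData n where
  γ := D.γ.inChart e
  ell x a := D.ell (e.symm x) (coordVec e x a)
  ell2 x := D.ell2 (e.symm x)
  Y := D.Y.inChart e

/-- The constraint tensor `𝓡(X, W)` at `p`, computed in the chart `e`. -/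
def constraintTensor (e : OpenPartialHomeomorph N (Coord n)) (p : N)
    (X W : TangentSpace (𝓡 n) p) : ℝ :=
  ∑ b, ∑ d, (D.inChart e).constraint (e p) b d * comps e p X b * comps e p W d

/-- The point `p` is null: the radical of `γ` at `p` is one-dimensional. -/
def IsNullPoint (p : N) : Prop :=
  Module.finrank ℝ (D.γ.val p).toLinearMap.ker = 1

end HypersurfaceData

section Embedded

variable {n : ℕ} {N : Type*} [TopologicalSpace N] [ChartedSpace (Coord n) N]
  [IsManifold (𝓡 n) ∞ N] {M : Type*} [TopologicalSpace M] [ChartedSpace (Coord (n + 1)) M]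
  [IsManifold (𝓡 (n + 1)) ∞ M]

/-- The push-forward `φ_⋆ X` of a tangent vector at `p`. -/
def push (φ : N → M) (p : N) (X : TangentSpace (𝓡 n) p) : TangentSpace (𝓡 (n + 1)) (φ p) :=
  mfderiv (𝓡 n) (𝓡 (n + 1)) φ p X

/-- `ζ` is a rigging: a smooth vector field along the map `φ`, transversal to its image. -/
structure IsRigging (φ : N → M) (ζ : ∀ p : N, TangentSpace (𝓡 (n + 1)) (φ p)) : Prop where
  contMDiff : ContMDiff (𝓡 n) (𝓡 (n + 1)).tangent ∞
    (fun p => (⟨φ p, ζ p⟩ : TangentBundle (𝓡 (n + 1)) M))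
  transversal (p : N) (X : TangentSpace (𝓡 n) p) : push φ p X ≠ ζ p

/-- The component `(φ^⋆ £_ζ g)(∂_a, ∂_b)` at the point with coordinates `x`, in the charts
`e` of `N` and `e'` of `M`. -/
def pullbackLieMetric (g : SemiRiemannianMetric (n + 1) M) (φ : N → M)
    (ζ : ∀ p : N, TangentSpace (𝓡 (n + 1)) (φ p)) (e : OpenPartialHomeomorph N (Coord n))
    (e' : OpenPartialHomeomorph M (Coord (n + 1))) (x : Coord n) (a b : Fin n) : ℝ :=
  pullbackLie (g.inChart e') (fun y => e' (φ (e.symm y)))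
    (fun y μ => comps e' (φ (e.symm y)) (ζ (e.symm y)) μ) x a b

/-- The hypersurface data `D` is embedded in `(M, g)` with embedding `φ` and rigging `ζ`:
`φ^⋆ g = γ`, `φ^⋆ (g(ζ, ·)) = ℓ`, `φ^⋆ (g(ζ, ζ)) = ℓ⁽²⁾` and `½ φ^⋆ (£_ζ g) = Y`. -/
structure HypersurfaceData.IsEmbedded (D : HypersurfaceData n N)
    (g : SemiRiemannianMetric (n + 1) M) (φ : N → M)
    (ζ : ∀ p : N, TangentSpace (𝓡 (n + 1)) (φ p)) : Prop where
  isSmoothEmbedding : Manifold.IsSmoothEmbedding (𝓡 n) (𝓡 (n + 1)) ∞ φ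
  isRigging : IsRigging φ ζ
  pullback_γ (p : N) (X W : TangentSpace (𝓡 n) p) :
    g.val (φ p) (push φ p X) (push φ p W) = D.γ.val p X W
  pullback_ell (p : N) (X : TangentSpace (𝓡 n) p) :
    g.val (φ p) (ζ p) (push φ p X) = D.ell p X
  pullback_ell2 (p : N) : g.val (φ p) (ζ p) (ζ p) = D.ell2 p
  pullback_Y (p : N) (e : OpenPartialHomeomorph N (Coord n))
    (e' : OpenPartialHomeomorph M (Coord (n + 1))) (he : IsChartAt e p)
    (he' : IsChartAt e' (φ p)) (a b : Fin n) :
    (1 / 2) * pullbackLieMetric g φ ζ e e' (e p) a b = D.Y.inChart e (e p) a b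

/-- `η` is a normal covector of `φ(N)` at `φ(p)` with `η(ζ) = 1`. -/
def IsNormalCovector (φ : N → M) (ζ : ∀ p : N, TangentSpace (𝓡 (n + 1)) (φ p)) (p : N)
    (η : TangentSpace (𝓡 (n + 1)) (φ p) →L[ℝ] ℝ) : Prop :=
  (∀ X : TangentSpace (𝓡 n) p, η (push φ p X) = 0) ∧ η (ζ p) = 1

end Embedded

end HypData

namespace HypData

section

variable {m : ℕ} {M : Type*} [TopologicalSpace M] [ChartedSpace (Coord m) M]
  [IsManifold (𝓡 m) ∞ M]

theorem contMDiffOn_coordVec {e : OpenPartialHomeomorph M (Coord m)}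
    (he : e ∈ IsManifold.maximalAtlas (𝓡 m) ∞ M) (a : Fin m) :
    ContMDiffOn (𝓡 m) (𝓡 m).tangent ∞
      (fun x => Bundle.TotalSpace.mk' (Coord m) (E := fun q : M => TangentSpace (𝓡 m) q)
        (e.symm x) (coordVec e x a)) e.target := by
  have h1 := contMDiffOn_symm_of_mem_maximalAtlas he
  have h2 := h1.contMDiffOn_tangentMapWithin (m := ∞) le_rfl e.open_target.uniqueMDiffOn
  have h3 : ContMDiffOn (𝓡 m) (𝓡 m).tangent ∞
      (fun x : Coord m => Bundle.TotalSpace.mk' (Coord m)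
        (E := fun x : Coord m => TangentSpace (𝓡 m) x) x
        (EuclideanSpace.single a (1 : ℝ) : Coord m)) e.target :=
    contMDiffOn_vectorSpace_iff_contDiffOn.2 contDiffOn_const
  refine (h2.comp h3 fun x hx => hx).congr fun x hx => ?_
  simp only [Function.comp, tangentMapWithin, coordVec]
  rw [mfderivWithin_of_isOpen e.open_target hx]

theorem SymTensorField.contDiffOn_inChart (T : SymTensorField m M)
    {e : OpenPartialHomeomorph M (Coord m)} (he : e ∈ IsManifold.maximalAtlas (𝓡 m) ∞ M)
    (a b : Fin m) : ContDiffOn ℝ ∞ (fun x => T.inChart e x a b) e.target := by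
  rw [← contMDiffOn_iff_contDiffOn]
  have h1 : ContMDiffOn (𝓡 m) ((𝓡 m).prod 𝓘(ℝ, Coord m →L[ℝ] Coord m →L[ℝ] ℝ)) ∞
    (fun x => Bundle.TotalSpace.mk' (Coord m →L[ℝ] Coord m →L[ℝ] ℝ)
      (E := fun q : M => TangentSpace (𝓡 m) q →L[ℝ] TangentSpace (𝓡 m) q →L[ℝ] ℝ) (e.symm x)
        (T.val (e.symm x))) e.target :=
    T.contMDiff.comp_contMDiffOn (contMDiffOn_symm_of_mem_maximalAtlas he)
  have h2 := h1.clm_bundle_apply₂ (F₁ := Coord m) (F₂ := Coord m) (F₃ := ℝ)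
    (E₃ := Bundle.Trivial M ℝ)
    (contMDiffOn_coordVec he a) (contMDiffOn_coordVec he b)
  intro x hx
  have h3 := h2 x hx
  simp only [Bundle.contMDiffWithinAt_totalSpace] at h3
  exact h3.2

theorem mdifferentiable_chart {m : ℕ} {M : Type*} [TopologicalSpace M]
    [ChartedSpace (Coord m) M] {e : OpenPartialHomeomorph M (Coord m)}
    (he : e ∈ IsManifold.maximalAtlas (𝓡 m) ∞ M) : e.MDifferentiable (𝓡 m) (𝓡 m) :=
  ⟨(contMDiffOn_of_mem_maximalAtlas he).mdifferentiableOn (by simp),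
    (contMDiffOn_symm_of_mem_maximalAtlas he).mdifferentiableOn (by simp)⟩

/-- The coordinate vectors of a chart are a basis of the tangent space: components. -/
theorem comps_coordVec {m : ℕ} {M : Type*} [TopologicalSpace M]
    [ChartedSpace (Coord m) M] {e : OpenPartialHomeomorph M (Coord m)}
    (he : e ∈ IsManifold.maximalAtlas (𝓡 m) ∞ M) {x : Coord m} (hx : x ∈ e.target)
    (a : Fin m) : comps e (e.symm x) (coordVec e x a) = EuclideanSpace.single a 1 := by
  have h := (mdifferentiable_chart he).comp_symm_deriv hx
  exact congrArg (fun L : Coord m →L[ℝ] Coord m => L (EuclideanSpace.single a 1)) h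

theorem mfderiv_symm_eq_sum {m : ℕ} {M : Type*} [TopologicalSpace M]
    [ChartedSpace (Coord m) M] (e : OpenPartialHomeomorph M (Coord m)) (x z : Coord m) :
    (mfderiv (𝓡 m) (𝓡 m) e.symm x z : TangentSpace (𝓡 m) (e.symm x))
      = ∑ a, z a • coordVec e x a := by
  have h3 : z = ∑ a, z a • EuclideanSpace.single a (1 : ℝ) := by
    ext i
    simp [Finset.sum_apply, Pi.single_apply]
  let L : Coord m →L[ℝ] TangentSpace (𝓡 m) (e.symm x) := mfderiv (𝓡 m) (𝓡 m) e.symm x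
  change L z = ∑ a, z a • L (EuclideanSpace.single a (1 : ℝ))
  conv_lhs => rw [h3]
  simp only [map_sum, map_smul]

/-- The coordinate vectors of a chart are a basis of the tangent space: expansion. -/
theorem sum_comps_coordVec {e : OpenPartialHomeomorph M (Coord m)}
    (he : e ∈ IsManifold.maximalAtlas (𝓡 m) ∞ M) {x : Coord m} (hx : x ∈ e.target)
    (v : TangentSpace (𝓡 m) (e.symm x)) :
    ∑ a, comps e (e.symm x) v a • coordVec e x a = v := by
  have h := (mdifferentiable_chart he).symm_comp_deriv (e.map_target hx)
  rw [e.right_inv hx] at h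
  rw [← mfderiv_symm_eq_sum]
  exact congrArg (fun L : TangentSpace (𝓡 m) (e.symm x) →L[ℝ] TangentSpace (𝓡 m) (e.symm x)
    => L v) h

end

section

variable {n : ℕ} {N : Type*} [TopologicalSpace N] [ChartedSpace (Coord n) N]
  [IsManifold (𝓡 n) ∞ N] (D : HypersurfaceData n N)

theorem HypersurfaceData.contDiffOn_ell {e : OpenPartialHomeomorph N (Coord n)}
    (he : e ∈ IsManifold.maximalAtlas (𝓡 n) ∞ N) (a : Fin n) :
    ContDiffOn ℝ ∞ (fun x => (D.inChart e).ell x a) e.target := by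
  rw [← contMDiffOn_iff_contDiffOn]
  have h1 : ContMDiffOn (𝓡 n) ((𝓡 n).prod 𝓘(ℝ, Coord n →L[ℝ] ℝ)) ∞
    (fun x => Bundle.TotalSpace.mk' (Coord n →L[ℝ] ℝ)
      (E := fun q : N => TangentSpace (𝓡 n) q →L[ℝ] ℝ) (e.symm x)
        (D.ell (e.symm x))) e.target :=
    D.contMDiff_ell.comp_contMDiffOn (contMDiffOn_symm_of_mem_maximalAtlas he)
  have h2 := h1.clm_bundle_apply (F₁ := Coord n) (F₂ := ℝ)
    (E₂ := Bundle.Trivial N ℝ) (contMDiffOn_coordVec he a)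
  intro x hx
  have h3 := h2 x hx
  simp only [Bundle.contMDiffWithinAt_totalSpace] at h3
  exact h3.2

theorem HypersurfaceData.contDiffOn_ell2 {e : OpenPartialHomeomorph N (Coord n)}
    (he : e ∈ IsManifold.maximalAtlas (𝓡 n) ∞ N) :
    ContDiffOn ℝ ∞ (D.inChart e).ell2 e.target := by
  rw [← contMDiffOn_iff_contDiffOn]
  exact D.contMDiff_ell2.comp_contMDiffOn (contMDiffOn_symm_of_mem_maximalAtlas he)

theorem HypersurfaceData.det_ne_zero {e : OpenPartialHomeomorph N (Coord n)}
    (he : e ∈ IsManifold.maximalAtlas (𝓡 n) ∞ N) {x : Coord n} (hx : x ∈ e.target) :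
    ((D.inChart e).A x).det ≠ 0 := by
  intro h0
  obtain ⟨v, hv0, hv⟩ := Matrix.exists_mulVec_eq_zero_iff.2 h0
  have hγ := D.γ.symm (e.symm x)
  set W := ∑ a, v (Sum.inl a) • coordVec e x a with hW
  have hrow : ∀ a, D.γ.val (e.symm x) W (coordVec e x a)
      + v (Sum.inr ()) * D.ell (e.symm x) (coordVec e x a) = 0 := by
    intro a
    have := congrFun hv (Sum.inl a)
    simp [Matrix.mulVec, dotProduct, Fintype.sum_sum_type, LocalData.A,
      HypersurfaceData.inChart, SymTensorField.inChart] at this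
    rw [hγ, hW]
    simp only [map_sum, map_smul, smul_eq_mul]
    rw [← this, mul_comm (v (Sum.inr ()))]
    congr 1
    exact Finset.sum_congr rfl fun _ _ => mul_comm _ _
  have hlast : D.ell (e.symm x) W + v (Sum.inr ()) * D.ell2 (e.symm x) = 0 := by
    have := congrFun hv (Sum.inr ())
    simp [Matrix.mulVec, dotProduct, Fintype.sum_sum_type, LocalData.A,
      HypersurfaceData.inChart] at this
    rw [hW]
    simp only [map_sum, map_smul, smul_eq_mul]
    rw [← this, mul_comm (v (Sum.inr ()))]
    congr 1
    exact Finset.sum_congr rfl fun _ _ => mul_comm _ _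
  obtain ⟨hW0, hv1⟩ := D.nondegenerate (e.symm x) W (v (Sum.inr ())) fun Z b => by
    have h1 : D.γ.val (e.symm x) W Z + v (Sum.inr ()) * D.ell (e.symm x) Z = 0 := by
      rw [← sum_comps_coordVec he hx Z]
      simp only [map_sum, map_smul, smul_eq_mul, Finset.mul_sum, ← Finset.sum_add_distrib]
      refine Finset.sum_eq_zero fun a _ => ?_
      linear_combination comps e (e.symm x) Z a * hrow a
    linear_combination h1 + b * hlast
  refine hv0 (funext fun i => ?_)
  rcases i with a | _
  · have h1 : comps e (e.symm x) W = 0 := by rw [hW0]; exact map_zero _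
    have h2 : comps e (e.symm x) W = ∑ b, v (Sum.inl b) • EuclideanSpace.single b (1 : ℝ) := by
      have : comps e (e.symm x) W = ∑ b, v (Sum.inl b) • comps e (e.symm x) (coordVec e x b) := by
        rw [hW]
        let L : TangentSpace (𝓡 n) (e.symm x) →L[ℝ] Coord n := mfderiv (𝓡 n) (𝓡 n) e (e.symm x)
        change L _ = ∑ b, v (Sum.inl b) • L _
        simp only [map_sum, map_smul]
      rw [this]
      simp only [comps_coordVec he hx]
    have h3 := congrArg (fun z : Coord n => z a) (h1.symm.trans h2)
    simpa [Finset.sum_apply, Pi.single_apply] using h3.symm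
  · exact hv1

/-- In a chart, the components of hypersurface data satisfy the hypotheses under which
`LocalData.connection` is the metric hypersurface connection. -/
theorem HypersurfaceData.isRegularAt {e : OpenPartialHomeomorph N (Coord n)}
    (he : e ∈ IsManifold.maximalAtlas (𝓡 n) ∞ N) {x : Coord n} (hx : x ∈ e.target) :
    (D.inChart e).IsRegularAt x where
  diff_γ a b := ((D.γ.contDiffOn_inChart he a b).contDiffAt
    (e.open_target.mem_nhds hx)).differentiableAt (by simp)
  diff_ell a := ((D.contDiffOn_ell he a).contDiffAt
    (e.open_target.mem_nhds hx)).differentiableAt (by simp)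
  diff_ell2 := ((D.contDiffOn_ell2 he).contDiffAt
    (e.open_target.mem_nhds hx)).differentiableAt (by simp)
  symm := Filter.Eventually.of_forall fun _ _ _ => D.γ.symm _ _ _
  nondegenerate := (e.open_target.eventually_mem hx).mono fun _ hy => D.det_ne_zero he hy

end

end HypData

end

open HypData

/-!
Put `e_a = φ_⋆ ∂_a` and let `∇` be the Levi-Civita connection of `g`, pulled back by `φ`. Since the
matrix of scalar products of the frame `(e_a, ζ)` is `𝓐`, the blocks of `𝓐⁻¹` give the dual frame:
`θ^c = P^{ca} e_a + n^c ζ` and the normal vector `ν = n^a e_a + n⁽²⁾ ζ`, with `g(ν, ν) = n⁽²⁾`.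

The trace that defines `Ric(e_b, e_d)`, taken in this frame, contains the term
`n⁽²⁾ Riem(ζ, e_b, ζ, e_d)`. What remains after subtracting it involves only curvature operators of
planes tangent to the hypersurface (`ricci_sub_riemann`):
`g(θ^c, R(e_c, e_d) e_b) - n^c g(e_d, R(e_c, e_b) ζ)`. Such operators are commutators of covariant
derivatives along `φ` (`covAlong_comm`), so no derivative transversal to the hypersurface occurs.

The metric hypersurface connection and `Y` are designed for the Gauss equation
`∇_a e_b = ∇°_a ∂_b - Y_{ab} ν - U_{ab} ζ` (`covAlong_tangent`). The scalar products of `∇_a ζ` with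
the frame are `Y_{ab} + F_{ab}` and `½ ∂_a ℓ⁽²⁾`, those of `∇_a ν` follow from
`g(ν, e_b) = 0` and `g(ν, ζ) = 1`, and comparing the two gives `∇°_b n^c` (`covDerivVec_nvec`).
Inserting all this yields both curvature terms in terms of the data (`dualTangent_curvVec`,
`tangent_curvVec_rigging`). The left-hand side is symmetric in `b`, `d`, so the result may be
symmetrized; this removes `n^c ∇°_c F_{bd}` and the terms with `n^c U_{cb}`, and leaves the
constraint tensor (`ricci_sub_riemann_eq_constraint`).

At a null point the radical of `γ` is spanned by some `X` with `φ_⋆ X = ℓ(X) ν` and `ℓ(X) ≠ 0`, so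
that `ν` is tangent as well as normal to the hypersurface and `g(ν, ν) = 0`.
-/

namespace HypData

/-! ### Partial derivatives -/

section PartialDerivatives

variable {n : ℕ} {f g : Coord n → ℝ} {x : Coord n} {s : Set (Coord n)}

theorem pd_congr (h : f =ᶠ[𝓝 x] g) (a : Fin n) : pd a f x = pd a g x := by
  unfold pd
  rw [h.fderiv_eq]

@[simp] theorem pd_const (a : Fin n) (c : ℝ) (x : Coord n) : pd a (fun _ => c) x = 0 := by
  simp [pd]

theorem pd_add (hf : DifferentiableAt ℝ f x) (hg : DifferentiableAt ℝ g x) (a : Fin n) :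
    pd a (fun y => f y + g y) x = pd a f x + pd a g x := by
  unfold pd
  rw [fderiv_fun_add hf hg]
  rfl

theorem pd_sub (hf : DifferentiableAt ℝ f x) (hg : DifferentiableAt ℝ g x) (a : Fin n) :
    pd a (fun y => f y - g y) x = pd a f x - pd a g x := by
  unfold pd
  rw [fderiv_fun_sub hf hg]
  rfl

theorem pd_mul (hf : DifferentiableAt ℝ f x) (hg : DifferentiableAt ℝ g x) (a : Fin n) :
    pd a (fun y => f y * g y) x = pd a f x * g x + f x * pd a g x := by
  unfold pd
  rw [fderiv_fun_mul hf hg]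
  simp
  ring

theorem pd_sum {ι : Type*} {u : Finset ι} {f : ι → Coord n → ℝ}
    (hf : ∀ i ∈ u, DifferentiableAt ℝ (f i) x) (a : Fin n) :
    pd a (fun y => ∑ i ∈ u, f i y) x = ∑ i ∈ u, pd a (f i) x := by
  unfold pd
  rw [fderiv_fun_sum hf]
  simp

theorem contDiffOn_pd (hs : IsOpen s) (hf : ContDiffOn ℝ ∞ f s) (a : Fin n) :
    ContDiffOn ℝ ∞ (fun y => pd a f y) s :=
  (hf.fderiv_of_isOpen hs (m := ∞) (by simp)).clm_apply contDiffOn_const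

theorem differentiableAt_of_contDiffOn (hs : IsOpen s) (hf : ContDiffOn ℝ ∞ f s) (hx : x ∈ s) :
    DifferentiableAt ℝ f x :=
  (hf.contDiffAt (hs.mem_nhds hx)).differentiableAt (by simp)

theorem pd_comm (hs : IsOpen s) (hf : ContDiffOn ℝ ∞ f s) (hx : x ∈ s) (a b : Fin n) :
    pd a (fun y => pd b f y) x = pd b (fun y => pd a f y) x := by
  have h : ContDiffAt ℝ ∞ f x := hf.contDiffAt (hs.mem_nhds hx)
  have hd : DifferentiableAt ℝ (fderiv ℝ f) x :=
    (h.fderiv_right (m := 1) (by norm_cast)).differentiableAt (by simp)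
  have h2 := (h.isSymmSndFDerivAt (by simp; norm_cast)).eq (EuclideanSpace.single a 1)
    (EuclideanSpace.single b 1)
  unfold pd
  rw [fderiv_clm_apply hd (by fun_prop), fderiv_clm_apply hd (by fun_prop)]
  simpa using h2

/-- The partial derivatives of a coordinate function. -/
@[simp] theorem pd_coord (a b : Fin n) (x : Coord n) :
    pd a (fun y : Coord n => y b) x = if b = a then 1 else 0 := by
  have : fderiv ℝ (fun y : Coord n => y b) x = EuclideanSpace.proj b :=
    (EuclideanSpace.proj (𝕜 := ℝ) b : Coord n →L[ℝ] ℝ).fderiv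
  unfold pd
  rw [this]
  simp

theorem contDiffOn_det {ι : Type*} [Fintype ι] [DecidableEq ι] {B : Coord n → Matrix ι ι ℝ}
    (hB : ∀ i j, ContDiffOn ℝ ∞ (fun y => B y i j) s) :
    ContDiffOn ℝ ∞ (fun y => (B y).det) s := by
  simp only [Matrix.det_apply']
  exact ContDiffOn.sum fun σ _ => contDiffOn_const.mul (contDiffOn_prod fun i _ => hB _ _)

theorem contDiffOn_inv {ι : Type*} [Fintype ι] [DecidableEq ι] {B : Coord n → Matrix ι ι ℝ}
    (hB : ∀ i j, ContDiffOn ℝ ∞ (fun y => B y i j) s) (h0 : ∀ y ∈ s, (B y).det ≠ 0) (i j : ι) :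
    ContDiffOn ℝ ∞ (fun y => (B y)⁻¹ i j) s := by
  simp only [Matrix.inv_def, Matrix.smul_apply, Ring.inverse_eq_inv', smul_eq_mul,
    Matrix.adjugate_apply]
  refine ((contDiffOn_det hB).inv h0).mul (contDiffOn_det fun k l => ?_)
  by_cases hk : k = j
  · subst hk
    simp only [Matrix.updateRow_self]
    exact contDiffOn_const
  · simpa [Matrix.updateRow_ne hk] using hB k l

end PartialDerivatives

/-! ### The Levi-Civita connection in coordinates -/

section LeviCivita

variable {m : ℕ} {t : Set (Coord m)} {G : Coord m → Fin m → Fin m → ℝ}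

/-- `G` is a smooth, symmetric and non-degenerate tensor on the open set `t`. -/
structure IsMetricOn (G : Coord m → Fin m → Fin m → ℝ) (t : Set (Coord m)) : Prop where
  isOpen : IsOpen t
  contDiffOn : ∀ μ ν, ContDiffOn ℝ ∞ (fun y => G y μ ν) t
  symm : ∀ y ∈ t, ∀ μ ν, G y μ ν = G y ν μ
  nondegenerate : ∀ y ∈ t, (Matrix.of (G y)).det ≠ 0

variable (h : IsMetricOn G t)
include h

theorem IsMetricOn.pd_symm {x : Coord m} (hx : x ∈ t) (c μ ν : Fin m) :
    pd c (fun y => G y μ ν) x = pd c (fun y => G y ν μ) x :=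
  pd_congr ((h.isOpen.eventually_mem hx).mono fun y hy => h.symm y hy μ ν) c

theorem IsMetricOn.contDiffOn_christoffel (a b c : Fin m) :
    ContDiffOn ℝ ∞ (fun y => christoffel G y a b c) t := by
  unfold christoffel
  refine contDiffOn_const.mul (ContDiffOn.sum fun d _ => ?_)
  refine (contDiffOn_inv (B := fun y => Matrix.of (G y)) (fun i j => h.contDiffOn i j)
    h.nondegenerate a d).mul ?_
  exact ((contDiffOn_pd h.isOpen (h.contDiffOn _ _) _).add
    (contDiffOn_pd h.isOpen (h.contDiffOn _ _) _)).sub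
    (contDiffOn_pd h.isOpen (h.contDiffOn _ _) _)

theorem IsMetricOn.christoffel_symm {x : Coord m} (hx : x ∈ t) (a b c : Fin m) :
    christoffel G x a b c = christoffel G x a c b := by
  unfold christoffel
  congr 1
  refine Finset.sum_congr rfl fun d _ => ?_
  rw [h.pd_symm hx d b c]
  ring

theorem IsMetricOn.sum_mul_christoffel {x : Coord m} (hx : x ∈ t) (e b c : Fin m) :
    ∑ f, G x e f * christoffel G x f b c = (1 / 2) * (pd b (fun y => G y c e) x
      + pd c (fun y => G y b e) x - pd e (fun y => G y b c) x) := by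
  have hinv : ∀ d, ∑ f, G x e f * (Matrix.of (G x))⁻¹ f d = if e = d then 1 else 0 := by
    intro d
    have := congrFun (congrFun
      (Matrix.mul_nonsing_inv (Matrix.of (G x)) (h.nondegenerate x hx).isUnit) e) d
    simpa [Matrix.mul_apply, Matrix.one_apply] using this
  unfold christoffel
  set K := fun d => pd b (fun y => G y c d) x + pd c (fun y => G y b d) x
    - pd d (fun y => G y b c) x
  calc ∑ f, G x e f * (1 / 2 * ∑ d, (Matrix.of (G x))⁻¹ f d * K d)
      = ∑ f, ∑ d, (1 / 2) * ((G x e f * (Matrix.of (G x))⁻¹ f d) * K d) := by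
        refine Finset.sum_congr rfl fun f _ => ?_
        rw [Finset.mul_sum, Finset.mul_sum]
        exact Finset.sum_congr rfl fun d _ => by ring
    _ = (1 / 2) * ∑ d, (∑ f, G x e f * (Matrix.of (G x))⁻¹ f d) * K d := by
        rw [Finset.sum_comm]
        simp only [Finset.mul_sum, Finset.sum_mul]
    _ = (1 / 2) * K e := by simp [hinv]

/-- The Levi-Civita connection is metric. -/
theorem IsMetricOn.pd_eq {x : Coord m} (hx : x ∈ t) (a b c : Fin m) :
    pd a (fun y => G y b c) x
      = ∑ f, (G x f c * christoffel G x f a b + G x b f * christoffel G x f a c) := by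
  have h1 := h.sum_mul_christoffel hx c a b
  have h2 := h.sum_mul_christoffel hx b a c
  rw [Finset.sum_add_distrib, Finset.sum_congr rfl fun f _ => by rw [h.symm x hx f c], h1, h2,
    h.pd_symm hx b a c, h.pd_symm hx a c b, h.pd_symm hx c a b]
  rw [h.pd_symm hx b c a, h.pd_symm hx c b a]
  ring

end LeviCivita


/-! ### Covariant derivatives along a map -/

/-- The scalar product defined by the components of a metric at the point `p`. -/
noncomputable def metricForm {m : ℕ} (G : Coord m → Fin m → Fin m → ℝ) (p : Coord m) :
    LinearMap.BilinForm ℝ (Fin m → ℝ) :=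
  Matrix.toBilin' (Matrix.of (G p))

theorem metricForm_apply {m : ℕ} (G : Coord m → Fin m → Fin m → ℝ) (p : Coord m)
    (v w : Fin m → ℝ) : metricForm G p v w = ∑ μ, ∑ ν, v μ * G p μ ν * w ν := by
  simp [metricForm, Matrix.toBilin'_apply]

/-- The push-forward of the coordinate vector `∂_a` under the map `F`. -/
noncomputable def tangent {n m : ℕ} (F : Coord n → Coord m) (a : Fin n) (x : Coord n) : Fin m → ℝ :=
  fun μ => pd a (fun y => F y μ) x

/-- The connection form of the pull-back of a connection `Γ` by `F`, evaluated on `∂_a`. -/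
noncomputable def connForm {n m : ℕ} (Γ : Coord m → Fin m → Fin m → Fin m → ℝ) (F : Coord n → Coord m)
    (a : Fin n) (x : Coord n) (μ β : Fin m) : ℝ :=
  ∑ α, Γ (F x) μ α β * tangent F a x α

/-- The covariant derivative in the direction `∂_a` of a vector field `V` along the map `F`. -/
noncomputable def covAlong {n m : ℕ} (Γ : Coord m → Fin m → Fin m → Fin m → ℝ) (F : Coord n → Coord m)
    (a : Fin n) (V : Coord n → Fin m → ℝ) (x : Coord n) : Fin m → ℝ :=
  fun μ => pd a (fun y => V y μ) x + ∑ β, connForm Γ F a x μ β * V x β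

/-- The vector `R(v, w) z`. -/
noncomputable def curvVec {m : ℕ} (Γ : Coord m → Fin m → Fin m → Fin m → ℝ) (p : Coord m)
    (v w z : Fin m → ℝ) : Fin m → ℝ :=
  fun μ => ∑ ν, ∑ α, ∑ β, curvature Γ p μ ν α β * v α * w β * z ν

section Along

variable {n m : ℕ} {s : Set (Coord n)} {t : Set (Coord m)} {G : Coord m → Fin m → Fin m → ℝ}
  {F : Coord n → Coord m} {Γ : Coord m → Fin m → Fin m → Fin m → ℝ}

theorem contDiffOn_tangent (hs : IsOpen s) (hF : ContDiffOn ℝ ∞ F s) (a : Fin n) (μ : Fin m) :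
    ContDiffOn ℝ ∞ (fun y => tangent F a y μ) s :=
  contDiffOn_pd hs (contDiffOn_euclidean.1 hF μ) a

theorem contDiffOn_connForm (hs : IsOpen s) (hF : ContDiffOn ℝ ∞ F s) (hst : Set.MapsTo F s t)
    (hΓ : ∀ a b c, ContDiffOn ℝ ∞ (fun y => Γ y a b c) t) (a : Fin n) (μ β : Fin m) :
    ContDiffOn ℝ ∞ (fun y => connForm Γ F a y μ β) s :=
  ContDiffOn.sum fun _ _ => ((hΓ _ _ _).comp hF hst).mul (contDiffOn_tangent hs hF _ _)

theorem contDiffOn_covAlong (hs : IsOpen s) (hF : ContDiffOn ℝ ∞ F s) (hst : Set.MapsTo F s t)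
    (hΓ : ∀ a b c, ContDiffOn ℝ ∞ (fun y => Γ y a b c) t) {V : Coord n → Fin m → ℝ}
    (hV : ∀ μ, ContDiffOn ℝ ∞ (fun y => V y μ) s) (a : Fin n) (μ : Fin m) :
    ContDiffOn ℝ ∞ (fun y => covAlong Γ F a V y μ) s :=
  (contDiffOn_pd hs (hV μ) a).add
    (ContDiffOn.sum fun β _ => (contDiffOn_connForm hs hF hst hΓ a μ β).mul (hV β))

theorem covAlong_congr {V W : Coord n → Fin m → ℝ} {x : Coord n} (h : V =ᶠ[𝓝 x] W) (a : Fin n) :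
    covAlong Γ F a V x = covAlong Γ F a W x := by
  funext μ
  unfold covAlong
  rw [h.self_of_nhds, pd_congr (h.mono fun y hy => congrFun hy μ)]

theorem covAlong_add {V W : Coord n → Fin m → ℝ} {x : Coord n}
    (hV : ∀ μ, DifferentiableAt ℝ (fun y => V y μ) x)
    (hW : ∀ μ, DifferentiableAt ℝ (fun y => W y μ) x) (a : Fin n) :
    covAlong Γ F a (fun y => V y + W y) x = covAlong Γ F a V x + covAlong Γ F a W x := by
  funext μ
  simp only [covAlong, Pi.add_apply, mul_add, Finset.sum_add_distrib]
  rw [pd_add (hV μ) (hW μ)]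
  ring

theorem covAlong_sub {V W : Coord n → Fin m → ℝ} {x : Coord n}
    (hV : ∀ μ, DifferentiableAt ℝ (fun y => V y μ) x)
    (hW : ∀ μ, DifferentiableAt ℝ (fun y => W y μ) x) (a : Fin n) :
    covAlong Γ F a (fun y => V y - W y) x = covAlong Γ F a V x - covAlong Γ F a W x := by
  funext μ
  simp only [covAlong, Pi.sub_apply, mul_sub, Finset.sum_sub_distrib]
  rw [pd_sub (hV μ) (hW μ)]
  ring

theorem covAlong_sum {ι : Type*} {u : Finset ι} {V : ι → Coord n → Fin m → ℝ} {x : Coord n}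
    (hV : ∀ i ∈ u, ∀ μ, DifferentiableAt ℝ (fun y => V i y μ) x) (a : Fin n) :
    covAlong Γ F a (fun y => ∑ i ∈ u, V i y) x = ∑ i ∈ u, covAlong Γ F a (V i) x := by
  funext μ
  simp only [covAlong, Finset.sum_apply, Finset.mul_sum, Finset.sum_add_distrib]
  rw [pd_sum (fun i hi => hV i hi μ), Finset.sum_comm]

theorem covAlong_smul {f : Coord n → ℝ} {V : Coord n → Fin m → ℝ} {x : Coord n}
    (hf : DifferentiableAt ℝ f x) (hV : ∀ μ, DifferentiableAt ℝ (fun y => V y μ) x) (a : Fin n) :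
    covAlong Γ F a (fun y => f y • V y) x = pd a f x • V x + f x • covAlong Γ F a V x := by
  funext μ
  simp only [covAlong, Pi.smul_apply, Pi.add_apply, smul_eq_mul]
  rw [pd_mul hf (hV μ), mul_add, Finset.mul_sum, add_assoc]
  congr 2
  exact Finset.sum_congr rfl fun β _ => by ring

theorem covAlong_sum_smul {ι : Type*} {u : Finset ι} {f : ι → Coord n → ℝ}
    {V : ι → Coord n → Fin m → ℝ} {x : Coord n} (hf : ∀ i, DifferentiableAt ℝ (f i) x)
    (hV : ∀ i μ, DifferentiableAt ℝ (fun y => V i y μ) x) (a : Fin n) :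
    covAlong Γ F a (fun y => ∑ i ∈ u, f i y • V i y) x
      = ∑ i ∈ u, (pd a (f i) x • V i x + f i x • covAlong Γ F a (V i) x) := by
  rw [covAlong_sum (V := fun i y => f i y • V i y) fun i _ μ => (hf i).fun_mul (hV i μ)]
  exact Finset.sum_congr rfl fun i _ => covAlong_smul (hf i) (hV i) a

/-- The pull-back of a symmetric connection is torsion-free. -/
theorem covAlong_tangent_comm (hs : IsOpen s) (hF : ContDiffOn ℝ ∞ F s) {x : Coord n} (hx : x ∈ s)
    (hΓ : ∀ a b c, Γ (F x) a b c = Γ (F x) a c b) (a b : Fin n) :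
    covAlong Γ F a (tangent F b) x = covAlong Γ F b (tangent F a) x := by
  funext μ
  simp only [covAlong, connForm, Finset.sum_mul]
  congr 1
  · exact pd_comm hs (contDiffOn_euclidean.1 hF μ) hx a b
  · rw [Finset.sum_comm]
    exact Finset.sum_congr rfl fun α _ => Finset.sum_congr rfl fun β _ => by rw [hΓ]; ring

/-- The structure equation for the pull-back of a connection. -/
theorem pd_connForm (hs : IsOpen s) (ht : IsOpen t) (hF : ContDiffOn ℝ ∞ F s)
    (hst : Set.MapsTo F s t) (hΓ : ∀ a b c, ContDiffOn ℝ ∞ (fun y => Γ y a b c) t)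
    {x : Coord n} (hx : x ∈ s) (c d : Fin n) (μ ν : Fin m) :
    pd c (fun y => connForm Γ F d y μ ν) x - pd d (fun y => connForm Γ F c y μ ν) x
        + ∑ f, (connForm Γ F c x μ f * connForm Γ F d x f ν
          - connForm Γ F d x μ f * connForm Γ F c x f ν)
      = ∑ α, ∑ β, curvature Γ (F x) μ ν α β * tangent F c x α * tangent F d x β := by
  have hd : ∀ c d : Fin n, pd c (fun y => connForm Γ F d y μ ν) x
      = ∑ β, ∑ α, pd α (fun p => Γ p μ β ν) (F x) * tangent F c x α * tangent F d x β
        + ∑ β, Γ (F x) μ β ν * pd c (fun y => tangent F d y β) x := by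
    intro c d
    have h1 : ∀ β, DifferentiableAt ℝ (fun y => Γ (F y) μ β ν) x := fun β =>
      differentiableAt_of_contDiffOn hs ((hΓ μ β ν).comp hF hst) hx
    have h2 : ∀ β, DifferentiableAt ℝ (fun y => tangent F d y β) x := fun β =>
      differentiableAt_of_contDiffOn hs (contDiffOn_tangent hs hF d β) hx
    unfold connForm
    rw [pd_sum fun β _ => (h1 β).fun_mul (h2 β), ← Finset.sum_add_distrib]
    refine Finset.sum_congr rfl fun β _ => ?_
    rw [pd_mul (h1 β) (h2 β), pd_comp (f := fun p => Γ p μ β ν)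
      (differentiableAt_of_contDiffOn ht (hΓ μ β ν) (hst hx))
      ((hF.contDiffAt (hs.mem_nhds hx)).differentiableAt (by simp)), Finset.sum_mul]
    rfl
  have hcomm : ∀ β, pd c (fun y => tangent F d y β) x = pd d (fun y => tangent F c y β) x :=
    fun β => pd_comm hs (contDiffOn_euclidean.1 hF β) hx c d
  have hq : ∀ c d : Fin n, ∑ f, connForm Γ F c x μ f * connForm Γ F d x f ν
      = ∑ α, ∑ β, (∑ f, Γ (F x) μ α f * Γ (F x) f β ν) * tangent F c x α * tangent F d x β := by
    intro c d
    simp only [connForm, Finset.sum_mul, Finset.mul_sum]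
    rw [Finset.sum_comm' (t' := Finset.univ) (s' := fun _ => Finset.univ) (by simp)]
    calc _ = ∑ β, ∑ α, ∑ f, Γ (F x) μ α f * tangent F c x α
          * (Γ (F x) f β ν * tangent F d x β) := ?_
      _ = _ := by
        rw [Finset.sum_comm]
        exact Finset.sum_congr rfl fun α _ => Finset.sum_congr rfl fun β _ =>
          Finset.sum_congr rfl fun f _ => by ring
    exact Finset.sum_congr rfl fun β _ => Finset.sum_comm
  have hq' : ∑ f, connForm Γ F d x μ f * connForm Γ F c x f ν
      = ∑ α, ∑ β, (∑ f, Γ (F x) μ β f * Γ (F x) f α ν) * tangent F c x α * tangent F d x β := by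
    rw [hq d c, Finset.sum_comm]
    exact Finset.sum_congr rfl fun α _ => Finset.sum_congr rfl fun β _ => by ring
  rw [Finset.sum_sub_distrib, hq c d, hq', hd c d, hd d c]
  simp only [hcomm, curvature, add_mul, sub_mul, Finset.sum_add_distrib, Finset.sum_sub_distrib]
  rw [Finset.sum_comm (f := fun β α => pd α (fun p => Γ p μ β ν) (F x) * tangent F c x α
    * tangent F d x β)]
  have : ∑ β, ∑ α, pd α (fun p => Γ p μ β ν) (F x) * tangent F d x α * tangent F c x β
      = ∑ α, ∑ β, pd β (fun p => Γ p μ α ν) (F x) * tangent F c x α * tangent F d x β :=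
    Finset.sum_congr rfl fun α _ => Finset.sum_congr rfl fun β _ => by ring
  rw [this]
  ring

/-- The Ricci identity: the commutator of covariant derivatives along a map is the curvature. -/
theorem covAlong_comm (hs : IsOpen s) (ht : IsOpen t) (hF : ContDiffOn ℝ ∞ F s)
    (hst : Set.MapsTo F s t) (hΓ : ∀ a b c, ContDiffOn ℝ ∞ (fun y => Γ y a b c) t)
    {V : Coord n → Fin m → ℝ} (hV : ∀ μ, ContDiffOn ℝ ∞ (fun y => V y μ) s)
    {x : Coord n} (hx : x ∈ s) (c d : Fin n) :
    covAlong Γ F c (covAlong Γ F d V) x - covAlong Γ F d (covAlong Γ F c V) x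
      = curvVec Γ (F x) (tangent F c x) (tangent F d x) (V x) := by
  funext μ
  have hd : ∀ c d : Fin n, covAlong Γ F c (covAlong Γ F d V) x μ
      = pd c (fun y => pd d (fun z => V z μ) y) x
        + ∑ ν, pd c (fun y => connForm Γ F d y μ ν) x * V x ν
        + ∑ ν, (connForm Γ F d x μ ν * pd c (fun y => V y ν) x
          + connForm Γ F c x μ ν * pd d (fun y => V y ν) x)
        + ∑ ν, (∑ f, connForm Γ F c x μ f * connForm Γ F d x f ν) * V x ν := by
    intro c d
    have h1 : ∀ ν, DifferentiableAt ℝ (fun y => connForm Γ F d y μ ν) x := fun ν =>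
      differentiableAt_of_contDiffOn hs (contDiffOn_connForm hs hF hst hΓ d μ ν) hx
    have h2 : ∀ ν, DifferentiableAt ℝ (fun y => V y ν) x := fun ν =>
      differentiableAt_of_contDiffOn hs (hV ν) hx
    have h3 : DifferentiableAt ℝ (fun y => pd d (fun z => V z μ) y) x :=
      differentiableAt_of_contDiffOn hs (contDiffOn_pd hs (hV μ) d) hx
    have e1 : pd c (fun y => covAlong Γ F d V y μ) x = pd c (fun y => pd d (fun z => V z μ) y) x
        + ∑ ν, (pd c (fun y => connForm Γ F d y μ ν) x * V x ν
          + connForm Γ F d x μ ν * pd c (fun y => V y ν) x) := by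
      unfold covAlong
      rw [pd_add h3 (DifferentiableAt.fun_sum fun ν _ => (h1 ν).fun_mul (h2 ν)),
        pd_sum fun ν _ => (h1 ν).fun_mul (h2 ν)]
      congr 1
      exact Finset.sum_congr rfl fun ν _ => pd_mul (h1 ν) (h2 ν) c
    have e2 : ∑ ν, (∑ f, connForm Γ F c x μ f * connForm Γ F d x f ν) * V x ν
        = ∑ f, connForm Γ F c x μ f * ∑ ν, connForm Γ F d x f ν * V x ν := by
      simp only [Finset.sum_mul, Finset.mul_sum]
      rw [Finset.sum_comm]
      exact Finset.sum_congr rfl fun f _ => Finset.sum_congr rfl fun ν _ => by ring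
    rw [e2]
    change pd c (fun y => covAlong Γ F d V y μ) x + ∑ f, connForm Γ F c x μ f
      * (pd d (fun y => V y f) x + ∑ ν, connForm Γ F d x f ν * V x ν) = _
    rw [e1]
    simp only [mul_add, Finset.sum_add_distrib]
    ring
  have hR : curvVec Γ (F x) (tangent F c x) (tangent F d x) (V x) μ
      = ∑ ν, (∑ α, ∑ β, curvature Γ (F x) μ ν α β * tangent F c x α * tangent F d x β)
        * V x ν := by
    simp only [curvVec, Finset.sum_mul]
  simp only [← pd_connForm hs ht hF hst hΓ hx, add_mul, sub_mul, Finset.sum_add_distrib,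
    Finset.sum_sub_distrib] at hR
  rw [Pi.sub_apply, hd c d, hd d c, hR, pd_comm hs (hV μ) hx c d]
  simp only [Finset.sum_add_distrib]
  ring

/-- The pull-back of the Levi-Civita connection is metric. -/
theorem IsMetricOn.pd_metricForm (hG : IsMetricOn G t) (hs : IsOpen s) (hF : ContDiffOn ℝ ∞ F s)
    (hst : Set.MapsTo F s t) {V W : Coord n → Fin m → ℝ} {x : Coord n}
    (hV : ∀ μ, DifferentiableAt ℝ (fun y => V y μ) x)
    (hW : ∀ μ, DifferentiableAt ℝ (fun y => W y μ) x) (hx : x ∈ s) (a : Fin n) :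
    pd a (fun y => metricForm G (F y) (V y) (W y)) x
      = metricForm G (F x) (covAlong (christoffel G) F a V x) (W x)
        + metricForm G (F x) (V x) (covAlong (christoffel G) F a W x) := by
  have hd : ∀ μ ν, DifferentiableAt ℝ (fun y => G (F y) μ ν) x := fun μ ν =>
    differentiableAt_of_contDiffOn hs ((hG.contDiffOn μ ν).comp hF hst) hx
  have hGF : ∀ μ ν, pd a (fun y => G (F y) μ ν) x
      = ∑ f, (G (F x) f ν * connForm (christoffel G) F a x f μ
        + G (F x) μ f * connForm (christoffel G) F a x f ν) := by
    intro μ ν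
    rw [pd_comp (f := fun p => G p μ ν)
      (differentiableAt_of_contDiffOn hG.isOpen (hG.contDiffOn μ ν) (hst hx))
      ((hF.contDiffAt (hs.mem_nhds hx)).differentiableAt (by simp))]
    simp only [hG.pd_eq (hst hx), connForm, Finset.mul_sum, Finset.sum_mul,
      ← Finset.sum_add_distrib]
    rw [Finset.sum_comm]
    refine Finset.sum_congr rfl fun f _ => Finset.sum_congr rfl fun α _ => ?_
    simp only [tangent]
    ring
  simp only [metricForm_apply]
  have hVGW : ∀ μ ν, DifferentiableAt ℝ (fun y => V y μ * G (F y) μ ν * W y ν) x := fun μ ν =>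
    ((hV μ).fun_mul (hd μ ν)).fun_mul (hW ν)
  rw [pd_sum fun μ _ => DifferentiableAt.fun_sum fun ν _ => hVGW μ ν]
  simp only [pd_sum fun ν _ => hVGW _ ν]
  have hp : ∀ μ ν, pd a (fun y => V y μ * G (F y) μ ν * W y ν) x
      = pd a (fun y => V y μ) x * G (F x) μ ν * W x ν
        + V x μ * G (F x) μ ν * pd a (fun y => W y ν) x
        + (∑ f, V x μ * connForm (christoffel G) F a x f μ * G (F x) f ν * W x ν
        + ∑ f, V x μ * G (F x) μ f * connForm (christoffel G) F a x f ν * W x ν) := by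
    intro μ ν
    rw [pd_mul ((hV μ).fun_mul (hd μ ν)) (hW ν), pd_mul (hV μ) (hd μ ν), hGF,
      Finset.sum_add_distrib]
    have e1 : ∑ f, V x μ * connForm (christoffel G) F a x f μ * G (F x) f ν * W x ν
        = V x μ * (∑ f, G (F x) f ν * connForm (christoffel G) F a x f μ) * W x ν := by
      rw [Finset.mul_sum, Finset.sum_mul]
      exact Finset.sum_congr rfl fun f _ => by ring
    have e2 : ∑ f, V x μ * G (F x) μ f * connForm (christoffel G) F a x f ν * W x ν
        = V x μ * (∑ f, G (F x) μ f * connForm (christoffel G) F a x f ν) * W x ν := by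
      rw [Finset.mul_sum, Finset.sum_mul]
      exact Finset.sum_congr rfl fun f _ => by ring
    rw [e1, e2]
    ring
  simp only [hp, covAlong, add_mul, mul_add, Finset.sum_add_distrib, Finset.sum_mul,
    Finset.mul_sum]
  have t1 : ∑ μ, ∑ ν, ∑ f, V x μ * connForm (christoffel G) F a x f μ * G (F x) f ν * W x ν
      = ∑ μ, ∑ ν, ∑ β, connForm (christoffel G) F a x μ β * V x β * G (F x) μ ν * W x ν := by
    calc _ = ∑ μ, ∑ f, ∑ ν, V x μ * connForm (christoffel G) F a x f μ * G (F x) f ν * W x ν :=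
          Finset.sum_congr rfl fun μ _ => Finset.sum_comm
      _ = ∑ f, ∑ μ, ∑ ν, V x μ * connForm (christoffel G) F a x f μ * G (F x) f ν * W x ν :=
          Finset.sum_comm
      _ = ∑ f, ∑ ν, ∑ μ, V x μ * connForm (christoffel G) F a x f μ * G (F x) f ν * W x ν :=
          Finset.sum_congr rfl fun μ _ => Finset.sum_comm
      _ = _ := Finset.sum_congr rfl fun f _ => Finset.sum_congr rfl fun ν _ =>
          Finset.sum_congr rfl fun μ _ => by ring
  have t2 : ∑ μ, ∑ ν, ∑ f, V x μ * G (F x) μ f * connForm (christoffel G) F a x f ν * W x ν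
      = ∑ μ, ∑ ν, ∑ β, V x μ * G (F x) μ ν * (connForm (christoffel G) F a x ν β * W x β) := by
    refine Finset.sum_congr rfl fun μ _ => ?_
    rw [Finset.sum_comm]
    exact Finset.sum_congr rfl fun f _ => Finset.sum_congr rfl fun ν _ => by ring
  rw [t1, t2]
  ring

end Along


/-! ### Symmetries of the Riemann tensor -/

section Riemann

variable {m : ℕ} {t : Set (Coord m)} {G : Coord m → Fin m → Fin m → ℝ}

theorem IsMetricOn.metricForm_comm (hG : IsMetricOn G t) {p : Coord m} (hp : p ∈ t)
    (v w : Fin m → ℝ) : metricForm G p v w = metricForm G p w v := by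
  simp only [metricForm_apply]
  rw [Finset.sum_comm]
  exact Finset.sum_congr rfl fun μ _ => Finset.sum_congr rfl fun ν _ => by
    rw [hG.symm p hp ν μ]; ring

/-- A metric connection has skew-symmetric curvature: the second derivatives of the scalar
product of two vector fields commute. -/
theorem IsMetricOn.metricForm_curvVec_skew_along {n : ℕ} {s : Set (Coord n)}
    {F : Coord n → Coord m} (hG : IsMetricOn G t)
    (hs : IsOpen s) (hF : ContDiffOn ℝ ∞ F s) (hst : Set.MapsTo F s t)
    {V W : Coord n → Fin m → ℝ} (hV : ∀ μ, ContDiffOn ℝ ∞ (fun y => V y μ) s)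
    (hW : ∀ μ, ContDiffOn ℝ ∞ (fun y => W y μ) s) {x : Coord n} (hx : x ∈ s) (c d : Fin n) :
    metricForm G (F x) (V x)
        (curvVec (christoffel G) (F x) (tangent F c x) (tangent F d x) (W x))
      = -metricForm G (F x)
        (curvVec (christoffel G) (F x) (tangent F c x) (tangent F d x) (V x)) (W x) := by
  have hΓ := hG.contDiffOn_christoffel
  have dif : ∀ {V : Coord n → Fin m → ℝ}, (∀ μ, ContDiffOn ℝ ∞ (fun y => V y μ) s) →
      ∀ {y}, y ∈ s → ∀ μ, DifferentiableAt ℝ (fun y => V y μ) y := fun hV y hy μ =>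
    differentiableAt_of_contDiffOn hs (hV μ) hy
  have hip : ∀ {V W : Coord n → Fin m → ℝ}, (∀ μ, ContDiffOn ℝ ∞ (fun y => V y μ) s) →
      (∀ μ, ContDiffOn ℝ ∞ (fun y => W y μ) s) →
      ContDiffOn ℝ ∞ (fun y => metricForm G (F y) (V y) (W y)) s := by
    intro V W hV hW
    simp only [metricForm_apply]
    exact ContDiffOn.sum fun μ _ => ContDiffOn.sum fun ν _ =>
      ((hV μ).mul ((hG.contDiffOn μ ν).comp hF hst)).mul (hW ν)
  have hcov : ∀ {V : Coord n → Fin m → ℝ}, (∀ μ, ContDiffOn ℝ ∞ (fun y => V y μ) s) →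
      ∀ a μ, ContDiffOn ℝ ∞ (fun y => covAlong (christoffel G) F a V y μ) s := fun hV a μ =>
    contDiffOn_covAlong hs hF hst hΓ hV a μ
  have key : ∀ c d, pd c (fun y => pd d (fun z => metricForm G (F z) (V z) (W z)) y) x
      = metricForm G (F x) (covAlong (christoffel G) F c (covAlong (christoffel G) F d V) x) (W x)
        + metricForm G (F x) (covAlong (christoffel G) F d V x)
          (covAlong (christoffel G) F c W x)
        + (metricForm G (F x) (covAlong (christoffel G) F c V x)
          (covAlong (christoffel G) F d W x)
        + metricForm G (F x) (V x)
          (covAlong (christoffel G) F c (covAlong (christoffel G) F d W) x)) := by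
    intro c d
    have e1 : (fun y => pd d (fun z => metricForm G (F z) (V z) (W z)) y) =ᶠ[𝓝 x]
        fun y => metricForm G (F y) (covAlong (christoffel G) F d V y) (W y)
          + metricForm G (F y) (V y) (covAlong (christoffel G) F d W y) :=
      (hs.eventually_mem hx).mono fun y hy =>
        hG.pd_metricForm hs hF hst (dif hV hy) (dif hW hy) hy d
    rw [pd_congr e1, pd_add (differentiableAt_of_contDiffOn hs (hip (hcov hV d) hW) hx)
      (differentiableAt_of_contDiffOn hs (hip hV (hcov hW d)) hx),
      hG.pd_metricForm hs hF hst (dif (hcov hV d) hx) (dif hW hx) hx,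
      hG.pd_metricForm hs hF hst (dif hV hx) (dif (hcov hW d) hx) hx]
  have h1 := pd_comm hs (hip hV hW) hx c d
  rw [key c d, key d c] at h1
  rw [← covAlong_comm hs hG.isOpen hF hst hΓ hV hx, ← covAlong_comm hs hG.isOpen hF hst hΓ hW hx]
  simp only [map_sub, LinearMap.sub_apply]
  linear_combination h1

theorem curvature_skew (Γ : Coord m → Fin m → Fin m → Fin m → ℝ) (p : Coord m)
    (a b c d : Fin m) : curvature Γ p a b c d = -curvature Γ p a b d c := by
  simp only [curvature, Finset.sum_sub_distrib]
  ring

theorem curvature_bianchi {Γ : Coord m → Fin m → Fin m → Fin m → ℝ} {p : Coord m}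
    (hΓ : ∀ᶠ y in 𝓝 p, ∀ a b c, Γ y a b c = Γ y a c b) (a b c d : Fin m) :
    curvature Γ p a b c d + curvature Γ p a c d b + curvature Γ p a d b c = 0 := by
  have h1 : ∀ e b c, pd e (fun y => Γ y a b c) p = pd e (fun y => Γ y a c b) p := fun e b c =>
    pd_congr (hΓ.mono fun y hy => hy a b c) e
  have h0 := hΓ.self_of_nhds
  simp only [curvature, Finset.sum_sub_distrib]
  rw [h1 c d b, h1 d c b, h1 b d c]
  simp only [h0 _ d b, h0 _ c b, h0 _ d c]
  ring

theorem metricForm_curvVec_single (G : Coord m → Fin m → Fin m → ℝ) (p : Coord m)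
    (a b c d : Fin m) :
    metricForm G p (Pi.single a 1)
        (curvVec (christoffel G) p (Pi.single c 1) (Pi.single d 1) (Pi.single b 1))
      = riemannLow G p a b c d := by
  simp [metricForm_apply, curvVec, riemannLow, Pi.single_apply]

theorem riemannLow_skew_right (G : Coord m → Fin m → Fin m → ℝ) (p : Coord m) (a b c d : Fin m) :
    riemannLow G p a b c d = -riemannLow G p a b d c := by
  simp only [riemannLow, curvature_skew _ _ _ _ c d, mul_neg, Finset.sum_neg_distrib]

theorem IsMetricOn.riemannLow_skew_left (hG : IsMetricOn G t) {p : Coord m} (hp : p ∈ t)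
    (a b c d : Fin m) : riemannLow G p a b c d = -riemannLow G p b a c d := by
  have h := hG.metricForm_curvVec_skew_along (F := id) (V := fun _ => Pi.single a 1)
    (W := fun _ => Pi.single b 1) hG.isOpen contDiffOn_id (Set.mapsTo_id t)
    (fun _ => contDiffOn_const) (fun _ => contDiffOn_const) hp c d
  -- for the identity map and constant fields, the frame is the coordinate frame
  have e : ∀ c : Fin m, tangent (id : Coord m → Coord m) c p = Pi.single c 1 := by
    intro c
    funext μ
    simp [tangent, Pi.single_apply]
  simp only [e, id_eq] at h
  rwa [hG.metricForm_comm hp (curvVec _ _ _ _ _), metricForm_curvVec_single,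
    metricForm_curvVec_single] at h

theorem IsMetricOn.riemannLow_bianchi (hG : IsMetricOn G t) {p : Coord m} (hp : p ∈ t)
    (a b c d : Fin m) :
    riemannLow G p a b c d + riemannLow G p a c d b + riemannLow G p a d b c = 0 := by
  simp only [riemannLow, ← Finset.sum_add_distrib, ← mul_add]
  refine Finset.sum_eq_zero fun f _ => ?_
  rw [curvature_bianchi ((hG.isOpen.eventually_mem hp).mono fun y hy a b c =>
    hG.christoffel_symm hy a b c), mul_zero]

theorem IsMetricOn.riemannLow_pair (hG : IsMetricOn G t) {p : Coord m} (hp : p ∈ t)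
    (a b c d : Fin m) : riemannLow G p a b c d = riemannLow G p c d a b := by
  -- the four Bianchi identities that start with `a`, `b`, `c`, `d`, in cyclic order, combine
  -- with the skew symmetries to the pair symmetry
  have s := hG.riemannLow_skew_left hp
  have s' := riemannLow_skew_right G p
  have B := hG.riemannLow_bianchi hp
  have b1 := B a b c d
  have b2 := B b c d a
  have b3 := B c d a b
  have b4 := B d a b c
  linarith [s a b c d, s a c d b, s a d b c, s b c d a, s b d a c, s b a c d, s c d a b,
    s c a b d, s c b d a, s d a b c, s d b c a, s d c a b, s' a b c d, s' a c d b, s' a d b c,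
    s' b c d a, s' b d a c, s' b a c d, s' c d a b, s' c a b d, s' c b d a, s' d a b c,
    s' d b c a, s' d c a b, s' c d b a, s' d a c b, s' d b a c, s' b a d c]

theorem metricForm_curvVec (G : Coord m → Fin m → Fin m → ℝ) (p : Coord m)
    (u v w z : Fin m → ℝ) :
    metricForm G p u (curvVec (christoffel G) p v w z)
      = ∑ a, ∑ b, ∑ c, ∑ d, riemannLow G p a b c d * u a * z b * v c * w d := by
  have h1 : ∀ a, ∑ f, G p a f * curvVec (christoffel G) p v w z f
      = ∑ b, ∑ c, ∑ d, riemannLow G p a b c d * z b * v c * w d := by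
    intro a
    simp only [curvVec, riemannLow, Finset.mul_sum, Finset.sum_mul]
    rw [Finset.sum_comm]
    refine Finset.sum_congr rfl fun b _ => ?_
    rw [Finset.sum_comm]
    refine Finset.sum_congr rfl fun c _ => ?_
    rw [Finset.sum_comm]
    exact Finset.sum_congr rfl fun d _ => Finset.sum_congr rfl fun f _ => by ring
  rw [metricForm_apply]
  refine Finset.sum_congr rfl fun a _ => ?_
  have h2 : ∑ f, u a * G p a f * curvVec (christoffel G) p v w z f
      = u a * ∑ f, G p a f * curvVec (christoffel G) p v w z f := by
    rw [Finset.mul_sum]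
    exact Finset.sum_congr rfl fun f _ => by ring
  rw [h2, h1]
  simp only [Finset.mul_sum]
  exact Finset.sum_congr rfl fun b _ => Finset.sum_congr rfl fun c _ =>
    Finset.sum_congr rfl fun d _ => by ring

theorem IsMetricOn.metricForm_curvVec_skew (hG : IsMetricOn G t) {p : Coord m} (hp : p ∈ t)
    (u v w z : Fin m → ℝ) :
    metricForm G p u (curvVec (christoffel G) p v w z)
      = -metricForm G p z (curvVec (christoffel G) p v w u) := by
  rw [metricForm_curvVec, metricForm_curvVec, Finset.sum_comm]
  simp only [← Finset.sum_neg_distrib]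
  exact Finset.sum_congr rfl fun b _ => Finset.sum_congr rfl fun a _ =>
    Finset.sum_congr rfl fun c _ => Finset.sum_congr rfl fun d _ => by
      rw [hG.riemannLow_skew_left hp a b]; ring

theorem IsMetricOn.metricForm_curvVec_pair (hG : IsMetricOn G t) {p : Coord m} (hp : p ∈ t)
    (u v w z : Fin m → ℝ) :
    metricForm G p u (curvVec (christoffel G) p v w z)
      = metricForm G p v (curvVec (christoffel G) p u z w) := by
  have comm4 : ∀ f : Fin m → Fin m → Fin m → Fin m → ℝ,
      ∑ a, ∑ b, ∑ c, ∑ d, f a b c d = ∑ c, ∑ d, ∑ a, ∑ b, f a b c d := by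
    intro f
    calc _ = ∑ a, ∑ c, ∑ b, ∑ d, f a b c d := Finset.sum_congr rfl fun a _ => Finset.sum_comm
      _ = ∑ c, ∑ a, ∑ b, ∑ d, f a b c d := Finset.sum_comm
      _ = ∑ c, ∑ a, ∑ d, ∑ b, f a b c d := Finset.sum_congr rfl fun c _ =>
          Finset.sum_congr rfl fun a _ => Finset.sum_comm
      _ = _ := Finset.sum_congr rfl fun c _ => Finset.sum_comm
  rw [metricForm_curvVec, metricForm_curvVec, comm4]
  exact Finset.sum_congr rfl fun b _ => Finset.sum_congr rfl fun a _ =>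
    Finset.sum_congr rfl fun c _ => Finset.sum_congr rfl fun d _ => by
      rw [hG.riemannLow_pair hp]; ring

theorem IsMetricOn.ricci_comm (hG : IsMetricOn G t) {p : Coord m} (hp : p ∈ t) (b d : Fin m) :
    ricci (christoffel G) p b d = ricci (christoffel G) p d b := by
  have hinv : (Matrix.of (G p))⁻¹.transpose = (Matrix.of (G p))⁻¹ := by
    rw [Matrix.transpose_nonsing_inv]
    congr 1
    ext i j
    exact hG.symm p hp j i
  have h1 : ∀ b d, ricci (christoffel G) p b d
      = ∑ a, ∑ e, (Matrix.of (G p))⁻¹ a e * riemannLow G p e b a d := by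
    intro b d
    unfold ricci
    refine Finset.sum_congr rfl fun a _ => ?_
    have h2 : ∀ f, ∑ e, (Matrix.of (G p))⁻¹ a e * G p e f = if a = f then 1 else 0 := by
      intro f
      have := congrFun (congrFun
        (Matrix.nonsing_inv_mul (Matrix.of (G p)) (hG.nondegenerate p hp).isUnit) a) f
      simpa [Matrix.mul_apply, Matrix.one_apply] using this
    calc curvature (christoffel G) p a b a d
        = ∑ f, (∑ e, (Matrix.of (G p))⁻¹ a e * G p e f) * curvature (christoffel G) p f b a d := by
          simp [h2]
      _ = _ := by
          simp only [riemannLow, Finset.sum_mul, Finset.mul_sum]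
          rw [Finset.sum_comm]
          exact Finset.sum_congr rfl fun e _ => Finset.sum_congr rfl fun f _ => by ring
  rw [h1, h1, Finset.sum_comm]
  refine Finset.sum_congr rfl fun a _ => Finset.sum_congr rfl fun e _ => ?_
  rw [hG.riemannLow_pair hp, ← congrFun (congrFun hinv a) e, Matrix.transpose_apply]

end Riemann


/-! ### Hypersurface data embedded in coordinates -/

section Embedding

variable {n : ℕ}

/-- The coordinate form of embedded hypersurface data: on the open set `s`, the data `D` are
induced by the map `F` into the domain `t` of the metric `G`, with rigging `Z`. -/
structure LocalData.IsInducedOn (D : LocalData n) (s : Set (Coord n)) (t : Set (Coord (n + 1)))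
    (G : Coord (n + 1) → Fin (n + 1) → Fin (n + 1) → ℝ) (F : Coord n → Coord (n + 1))
    (Z : Coord n → Fin (n + 1) → ℝ) : Prop where
  isMetricOn : IsMetricOn G t
  isOpen : IsOpen s
  contDiffOn_map : ContDiffOn ℝ ∞ F s
  mapsTo : Set.MapsTo F s t
  contDiffOn_rigging : ∀ μ, ContDiffOn ℝ ∞ (fun y => Z y μ) s
  γ_eq : ∀ y ∈ s, ∀ a b, D.γ y a b = metricForm G (F y) (tangent F a y) (tangent F b y)
  ell_eq : ∀ y ∈ s, ∀ a, D.ell y a = metricForm G (F y) (Z y) (tangent F a y)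
  ell2_eq : ∀ y ∈ s, D.ell2 y = metricForm G (F y) (Z y) (Z y)
  Y_eq : ∀ y ∈ s, ∀ a b, D.Y y a b = (1 / 2) * pullbackLie G F Z y a b
  nondegenerate : ∀ y ∈ s, (D.A y).det ≠ 0

theorem metricForm_eq_sum_single {m : ℕ} (G : Coord m → Fin m → Fin m → ℝ) (p : Coord m)
    (u v : Fin m → ℝ) : metricForm G p u v = ∑ ν, metricForm G p u (Pi.single ν 1) * v ν := by
  conv_lhs => rw [← Finset.univ_sum_single v]
  rw [map_sum]
  refine Finset.sum_congr rfl fun ν _ => ?_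
  rw [show (Pi.single ν (v ν) : Fin m → ℝ) = v ν • Pi.single ν 1 by
    rw [← Pi.single_smul, smul_eq_mul, mul_one], map_smul, smul_eq_mul, mul_comm]

/-- The covariant derivative `D_a V^c` of a vector field. -/
noncomputable def covDerivVec {m : ℕ} (Γ : Coord m → Fin m → Fin m → Fin m → ℝ)
    (V : Coord m → Fin m → ℝ) (x : Coord m) (a c : Fin m) : ℝ :=
  pd a (fun y => V y c) x + ∑ f, Γ x c a f * V x f

namespace LocalData

variable (D : LocalData n)

/-- The vectors `θ^c = P^{ca} e_a + n^c ζ`. Together with the normal vector `ν` they are dual to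
the frame `(e_a, ζ)`. -/
noncomputable def dualTangent (F : Coord n → Coord (n + 1)) (Z : Coord n → Fin (n + 1) → ℝ)
    (c : Fin n) (x : Coord n) : Fin (n + 1) → ℝ :=
  ∑ a, D.P x c a • tangent F a x + D.nvec x c • Z x

/-- The normal vector `ν = n^a e_a + n⁽²⁾ ζ`. -/
noncomputable def normal (F : Coord n → Coord (n + 1)) (Z : Coord n → Fin (n + 1) → ℝ)
    (x : Coord n) : Fin (n + 1) → ℝ :=
  ∑ a, D.nvec x a • tangent F a x + D.n2 x • Z x

variable {D} {s : Set (Coord n)} {t : Set (Coord (n + 1))}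
  {G : Coord (n + 1) → Fin (n + 1) → Fin (n + 1) → ℝ} {F : Coord n → Coord (n + 1)}
  {Z : Coord n → Fin (n + 1) → ℝ}

theorem metricForm_dualTangent (p : Coord (n + 1)) (c : Fin n) (x : Coord n)
    (v : Fin (n + 1) → ℝ) : metricForm G p (D.dualTangent F Z c x) v
      = ∑ a, D.P x c a * metricForm G p (tangent F a x) v
        + D.nvec x c * metricForm G p (Z x) v := by
  simp [dualTangent, LinearMap.sum_apply]

theorem metricForm_normal (p : Coord (n + 1)) (x : Coord n) (v : Fin (n + 1) → ℝ) :
    metricForm G p (D.normal F Z x) v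
      = ∑ a, D.nvec x a * metricForm G p (tangent F a x) v
        + D.n2 x * metricForm G p (Z x) v := by
  simp [normal, LinearMap.sum_apply]

variable (h : D.IsInducedOn s t G F Z)

/-! ### Smoothness -/

include h in
theorem IsInducedOn.contDiffOn_metricForm {V W : Coord n → Fin (n + 1) → ℝ}
    (hV : ∀ μ, ContDiffOn ℝ ∞ (fun y => V y μ) s) (hW : ∀ μ, ContDiffOn ℝ ∞ (fun y => W y μ) s) :
    ContDiffOn ℝ ∞ (fun y => metricForm G (F y) (V y) (W y)) s := by
  simp only [metricForm_apply]
  exact ContDiffOn.sum fun μ _ => ContDiffOn.sum fun ν _ =>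
    ((hV μ).mul ((h.isMetricOn.contDiffOn μ ν).comp h.contDiffOn_map h.mapsTo)).mul (hW ν)

include h in
theorem IsInducedOn.contDiffOn_tangent (a : Fin n) (μ : Fin (n + 1)) :
    ContDiffOn ℝ ∞ (fun y => tangent F a y μ) s :=
  HypData.contDiffOn_tangent h.isOpen h.contDiffOn_map a μ

include h in
theorem IsInducedOn.contDiffOn_γ (a b : Fin n) : ContDiffOn ℝ ∞ (fun y => D.γ y a b) s :=
  (h.contDiffOn_metricForm (h.contDiffOn_tangent a) (h.contDiffOn_tangent b)).congr
    fun y hy => h.γ_eq y hy a b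

include h in
theorem IsInducedOn.contDiffOn_ell (a : Fin n) : ContDiffOn ℝ ∞ (fun y => D.ell y a) s :=
  (h.contDiffOn_metricForm h.contDiffOn_rigging (h.contDiffOn_tangent a)).congr
    fun y hy => h.ell_eq y hy a

include h in
theorem IsInducedOn.contDiffOn_ell2 : ContDiffOn ℝ ∞ (fun y => D.ell2 y) s :=
  (h.contDiffOn_metricForm h.contDiffOn_rigging h.contDiffOn_rigging).congr
    fun y hy => h.ell2_eq y hy

include h in
theorem IsInducedOn.contDiffOn_A (i j : Fin n ⊕ Unit) : ContDiffOn ℝ ∞ (fun y => D.A y i j) s := by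
  rcases i with i | i <;> rcases j with j | j
  · exact h.contDiffOn_γ i j
  · exact h.contDiffOn_ell i
  · exact h.contDiffOn_ell j
  · exact h.contDiffOn_ell2

include h in
theorem IsInducedOn.contDiffOn_P (a b : Fin n) : ContDiffOn ℝ ∞ (fun y => D.P y a b) s :=
  contDiffOn_inv h.contDiffOn_A h.nondegenerate _ _

include h in
theorem IsInducedOn.contDiffOn_nvec (a : Fin n) : ContDiffOn ℝ ∞ (fun y => D.nvec y a) s :=
  contDiffOn_inv h.contDiffOn_A h.nondegenerate _ _

include h in
theorem IsInducedOn.contDiffOn_n2 : ContDiffOn ℝ ∞ (fun y => D.n2 y) s :=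
  contDiffOn_inv h.contDiffOn_A h.nondegenerate _ _

include h in
theorem IsInducedOn.contDiffOn_F (a b : Fin n) : ContDiffOn ℝ ∞ (fun y => D.F y a b) s :=
  contDiffOn_const.mul ((contDiffOn_pd h.isOpen (h.contDiffOn_ell b) a).sub
    (contDiffOn_pd h.isOpen (h.contDiffOn_ell a) b))

include h in
theorem IsInducedOn.contDiffOn_U (a b : Fin n) : ContDiffOn ℝ ∞ (fun y => D.U y a b) s := by
  have hn := fun c a => contDiffOn_pd h.isOpen (h.contDiffOn_nvec c) a
  have hn2 := contDiffOn_pd h.isOpen h.contDiffOn_n2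
  unfold U lie2
  exact (contDiffOn_const.mul (ContDiffOn.sum fun c _ =>
    (((h.contDiffOn_nvec c).mul (contDiffOn_pd h.isOpen (h.contDiffOn_γ a b) c)).add
      ((h.contDiffOn_γ c b).mul (hn c a))).add ((h.contDiffOn_γ a c).mul (hn c b)))).add
    (contDiffOn_const.mul (((h.contDiffOn_ell a).mul (hn2 b)).add
      ((h.contDiffOn_ell b).mul (hn2 a))))

include h in
theorem IsInducedOn.contDiffOn_connection (c a b : Fin n) :
    ContDiffOn ℝ ∞ (fun y => D.connection y c a b) s := by
  have hγ := fun a b c => contDiffOn_pd h.isOpen (h.contDiffOn_γ a b) c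
  have hl := fun a b => contDiffOn_pd h.isOpen (h.contDiffOn_ell a) b
  unfold connection
  exact (contDiffOn_const.mul (ContDiffOn.sum fun d _ => (h.contDiffOn_P c d).mul
    (((hγ b d a).add (hγ a d b)).sub (hγ a b d)))).add
    ((contDiffOn_const.mul (h.contDiffOn_nvec c)).mul ((hl b a).add (hl a b)))

include h in
theorem IsInducedOn.contDiffOn_normal (μ : Fin (n + 1)) :
    ContDiffOn ℝ ∞ (fun y => D.normal F Z y μ) s := by
  simp only [normal, Pi.add_apply, Finset.sum_apply, Pi.smul_apply, smul_eq_mul]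
  exact (ContDiffOn.sum fun a _ => (h.contDiffOn_nvec a).mul (h.contDiffOn_tangent a μ)).add
    (h.contDiffOn_n2.mul (h.contDiffOn_rigging μ))

include h in
theorem IsInducedOn.γ_symm {x : Coord n} (hx : x ∈ s) (a b : Fin n) :
    D.γ x a b = D.γ x b a := by
  rw [h.γ_eq x hx, h.γ_eq x hx, h.isMetricOn.metricForm_comm (h.mapsTo hx)]

include h in
theorem IsInducedOn.isRegularAt {x : Coord n} (hx : x ∈ s) : D.IsRegularAt x where
  diff_γ a b := differentiableAt_of_contDiffOn h.isOpen (h.contDiffOn_γ a b) hx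
  diff_ell a := differentiableAt_of_contDiffOn h.isOpen (h.contDiffOn_ell a) hx
  diff_ell2 := differentiableAt_of_contDiffOn h.isOpen h.contDiffOn_ell2 hx
  symm := (h.isOpen.eventually_mem hx).mono fun _ hy a b => h.γ_symm hy a b
  nondegenerate := (h.isOpen.eventually_mem hx).mono fun y hy => h.nondegenerate y hy

/-! ### The adapted frame and its dual -/

include h in
theorem IsInducedOn.metricForm_tangent_rigging {x : Coord n} (hx : x ∈ s) (a : Fin n) :
    metricForm G (F x) (tangent F a x) (Z x) = D.ell x a := by
  rw [h.ell_eq x hx, h.isMetricOn.metricForm_comm (h.mapsTo hx)]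

include h in
theorem IsInducedOn.dualTangent_tangent {x : Coord n} (hx : x ∈ s) (c b : Fin n) :
    metricForm G (F x) (D.dualTangent F Z c x) (tangent F b x) = if c = b then 1 else 0 := by
  rw [metricForm_dualTangent, ← D.P_γ (h.nondegenerate x hx) c b]
  simp only [h.γ_eq x hx, h.ell_eq x hx]

include h in
theorem IsInducedOn.dualTangent_rigging {x : Coord n} (hx : x ∈ s) (c : Fin n) :
    metricForm G (F x) (D.dualTangent F Z c x) (Z x) = 0 := by
  rw [metricForm_dualTangent, ← D.P_ell (h.nondegenerate x hx) c]
  simp only [h.metricForm_tangent_rigging hx, h.ell2_eq x hx, mul_comm]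

include h in
theorem IsInducedOn.normal_tangent {x : Coord n} (hx : x ∈ s) (b : Fin n) :
    metricForm G (F x) (D.normal F Z x) (tangent F b x) = 0 := by
  rw [metricForm_normal, ← D.γ_nvec (h.nondegenerate x hx) b, h.ell_eq x hx]
  congr 1
  exact Finset.sum_congr rfl fun a _ => by rw [h.γ_symm hx, h.γ_eq x hx, mul_comm]

include h in
theorem IsInducedOn.normal_rigging {x : Coord n} (hx : x ∈ s) :
    metricForm G (F x) (D.normal F Z x) (Z x) = 1 := by
  rw [metricForm_normal, ← D.ell_nvec (h.nondegenerate x hx), h.ell2_eq x hx]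
  congr 1
  exact Finset.sum_congr rfl fun a _ => by rw [h.metricForm_tangent_rigging hx, mul_comm]

include h in
theorem IsInducedOn.tangent_normal {x : Coord n} (hx : x ∈ s) (b : Fin n) :
    metricForm G (F x) (tangent F b x) (D.normal F Z x) = 0 := by
  rw [h.isMetricOn.metricForm_comm (h.mapsTo hx), h.normal_tangent hx]

include h in
theorem IsInducedOn.rigging_normal {x : Coord n} (hx : x ∈ s) :
    metricForm G (F x) (Z x) (D.normal F Z x) = 1 := by
  rw [h.isMetricOn.metricForm_comm (h.mapsTo hx), h.normal_rigging hx]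

include h in
theorem IsInducedOn.dualTangent_normal {x : Coord n} (hx : x ∈ s) (c : Fin n) :
    metricForm G (F x) (D.dualTangent F Z c x) (D.normal F Z x) = D.nvec x c := by
  rw [normal]
  simp [h.dualTangent_tangent hx, h.dualTangent_rigging hx]

include h in
theorem IsInducedOn.normal_normal {x : Coord n} (hx : x ∈ s) :
    metricForm G (F x) (D.normal F Z x) (D.normal F Z x) = D.n2 x := by
  rw [metricForm_normal]
  simp [h.tangent_normal hx, h.rigging_normal hx]

include h in
/-- The completeness relation `e_c ⊗ θ^c + ζ ⊗ ν = 1` of the frame and its dual. -/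
theorem IsInducedOn.frame_complete {x : Coord n} (hx : x ∈ s) (μ ν : Fin (n + 1)) :
    ∑ c, tangent F c x μ * metricForm G (F x) (D.dualTangent F Z c x) (Pi.single ν 1)
      + Z x μ * metricForm G (F x) (D.normal F Z x) (Pi.single ν 1) = if μ = ν then 1 else 0 := by
  set E : Matrix (Fin (n + 1)) (Fin n ⊕ Unit) ℝ :=
    Matrix.of fun μ => Sum.elim (fun c => tangent F c x μ) (fun _ => Z x μ) with hE
  set T : Matrix (Fin n ⊕ Unit) (Fin (n + 1)) ℝ :=
    Matrix.of (Sum.elim (fun c ν => metricForm G (F x) (D.dualTangent F Z c x) (Pi.single ν 1))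
      (fun _ ν => metricForm G (F x) (D.normal F Z x) (Pi.single ν 1))) with hT
  have h1 : T * E = 1 := by
    ext i j
    rw [Matrix.mul_apply]
    rcases i with i | i <;> rcases j with j | j
    · simpa [hE, hT, Matrix.one_apply, ← metricForm_eq_sum_single] using h.dualTangent_tangent hx i j
    · simpa [hE, hT, Matrix.one_apply, ← metricForm_eq_sum_single] using h.dualTangent_rigging hx i
    · simpa [hE, hT, Matrix.one_apply, ← metricForm_eq_sum_single] using h.normal_tangent hx j
    · simpa [hE, hT, Matrix.one_apply, ← metricForm_eq_sum_single] using h.normal_rigging hx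
  have h2 : E * T = 1 := (Matrix.mul_eq_one_comm_of_card_eq _ _ _ (by simp)).1 h1
  have h3 := congrFun (congrFun h2 μ) ν
  rw [Matrix.mul_apply, Fintype.sum_sum_type] at h3
  simpa [hE, hT, Matrix.one_apply] using h3

include h in
theorem IsInducedOn.frame_expansion {x : Coord n} (hx : x ∈ s) (v : Fin (n + 1) → ℝ) :
    v = ∑ c, metricForm G (F x) (D.dualTangent F Z c x) v • tangent F c x
      + metricForm G (F x) (D.normal F Z x) v • Z x := by
  funext μ
  have h1 : v μ = ∑ ν, (if μ = ν then 1 else 0) * v ν := by simp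
  rw [h1]
  simp only [← h.frame_complete hx, add_mul, Finset.sum_add_distrib, Finset.sum_mul,
    Pi.add_apply, Finset.sum_apply, Pi.smul_apply, smul_eq_mul,
    metricForm_eq_sum_single (v := v)]
  rw [Finset.sum_comm]
  congr 1
  · exact Finset.sum_congr rfl fun _ _ => Finset.sum_congr rfl fun _ _ => by ring
  · exact Finset.sum_congr rfl fun _ _ => by ring

include h in
/-- A vector is determined by its scalar products with the frame `(e_a, ζ)`. -/
theorem IsInducedOn.ext_frame {x : Coord n} (hx : x ∈ s) {v w : Fin (n + 1) → ℝ}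
    (he : ∀ a, metricForm G (F x) (tangent F a x) v = metricForm G (F x) (tangent F a x) w)
    (hZ : metricForm G (F x) (Z x) v = metricForm G (F x) (Z x) w) : v = w := by
  rw [h.frame_expansion hx v, h.frame_expansion hx w]
  simp only [metricForm_dualTangent, metricForm_normal, he, hZ]

end LocalData

end Embedding


/-! ### The Gauss and Weingarten equations -/

/-- The pull-back of `£_Z G` is twice the symmetrized covariant derivative of `Z`, lowered by `G`. -/
theorem IsMetricOn.pullbackLie_eq {n m : ℕ} {t : Set (Coord m)}
    {G : Coord m → Fin m → Fin m → ℝ} (hG : IsMetricOn G t) {F : Coord n → Coord m}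
    (Z : Coord n → Fin m → ℝ) {x : Coord n} (hx : F x ∈ t) (a b : Fin n) :
    pullbackLie G F Z x a b
      = metricForm G (F x) (covAlong (christoffel G) F a Z x) (tangent F b x)
        + metricForm G (F x) (tangent F a x) (covAlong (christoffel G) F b Z x) := by
  set K : Fin m → Fin m → ℝ := fun f μ => ∑ lam, christoffel G (F x) f lam μ * Z x lam with hK
  have h1 : ∀ μ ν, ∑ lam, Z x lam * pd lam (fun y => G y μ ν) (F x)
      = ∑ f, (G (F x) f ν * K f μ + G (F x) μ f * K f ν) := by
    intro μ ν
    simp only [hG.pd_eq hx, hK, Finset.mul_sum, ← Finset.sum_add_distrib]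
    rw [Finset.sum_comm]
    exact Finset.sum_congr rfl fun f _ => Finset.sum_congr rfl fun lam _ => by ring
  have h2 : ∀ a μ, covAlong (christoffel G) F a Z x μ = pd a (fun y => Z y μ) x
      + ∑ α, K μ α * tangent F a x α := by
    intro a μ
    simp only [covAlong, connForm, hK, Finset.sum_mul]
    congr 1
    rw [Finset.sum_comm]
    exact Finset.sum_congr rfl fun f _ => Finset.sum_congr rfl fun lam _ => by
      rw [hG.christoffel_symm hx]; ring
  simp only [metricForm_apply, h2, pullbackLie, h1, Finset.sum_add_distrib, mul_add, add_mul,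
    Finset.sum_mul, Finset.mul_sum]
  change _ + _ + (∑ μ, ∑ ν, G (F x) μ ν * (pd a (fun y => Z y μ) x * tangent F b x ν)
    + ∑ μ, ∑ ν, G (F x) μ ν * (tangent F a x μ * pd b (fun y => Z y ν) x)) = _
  have t1 : ∑ μ, ∑ ν, ∑ f, G (F x) f ν * K f μ * pd a (fun y => F y μ) x * pd b (fun y => F y ν) x
      = ∑ μ, ∑ ν, ∑ α, K μ α * tangent F a x α * G (F x) μ ν * tangent F b x ν := by
    calc _ = ∑ μ, ∑ f, ∑ ν, G (F x) f ν * K f μ * pd a (fun y => F y μ) x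
            * pd b (fun y => F y ν) x := Finset.sum_congr rfl fun μ _ => Finset.sum_comm
      _ = ∑ f, ∑ μ, ∑ ν, G (F x) f ν * K f μ * pd a (fun y => F y μ) x
            * pd b (fun y => F y ν) x := Finset.sum_comm
      _ = ∑ f, ∑ ν, ∑ μ, G (F x) f ν * K f μ * pd a (fun y => F y μ) x
            * pd b (fun y => F y ν) x := Finset.sum_congr rfl fun μ _ => Finset.sum_comm
      _ = _ := Finset.sum_congr rfl fun f _ => Finset.sum_congr rfl fun ν _ =>
          Finset.sum_congr rfl fun μ _ => by simp only [tangent]; ring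
  have t2 : ∑ μ, ∑ ν, ∑ f, G (F x) μ f * K f ν * pd a (fun y => F y μ) x * pd b (fun y => F y ν) x
      = ∑ μ, ∑ ν, ∑ α, tangent F a x μ * G (F x) μ ν * (K ν α * tangent F b x α) := by
    refine Finset.sum_congr rfl fun μ _ => ?_
    rw [Finset.sum_comm]
    exact Finset.sum_congr rfl fun f _ => Finset.sum_congr rfl fun ν _ => by
      simp only [tangent]; ring
  rw [t1, t2]
  simp only [mul_comm, mul_left_comm, mul_assoc]
  ring

namespace LocalData

variable {n : ℕ} {D : LocalData n} {s : Set (Coord n)} {t : Set (Coord (n + 1))}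
  {G : Coord (n + 1) → Fin (n + 1) → Fin (n + 1) → ℝ} {F : Coord n → Coord (n + 1)}
  {Z : Coord n → Fin (n + 1) → ℝ}

section

variable (h : D.IsInducedOn s t G F Z) {x : Coord n} (hx : x ∈ s)
include h hx

theorem IsInducedOn.differentiableAt {f : Coord n → ℝ} (hf : ContDiffOn ℝ ∞ f s) :
    DifferentiableAt ℝ f x :=
  differentiableAt_of_contDiffOn h.isOpen hf hx

theorem IsInducedOn.pd_metricForm {V W : Coord n → Fin (n + 1) → ℝ}
    (hV : ∀ μ, ContDiffOn ℝ ∞ (fun y => V y μ) s) (hW : ∀ μ, ContDiffOn ℝ ∞ (fun y => W y μ) s)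
    (a : Fin n) : pd a (fun y => metricForm G (F y) (V y) (W y)) x
      = metricForm G (F x) (covAlong (christoffel G) F a V x) (W x)
        + metricForm G (F x) (V x) (covAlong (christoffel G) F a W x) :=
  h.isMetricOn.pd_metricForm h.isOpen h.contDiffOn_map h.mapsTo
    (fun μ => h.differentiableAt hx (hV μ)) (fun μ => h.differentiableAt hx (hW μ)) hx a

theorem IsInducedOn.metricForm_comm (v w : Fin (n + 1) → ℝ) :
    metricForm G (F x) v w = metricForm G (F x) w v :=
  h.isMetricOn.metricForm_comm (h.mapsTo hx) v w

theorem IsInducedOn.covAlong_tangent_comm (a b : Fin n) :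
    covAlong (christoffel G) F a (tangent F b) x = covAlong (christoffel G) F b (tangent F a) x :=
  HypData.covAlong_tangent_comm h.isOpen h.contDiffOn_map hx
    (h.isMetricOn.christoffel_symm (h.mapsTo hx)) a b

theorem IsInducedOn.pd_γ_symm (c a b : Fin n) :
    pd c (fun y => D.γ y a b) x = pd c (fun y => D.γ y b a) x :=
  pd_congr ((h.isOpen.eventually_mem hx).mono fun _ hy => h.γ_symm hy a b) c

/-- The Koszul formula along the hypersurface. -/
theorem IsInducedOn.koszul (a b c : Fin n) :
    metricForm G (F x) (tangent F c x) (covAlong (christoffel G) F a (tangent F b) x)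
      = (1 / 2) * (pd a (fun y => D.γ y b c) x + pd b (fun y => D.γ y a c) x
        - pd c (fun y => D.γ y a b) x) := by
  have hp : ∀ a b c, pd a (fun y => D.γ y b c) x
      = metricForm G (F x) (tangent F c x) (covAlong (christoffel G) F a (tangent F b) x)
        + metricForm G (F x) (tangent F b x) (covAlong (christoffel G) F a (tangent F c) x) := by
    intro a b c
    rw [pd_congr ((h.isOpen.eventually_mem hx).mono fun y hy => h.γ_eq y hy b c),
      h.pd_metricForm hx (h.contDiffOn_tangent b) (h.contDiffOn_tangent c),
      h.metricForm_comm hx (covAlong _ _ _ _ _)]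
  rw [hp a b c, hp b a c, hp c a b, h.covAlong_tangent_comm hx b a,
    h.covAlong_tangent_comm hx c a, h.covAlong_tangent_comm hx c b]
  ring

theorem IsInducedOn.pd_ell (a b : Fin n) : pd a (fun y => D.ell y b) x
    = metricForm G (F x) (tangent F b x) (covAlong (christoffel G) F a Z x)
      + metricForm G (F x) (Z x) (covAlong (christoffel G) F a (tangent F b) x) := by
  rw [pd_congr ((h.isOpen.eventually_mem hx).mono fun y hy => h.ell_eq y hy b),
    h.pd_metricForm hx h.contDiffOn_rigging (h.contDiffOn_tangent b),
    h.metricForm_comm hx (covAlong _ _ _ _ _)]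

/-- The tangential part of the derivative of the rigging is `Y + F`. -/
theorem IsInducedOn.tangent_covAlong_rigging (a b : Fin n) :
    metricForm G (F x) (tangent F b x) (covAlong (christoffel G) F a Z x)
      = D.Y x a b + D.F x a b := by
  rw [h.Y_eq x hx, h.isMetricOn.pullbackLie_eq Z (h.mapsTo hx), LocalData.F, h.pd_ell hx,
    h.pd_ell hx, h.covAlong_tangent_comm hx b a, h.metricForm_comm hx (covAlong _ _ _ _ _)]
  ring

theorem IsInducedOn.rigging_covAlong_rigging (a : Fin n) :
    metricForm G (F x) (Z x) (covAlong (christoffel G) F a Z x)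
      = (1 / 2) * pd a D.ell2 x := by
  rw [pd_congr ((h.isOpen.eventually_mem hx).mono fun y hy => h.ell2_eq y hy),
    h.pd_metricForm hx h.contDiffOn_rigging h.contDiffOn_rigging,
    h.metricForm_comm hx (covAlong _ _ _ _ _)]
  ring

theorem IsInducedOn.Y_symm (a b : Fin n) : D.Y x a b = D.Y x b a := by
  rw [h.Y_eq x hx, h.Y_eq x hx, h.isMetricOn.pullbackLie_eq Z (h.mapsTo hx),
    h.isMetricOn.pullbackLie_eq Z (h.mapsTo hx), h.metricForm_comm hx (tangent F a x),
    h.metricForm_comm hx (tangent F b x), add_comm]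

theorem IsInducedOn.U_symm (a b : Fin n) : D.U x a b = D.U x b a := by
  rw [(h.isRegularAt hx).U_eq, (h.isRegularAt hx).U_eq]
  congr 1
  · congr 1
    refine Finset.sum_congr rfl fun c _ => ?_
    rw [h.pd_γ_symm hx c a b]
    ring
  · ring

/-- The Gauss equation: the derivative of the frame in terms of the metric hypersurface
connection. -/
theorem IsInducedOn.covAlong_tangent (a b : Fin n) :
    covAlong (christoffel G) F a (tangent F b) x
      = ∑ c, D.connection x c a b • tangent F c x - D.Y x a b • D.normal F Z x
        - D.U x a b • Z x := by
  refine h.ext_frame hx (fun c => ?_) ?_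
  · simp only [map_sub, map_sum, map_smul, smul_eq_mul, h.tangent_normal hx,
      h.metricForm_tangent_rigging hx, h.koszul hx, ← h.γ_eq x hx]
    have := (h.isRegularAt hx).γ_connection c a b
    simp only [mul_comm (D.γ x c _)] at this
    rw [this]
    ring
  · have h1 := h.pd_ell hx a b
    rw [h.tangent_covAlong_rigging hx, LocalData.F] at h1
    simp only [map_sub, map_sum, map_smul, smul_eq_mul, h.rigging_normal hx,
      ← h.ell_eq x hx, ← h.ell2_eq x hx]
    have := (h.isRegularAt hx).ell_connection a b
    simp only [mul_comm (D.ell x _)] at this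
    rw [this]
    linear_combination -h1

end


/-! ### Curvature along the hypersurface -/

variable {n : ℕ} {D : LocalData n} {s : Set (Coord n)} {t : Set (Coord (n + 1))}
  {G : Coord (n + 1) → Fin (n + 1) → Fin (n + 1) → ℝ} {F : Coord n → Coord (n + 1)}
  {Z : Coord n → Fin (n + 1) → ℝ}

section

variable (h : D.IsInducedOn s t G F Z)
include h

theorem IsInducedOn.contDiffOn_covAlong {V : Coord n → Fin (n + 1) → ℝ}
    (hV : ∀ μ, ContDiffOn ℝ ∞ (fun y => V y μ) s) (a : Fin n) (μ : Fin (n + 1)) :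
    ContDiffOn ℝ ∞ (fun y => covAlong (christoffel G) F a V y μ) s :=
  HypData.contDiffOn_covAlong h.isOpen h.contDiffOn_map h.mapsTo
    h.isMetricOn.contDiffOn_christoffel hV a μ

theorem IsInducedOn.contDiffOn_Y (a b : Fin n) : ContDiffOn ℝ ∞ (fun y => D.Y y a b) s :=
  ((h.contDiffOn_metricForm (h.contDiffOn_tangent b)
    (h.contDiffOn_covAlong h.contDiffOn_rigging a)).sub (h.contDiffOn_F a b)).congr
    fun y hy => by rw [h.tangent_covAlong_rigging hy]; ring

variable {x : Coord n} (hx : x ∈ s)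
include hx

theorem IsInducedOn.normal_covAlong_rigging (b : Fin n) :
    metricForm G (F x) (D.normal F Z x) (covAlong (christoffel G) F b Z x)
      = D.r x b - D.s x b + (1 / 2) * D.n2 x * pd b D.ell2 x := by
  have hF : ∀ c, D.F x b c = -D.F x c b := fun c => by simp only [LocalData.F]; ring
  simp only [metricForm_normal, h.tangent_covAlong_rigging hx, h.rigging_covAlong_rigging hx,
    h.Y_symm hx b, hF, LocalData.r, LocalData.s, mul_add, mul_neg, Finset.sum_add_distrib, Finset.sum_neg_distrib]
  ring

theorem IsInducedOn.dualTangent_covAlong_rigging (c b : Fin n) :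
    metricForm G (F x) (D.dualTangent F Z c x) (covAlong (christoffel G) F b Z x)
      = ∑ a, D.P x c a * (D.Y x b a + D.F x b a) + (1 / 2) * D.nvec x c * pd b D.ell2 x := by
  simp only [metricForm_dualTangent, h.tangent_covAlong_rigging hx,
    h.rigging_covAlong_rigging hx]
  ring

theorem IsInducedOn.tangent_covAlong_normal (b a : Fin n) :
    metricForm G (F x) (tangent F a x) (covAlong (christoffel G) F b (D.normal F Z) x)
      = D.n2 x * D.Y x b a + D.U x b a := by
  have h1 := h.pd_metricForm hx (h.contDiffOn_tangent a) h.contDiffOn_normal b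
  rw [pd_congr ((h.isOpen.eventually_mem hx).mono fun y hy => h.tangent_normal hy a), pd_const,
    h.covAlong_tangent hx] at h1
  simp only [map_sub, map_sum, map_smul, smul_eq_mul, LinearMap.sub_apply, LinearMap.sum_apply,
    LinearMap.smul_apply, h.tangent_normal hx, h.rigging_normal hx, h.normal_normal hx,
    mul_zero, Finset.sum_const_zero] at h1
  linear_combination -h1

theorem IsInducedOn.rigging_covAlong_normal (b : Fin n) :
    metricForm G (F x) (Z x) (covAlong (christoffel G) F b (D.normal F Z) x)
      = -(D.r x b - D.s x b + (1 / 2) * D.n2 x * pd b D.ell2 x) := by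
  have h1 := h.pd_metricForm hx h.contDiffOn_rigging h.contDiffOn_normal b
  rw [pd_congr ((h.isOpen.eventually_mem hx).mono fun y hy => h.rigging_normal hy), pd_const,
    h.metricForm_comm hx (covAlong _ _ _ _ _), h.normal_covAlong_rigging hx] at h1
  linear_combination -h1

theorem IsInducedOn.dualTangent_covAlong_normal (c b : Fin n) :
    metricForm G (F x) (D.dualTangent F Z c x) (covAlong (christoffel G) F b (D.normal F Z) x)
      = ∑ a, D.P x c a * (D.n2 x * D.Y x b a + D.U x b a)
        - D.nvec x c * (D.r x b - D.s x b + (1 / 2) * D.n2 x * pd b D.ell2 x) := by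
  simp only [metricForm_dualTangent, h.tangent_covAlong_normal hx, h.rigging_covAlong_normal hx]
  ring

/-- The scalar products of the Gauss equation with the dual frame. -/
theorem IsInducedOn.dualTangent_covAlong_tangent (c a b : Fin n) :
    metricForm G (F x) (D.dualTangent F Z c x) (covAlong (christoffel G) F a (tangent F b) x)
      = D.connection x c a b - D.Y x a b * D.nvec x c := by
  rw [h.covAlong_tangent hx]
  simp [h.dualTangent_tangent hx, h.dualTangent_normal hx, h.dualTangent_rigging hx]

/-- The derivative `∇°_b n^c` of the vector field `n`. -/
theorem IsInducedOn.covDerivVec_nvec (b c : Fin n) :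
    covDerivVec D.connection D.nvec x b c
      = ∑ a, D.P x c a * (D.U x b a - D.n2 x * D.F x b a)
        + D.nvec x c * (D.s x b - D.n2 x * pd b D.ell2 x) := by
  have hn := fun a => h.differentiableAt hx (h.contDiffOn_nvec a)
  have he := fun a μ => h.differentiableAt hx (h.contDiffOn_tangent a μ)
  have hZ := fun μ => h.differentiableAt hx (h.contDiffOn_rigging μ)
  have hn2 := h.differentiableAt hx h.contDiffOn_n2
  have h1 : covAlong (christoffel G) F b (D.normal F Z) x
      = ∑ a, (pd b (fun y => D.nvec y a) x • tangent F a x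
          + D.nvec x a • covAlong (christoffel G) F b (tangent F a) x)
        + (pd b D.n2 x • Z x + D.n2 x • covAlong (christoffel G) F b Z x) := by
    unfold normal
    have hsum : ∀ μ, DifferentiableAt ℝ
        (fun y => (∑ a, D.nvec y a • tangent F a y) μ) x := fun μ => by
      simpa using DifferentiableAt.fun_sum fun a _ => (hn a).fun_mul (he a μ)
    have hn2Z : ∀ μ, DifferentiableAt ℝ (fun y => (D.n2 y • Z y) μ) x := fun μ =>
      hn2.fun_mul (hZ μ)
    rw [covAlong_add hsum hn2Z, covAlong_sum_smul hn he, covAlong_smul hn2 hZ]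
  have h2 := congrArg (metricForm G (F x) (D.dualTangent F Z c x)) h1
  rw [h.dualTangent_covAlong_normal hx] at h2
  simp only [map_add, map_sum, map_smul, smul_eq_mul, h.dualTangent_tangent hx,
    h.dualTangent_covAlong_tangent hx, h.dualTangent_rigging hx,
    h.dualTangent_covAlong_rigging hx, Finset.sum_add_distrib, mul_ite, mul_one, mul_zero,
    Finset.sum_ite_eq, Finset.mem_univ, if_true] at h2
  have h3 : ∑ a, D.nvec x a * (D.connection x c b a - D.Y x b a * D.nvec x c)
      = ∑ f, D.connection x c b f * D.nvec x f - D.r x b * D.nvec x c := by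
    simp only [r, Finset.sum_mul, ← Finset.sum_sub_distrib]
    exact Finset.sum_congr rfl fun a _ => by rw [h.Y_symm hx a b]; ring
  rw [h3] at h2
  simp only [mul_add, mul_sub, Finset.sum_add_distrib, Finset.sum_sub_distrib,
    Finset.mul_sum] at h2 ⊢
  have h4 : ∀ T : Fin n → ℝ, ∑ a, D.P x c a * (D.n2 x * T a)
      = ∑ a, D.n2 x * (D.P x c a * T a) := fun T => Finset.sum_congr rfl fun a _ => by ring
  simp only [h4] at h2 ⊢
  unfold covDerivVec
  linear_combination -h2

/-- The component of `R(e_c, e_d) e_b` along `e_i` in the frame `(e_a, ζ)`. -/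
theorem IsInducedOn.dualTangent_curvVec (i b c d : Fin n) :
    metricForm G (F x) (D.dualTangent F Z i x)
        (curvVec (christoffel G) (F x) (tangent F c x) (tangent F d x) (tangent F b x))
      = curvature D.connection x i b c d
        - D.nvec x i * (covDerivTensor D.connection D.Y x c d b
          - covDerivTensor D.connection D.Y x d c b)
        - D.Y x d b * metricForm G (F x) (D.dualTangent F Z i x)
          (covAlong (christoffel G) F c (D.normal F Z) x)
        + D.Y x c b * metricForm G (F x) (D.dualTangent F Z i x)
          (covAlong (christoffel G) F d (D.normal F Z) x)
        - D.U x d b * metricForm G (F x) (D.dualTangent F Z i x)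
          (covAlong (christoffel G) F c Z x)
        + D.U x c b * metricForm G (F x) (D.dualTangent F Z i x)
          (covAlong (christoffel G) F d Z x) := by
  have hΓ := fun i a b => h.differentiableAt hx (h.contDiffOn_connection i a b)
  have hY := fun a b => h.differentiableAt hx (h.contDiffOn_Y a b)
  have hU := fun a b => h.differentiableAt hx (h.contDiffOn_U a b)
  have he := fun a μ => h.differentiableAt hx (h.contDiffOn_tangent a μ)
  have hν := fun μ => h.differentiableAt hx (h.contDiffOn_normal μ)
  have hZ := fun μ => h.differentiableAt hx (h.contDiffOn_rigging μ)
  have key : ∀ c d, metricForm G (F x) (D.dualTangent F Z i x) (covAlong (christoffel G) F c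
        (covAlong (christoffel G) F d (tangent F b)) x)
      = pd c (fun y => D.connection y i d b) x
        + ∑ f, D.connection x f d b * (D.connection x i c f - D.Y x c f * D.nvec x i)
        - (pd c (fun y => D.Y y d b) x * D.nvec x i + D.Y x d b * metricForm G (F x)
          (D.dualTangent F Z i x) (covAlong (christoffel G) F c (D.normal F Z) x))
        - D.U x d b * metricForm G (F x) (D.dualTangent F Z i x)
          (covAlong (christoffel G) F c Z x) := by
    intro c d
    have hsum : ∀ μ, DifferentiableAt ℝ
        (fun y => (∑ f, D.connection y f d b • tangent F f y) μ) x := fun μ => by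
      simpa using DifferentiableAt.fun_sum fun f _ => (hΓ f d b).fun_mul (he f μ)
    have hYν : ∀ μ, DifferentiableAt ℝ (fun y => (D.Y y d b • D.normal F Z y) μ) x := fun μ =>
      (hY d b).fun_mul (hν μ)
    have hdif : ∀ μ, DifferentiableAt ℝ (fun y =>
        (∑ f, D.connection y f d b • tangent F f y - D.Y y d b • D.normal F Z y) μ) x := fun μ =>
      (hsum μ).fun_sub (hYν μ)
    have hUZ : ∀ μ, DifferentiableAt ℝ (fun y => (D.U y d b • Z y) μ) x := fun μ =>
      (hU d b).fun_mul (hZ μ)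
    rw [covAlong_congr ((h.isOpen.eventually_mem hx).mono fun y hy => h.covAlong_tangent hy d b),
      covAlong_sub hdif hUZ, covAlong_sub hsum hYν,
      covAlong_sum_smul (fun f => hΓ f d b) he, covAlong_smul (hY d b) hν,
      covAlong_smul (hU d b) hZ]
    simp only [map_add, map_sub, map_sum, map_smul, smul_eq_mul, h.dualTangent_tangent hx,
      h.dualTangent_covAlong_tangent hx, h.dualTangent_rigging hx, h.dualTangent_normal hx,
      Finset.sum_add_distrib, mul_ite, mul_one, mul_zero, zero_add,
      Finset.sum_ite_eq, Finset.mem_univ, if_true]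
  rw [← covAlong_comm h.isOpen h.isMetricOn.isOpen h.contDiffOn_map h.mapsTo
    h.isMetricOn.contDiffOn_christoffel (h.contDiffOn_tangent b) hx, map_sub, key, key]
  have tors := (connection_spec (h.isRegularAt hx)).torsionFree
  have t1 : ∀ c d, ∑ f, D.connection x f d b * (D.connection x i c f - D.Y x c f * D.nvec x i)
      = ∑ f, D.connection x i c f * D.connection x f d b
        - D.nvec x i * ∑ f, D.connection x f d b * D.Y x c f := by
    intro c d
    rw [Finset.mul_sum, ← Finset.sum_sub_distrib]
    exact Finset.sum_congr rfl fun f _ => by ring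
  have t2 : ∑ f, D.connection x f d c * D.Y x f b = ∑ f, D.connection x f c d * D.Y x f b :=
    Finset.sum_congr rfl fun f _ => by rw [tors f d c]
  simp only [t1, curvature, covDerivTensor, Finset.sum_add_distrib, Finset.sum_sub_distrib, t2]
  ring

/-- The tangential part of `R(e_c, e_b) ζ`. -/
theorem IsInducedOn.tangent_curvVec_rigging (b c d : Fin n) :
    metricForm G (F x) (tangent F d x)
        (curvVec (christoffel G) (F x) (tangent F c x) (tangent F b x) (Z x))
      = covDerivTensor D.connection D.Y x c b d + covDerivTensor D.connection D.F x c b d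
        - covDerivTensor D.connection D.Y x b c d - covDerivTensor D.connection D.F x b c d
        + D.Y x c d * (D.r x b - D.s x b + (1 / 2) * D.n2 x * pd b D.ell2 x)
        - D.Y x b d * (D.r x c - D.s x c + (1 / 2) * D.n2 x * pd c D.ell2 x)
        + (1 / 2) * D.U x c d * pd b D.ell2 x - (1 / 2) * D.U x b d * pd c D.ell2 x := by
  have hZ := h.contDiffOn_rigging
  have key : ∀ c b, metricForm G (F x) (tangent F d x) (covAlong (christoffel G) F c
        (covAlong (christoffel G) F b Z) x)
      = pd c (fun y => D.Y y b d) x + pd c (fun y => D.F y b d) x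
        - ∑ f, D.connection x f c d * (D.Y x b f + D.F x b f)
        + D.Y x c d * (D.r x b - D.s x b + (1 / 2) * D.n2 x * pd b D.ell2 x)
        + D.U x c d * ((1 / 2) * pd b D.ell2 x) := by
    intro c b
    have h1 := h.pd_metricForm hx (h.contDiffOn_tangent d) (h.contDiffOn_covAlong hZ b) c
    rw [pd_congr ((h.isOpen.eventually_mem hx).mono fun y hy =>
        h.tangent_covAlong_rigging hy b d),
      pd_add (h.differentiableAt hx (h.contDiffOn_Y b d))
        (h.differentiableAt hx (h.contDiffOn_F b d)), h.covAlong_tangent hx] at h1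
    simp only [map_sub, map_sum, map_smul, smul_eq_mul, LinearMap.sub_apply, LinearMap.sum_apply,
      LinearMap.smul_apply, h.tangent_covAlong_rigging hx, h.normal_covAlong_rigging hx,
      h.rigging_covAlong_rigging hx] at h1
    linear_combination -h1
  rw [← covAlong_comm h.isOpen h.isMetricOn.isOpen h.contDiffOn_map h.mapsTo
    h.isMetricOn.contDiffOn_christoffel hZ hx, map_sub, key, key]
  have tors := (connection_spec (h.isRegularAt hx)).torsionFree
  have t2 : ∀ T : Coord n → Fin n → Fin n → ℝ,
      ∑ f, D.connection x f b c * T x f d = ∑ f, D.connection x f c b * T x f d := fun T =>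
    Finset.sum_congr rfl fun f _ => by rw [tors f b c]
  simp only [covDerivTensor, Finset.sum_add_distrib, mul_add, t2]
  ring

/-- The Ricci tensor as a trace in the adapted frame. -/
theorem IsInducedOn.ricci_eq_trace (v w : Fin (n + 1) → ℝ) :
    ∑ μ, ∑ ν, ricci (christoffel G) (F x) μ ν * v μ * w ν
      = ∑ c, metricForm G (F x) (D.dualTangent F Z c x)
          (curvVec (christoffel G) (F x) (tangent F c x) w v)
        + metricForm G (F x) (D.normal F Z x) (curvVec (christoffel G) (F x) (Z x) w v) := by
  set T : Fin (n + 1) → Fin (n + 1) → ℝ := fun α f =>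
    ∑ b, ∑ β, curvature (christoffel G) (F x) f b α β * w β * v b with hT
  have h1 : ∀ u z, metricForm G (F x) u (curvVec (christoffel G) (F x) z w v)
      = ∑ α, ∑ f, z α * metricForm G (F x) u (Pi.single f 1) * T α f := by
    intro u z
    rw [metricForm_eq_sum_single, Finset.sum_comm]
    refine Finset.sum_congr rfl fun f _ => ?_
    simp only [curvVec, hT, Finset.mul_sum]
    rw [Finset.sum_comm]
    exact Finset.sum_congr rfl fun _ _ => Finset.sum_congr rfl fun _ _ =>
      Finset.sum_congr rfl fun _ _ => by ring
  have h2 : ∑ μ, ∑ ν, ricci (christoffel G) (F x) μ ν * v μ * w ν = ∑ α, T α α := by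
    simp only [ricci, hT, Finset.sum_mul]
    calc _ = ∑ μ, ∑ a, ∑ ν, curvature (christoffel G) (F x) a μ a ν * v μ * w ν :=
          Finset.sum_congr rfl fun μ _ => Finset.sum_comm
      _ = _ := by
          rw [Finset.sum_comm]
          exact Finset.sum_congr rfl fun _ _ => Finset.sum_congr rfl fun _ _ =>
            Finset.sum_congr rfl fun _ _ => by ring
  have h3 : ∑ α, T α α = ∑ α, ∑ f, (if α = f then 1 else 0) * T α f := by simp
  rw [h2, h3]
  simp only [h1, ← h.frame_complete hx, add_mul, Finset.sum_add_distrib, Finset.sum_mul]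
  congr 1
  calc _ = ∑ α, ∑ c, ∑ f, tangent F c x α * metricForm G (F x) (D.dualTangent F Z c x)
        (Pi.single f 1) * T α f := Finset.sum_congr rfl fun α _ => Finset.sum_comm
    _ = _ := Finset.sum_comm

/-- Once `g(ν, ν) Riem(ζ, ·, ζ, ·)` is subtracted, the Ricci tensor involves only curvature
operators of planes tangent to the hypersurface. -/
theorem IsInducedOn.ricci_sub_riemann (b d : Fin n) :
    ∑ μ, ∑ ν, ricci (christoffel G) (F x) μ ν * tangent F b x μ * tangent F d x ν
        - D.n2 x * metricForm G (F x) (Z x)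
          (curvVec (christoffel G) (F x) (Z x) (tangent F d x) (tangent F b x))
      = ∑ c, metricForm G (F x) (D.dualTangent F Z c x)
          (curvVec (christoffel G) (F x) (tangent F c x) (tangent F d x) (tangent F b x))
        - ∑ c, D.nvec x c * metricForm G (F x) (tangent F d x)
          (curvVec (christoffel G) (F x) (tangent F c x) (tangent F b x) (Z x)) := by
  have h1 : ∀ c, metricForm G (F x) (tangent F c x)
      (curvVec (christoffel G) (F x) (Z x) (tangent F d x) (tangent F b x))
      = -metricForm G (F x) (tangent F d x)
          (curvVec (christoffel G) (F x) (tangent F c x) (tangent F b x) (Z x)) := fun c => by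
    rw [h.isMetricOn.metricForm_curvVec_pair (h.mapsTo hx),
      h.isMetricOn.metricForm_curvVec_skew (h.mapsTo hx)]
  rw [h.ricci_eq_trace hx, metricForm_normal]
  simp only [h1, mul_neg, Finset.sum_neg_distrib]
  ring

end

end LocalData
namespace LocalData

/-! ### The constraint tensor in coordinates -/

variable {n : ℕ} {D : LocalData n} {s : Set (Coord n)} {t : Set (Coord (n + 1))}
  {G : Coord (n + 1) → Fin (n + 1) → Fin (n + 1) → ℝ} {F : Coord n → Coord (n + 1)}
  {Z : Coord n → Fin (n + 1) → ℝ}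

/-- The contraction `P^{ca} S_{bc} T_{da}`. -/
noncomputable def contractP (D : LocalData n) (x : Coord n) (S T : Fin n → Fin n → ℝ)
    (b d : Fin n) : ℝ :=
  ∑ c, S b c * ∑ a, D.P x c a * T d a

theorem contractP_eq_sum (x : Coord n) (S T : Fin n → Fin n → ℝ) (b d : Fin n) :
    D.contractP x S T b d = ∑ a, ∑ c, D.P x a c * (S b a * T d c) := by
  simp only [contractP, Finset.mul_sum]
  exact Finset.sum_congr rfl fun _ _ => Finset.sum_congr rfl fun _ _ => by ring

section

variable (h : D.IsInducedOn s t G F Z) {x : Coord n} (hx : x ∈ s)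
include h hx

theorem IsInducedOn.P_symm (a b : Fin n) : D.P x a b = D.P x b a :=
  D.A_inv_symm (fun a b => h.γ_symm hx a b) _ _

theorem IsInducedOn.contractP_comm (S T : Fin n → Fin n → ℝ) (b d : Fin n) :
    D.contractP x S T b d = D.contractP x T S d b := by
  rw [contractP_eq_sum, contractP_eq_sum, Finset.sum_comm]
  exact Finset.sum_congr rfl fun _ _ => Finset.sum_congr rfl fun _ _ => by
    rw [h.P_symm hx]; ring

omit h hx in
theorem F_skew (D : LocalData n) (x : Coord n) (a b : Fin n) : D.F x a b = -D.F x b a := by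
  simp only [LocalData.F]
  ring

theorem IsInducedOn.trP_F : D.trP D.F x = 0 := by
  have h1 : D.trP D.F x = -D.trP D.F x := by
    conv_lhs => rw [trP, Finset.sum_comm]
    simp only [trP, ← Finset.sum_neg_distrib]
    exact Finset.sum_congr rfl fun a _ => Finset.sum_congr rfl fun c _ => by
      rw [h.P_symm hx, F_skew D x c a, mul_neg]
  linarith

omit h hx in
theorem sum_nvec_s (D : LocalData n) (x : Coord n) : ∑ c, D.nvec x c * D.s x c = 0 := by
  have h1 : ∑ c, D.nvec x c * D.s x c = -∑ c, D.nvec x c * D.s x c := by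
    simp only [LocalData.s, Finset.mul_sum, ← Finset.sum_neg_distrib]
    rw [Finset.sum_comm]
    exact Finset.sum_congr rfl fun a _ => Finset.sum_congr rfl fun c _ => by
      rw [F_skew D x a c]; ring
  linarith

omit h hx in
theorem sum_nvec_r (D : LocalData n) (x : Coord n) : ∑ c, D.nvec x c * D.r x c = -D.kappa x := by
  simp only [LocalData.r, kappa, Finset.mul_sum, neg_neg]
  rw [Finset.sum_comm]
  exact Finset.sum_congr rfl fun a _ => Finset.sum_congr rfl fun c _ => by ring

/-- The Leibniz rule for the contraction of a covariant tensor with the vector field `n`. -/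
theorem IsInducedOn.sum_nvec_covDerivTensor {T : Coord n → Fin n → Fin n → ℝ}
    (hT : ∀ a b, DifferentiableAt ℝ (fun y => T y a b) x) (b d : Fin n) :
    ∑ c, D.nvec x c * covDerivTensor D.connection T x b c d
      = covDerivForm D.connection (fun y f => ∑ c, D.nvec y c * T y c f) x b d
        - ∑ c, T x c d * covDerivVec D.connection D.nvec x b c := by
  have hn := fun a => h.differentiableAt hx (h.contDiffOn_nvec a)
  have h1 : ∑ c, ∑ f, D.nvec x c * (D.connection x f b c * T x f d)
      = ∑ c, ∑ f, T x c d * (D.connection x c b f * D.nvec x f) := by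
    rw [Finset.sum_comm]
    exact Finset.sum_congr rfl fun _ _ => Finset.sum_congr rfl fun _ _ => by ring
  have h2 : ∑ c, ∑ f, D.nvec x c * (D.connection x f b d * T x c f)
      = ∑ f, ∑ c, D.connection x f b d * (D.nvec x c * T x c f) := by
    rw [Finset.sum_comm]
    exact Finset.sum_congr rfl fun _ _ => Finset.sum_congr rfl fun _ _ => by ring
  have h3 : ∑ c, pd b (fun y => D.nvec y c) x * T x c d
      = ∑ c, T x c d * pd b (fun y => D.nvec y c) x :=
    Finset.sum_congr rfl fun _ _ => mul_comm _ _
  simp only [covDerivTensor, covDerivForm, covDerivVec]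
  rw [pd_sum fun c _ => (hn c).fun_mul (hT c d)]
  simp only [pd_mul (hn _) (hT _ d), mul_sub, mul_add, Finset.sum_sub_distrib,
    Finset.sum_add_distrib, Finset.mul_sum, h1, h2, h3]
  ring

theorem IsInducedOn.lie2_nvec_Y (b d : Fin n) :
    lie2 D.nvec D.Y x b d = ∑ c, D.nvec x c * covDerivTensor D.connection D.Y x c b d
      + ∑ c, D.Y x c d * covDerivVec D.connection D.nvec x b c
      + ∑ c, D.Y x c b * covDerivVec D.connection D.nvec x d c := by
  have tors := (connection_spec (h.isRegularAt hx)).torsionFree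
  have h1 : ∀ b d, ∑ c, ∑ f, D.nvec x c * (D.connection x f c b * D.Y x f d)
      = ∑ c, ∑ f, D.Y x c d * (D.connection x c b f * D.nvec x f) := by
    intro b d
    rw [Finset.sum_comm]
    exact Finset.sum_congr rfl fun f _ => Finset.sum_congr rfl fun c _ => by
      rw [tors f c b]; ring
  have h2 : ∑ c, ∑ f, D.nvec x c * (D.connection x f c d * D.Y x b f)
      = ∑ c, ∑ f, D.nvec x c * (D.connection x f c d * D.Y x f b) :=
    Finset.sum_congr rfl fun f _ => Finset.sum_congr rfl fun c _ => by rw [h.Y_symm hx b]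
  simp only [lie2, covDerivTensor, covDerivVec, mul_sub, mul_add, Finset.sum_sub_distrib,
    Finset.sum_add_distrib, Finset.mul_sum]
  have h3 : ∑ c, D.Y x b c * pd d (fun y => D.nvec y c) x
      = ∑ c, D.Y x c b * pd d (fun y => D.nvec y c) x :=
    Finset.sum_congr rfl fun c _ => by rw [h.Y_symm hx b c]
  rw [h2, h3, h1 b d, h1 d b]
  ring

theorem IsInducedOn.sum_mul_covDerivVec_nvec (S : Fin n → Fin n → ℝ) (b d : Fin n) :
    ∑ c, S d c * covDerivVec D.connection D.nvec x b c
      = D.contractP x S (D.U x) d b - D.n2 x * D.contractP x S (D.F x) d b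
        + (∑ c, D.nvec x c * S d c) * (D.s x b - D.n2 x * pd b D.ell2 x) := by
  simp only [h.covDerivVec_nvec hx, contractP, Finset.mul_sum, Finset.sum_mul,
    ← Finset.sum_sub_distrib, ← Finset.sum_add_distrib]
  refine Finset.sum_congr rfl fun c _ => ?_
  rw [mul_add, Finset.mul_sum]
  congr 1
  · exact Finset.sum_congr rfl fun a _ => by ring
  · ring

/-- The first trace in `ricci_sub_riemann`, in terms of the hypersurface data. -/
theorem IsInducedOn.sum_dualTangent_curvVec (b d : Fin n) :
    ∑ c, metricForm G (F x) (D.dualTangent F Z c x)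
        (curvVec (christoffel G) (F x) (tangent F c x) (tangent F d x) (tangent F b x))
      = ricci D.connection x b d
        - ∑ c, D.nvec x c * covDerivTensor D.connection D.Y x c d b
        + ∑ c, D.nvec x c * covDerivTensor D.connection D.Y x d c b
        - D.Y x d b * (D.n2 x * D.trP D.Y x + D.trP D.U x + D.kappa x
          - (1 / 2) * D.n2 x * D.nell2 x)
        + D.n2 x * D.contractP x (D.Y x) (D.Y x) b d + D.contractP x (D.Y x) (D.U x) b d
        - D.r x b * (D.r x d - D.s x d + (1 / 2) * D.n2 x * pd d D.ell2 x)
        - D.U x d b * (D.trP D.Y x + (1 / 2) * D.nell2 x)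
        + D.contractP x (D.U x) (D.Y x) b d + D.contractP x (D.U x) (D.F x) b d
        + (1 / 2) * (∑ c, D.nvec x c * D.U x c b) * pd d D.ell2 x := by
  have e1 : ∑ c, D.nvec x c * (covDerivTensor D.connection D.Y x c d b
      - covDerivTensor D.connection D.Y x d c b)
      = ∑ c, D.nvec x c * covDerivTensor D.connection D.Y x c d b
        - ∑ c, D.nvec x c * covDerivTensor D.connection D.Y x d c b := by
    simp only [mul_sub, Finset.sum_sub_distrib]
  have e2 : ∑ c, D.Y x d b * metricForm G (F x) (D.dualTangent F Z c x)
      (covAlong (christoffel G) F c (D.normal F Z) x)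
      = D.Y x d b * (D.n2 x * D.trP D.Y x + D.trP D.U x + D.kappa x
          - (1 / 2) * D.n2 x * D.nell2 x) := by
    rw [← Finset.mul_sum]
    congr 1
    have k1 : ∑ c, ∑ a, D.P x c a * (D.n2 x * D.Y x c a) = D.n2 x * D.trP D.Y x := by
      simp only [trP, Finset.mul_sum]
      exact Finset.sum_congr rfl fun _ _ => Finset.sum_congr rfl fun _ _ => by ring
    have k2 : ∑ c, D.nvec x c * (1 / 2 * D.n2 x * pd c D.ell2 x)
        = 1 / 2 * D.n2 x * D.nell2 x := by
      simp only [nell2, Finset.mul_sum]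
      exact Finset.sum_congr rfl fun _ _ => by ring
    simp only [h.dualTangent_covAlong_normal hx, mul_add, mul_sub, Finset.sum_sub_distrib,
      Finset.sum_add_distrib, k1, k2, sum_nvec_r, sum_nvec_s]
    change _ + D.trP D.U x - _ = _
    ring
  have e3 : ∑ c, D.Y x c b * metricForm G (F x) (D.dualTangent F Z c x)
      (covAlong (christoffel G) F d (D.normal F Z) x)
      = D.n2 x * D.contractP x (D.Y x) (D.Y x) b d + D.contractP x (D.Y x) (D.U x) b d
        - D.r x b * (D.r x d - D.s x d + (1 / 2) * D.n2 x * pd d D.ell2 x) := by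
    have k : D.r x b = ∑ c, D.Y x b c * D.nvec x c :=
      Finset.sum_congr rfl fun c _ => by rw [h.Y_symm hx b c, mul_comm]
    rw [k]
    simp only [h.dualTangent_covAlong_normal hx, contractP, h.Y_symm hx _ b, Finset.mul_sum,
      Finset.sum_mul, ← Finset.sum_sub_distrib, ← Finset.sum_add_distrib]
    refine Finset.sum_congr rfl fun c _ => ?_
    rw [mul_sub, Finset.mul_sum]
    congr 1
    · exact Finset.sum_congr rfl fun a _ => by ring
    · ring
  have e4 : ∑ c, D.U x d b * metricForm G (F x) (D.dualTangent F Z c x)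
      (covAlong (christoffel G) F c Z x)
      = D.U x d b * (D.trP D.Y x + (1 / 2) * D.nell2 x) := by
    rw [← Finset.mul_sum]
    congr 1
    have k2 : ∑ c, 1 / 2 * D.nvec x c * pd c D.ell2 x = 1 / 2 * D.nell2 x := by
      simp only [nell2, Finset.mul_sum, mul_assoc]
    simp only [h.dualTangent_covAlong_rigging hx, mul_add, Finset.sum_add_distrib, k2]
    change D.trP D.Y x + D.trP D.F x + _ = _
    rw [h.trP_F hx, add_zero]
  have e5 : ∑ c, D.U x c b * metricForm G (F x) (D.dualTangent F Z c x)
      (covAlong (christoffel G) F d Z x)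
      = D.contractP x (D.U x) (D.Y x) b d + D.contractP x (D.U x) (D.F x) b d
        + (1 / 2) * (∑ c, D.nvec x c * D.U x c b) * pd d D.ell2 x := by
    simp only [h.dualTangent_covAlong_rigging hx, contractP, h.U_symm hx _ b, Finset.mul_sum,
      Finset.sum_mul, ← Finset.sum_add_distrib]
    refine Finset.sum_congr rfl fun c _ => ?_
    rw [mul_add, Finset.mul_sum]
    congr 1
    · exact Finset.sum_congr rfl fun a _ => by ring
    · ring
  simp only [h.dualTangent_curvVec hx, Finset.sum_add_distrib, Finset.sum_sub_distrib, e1, e2, e3,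
    e4, e5, ricci]
  ring

/-- The second trace in `ricci_sub_riemann`, in terms of the hypersurface data. -/
theorem IsInducedOn.sum_nvec_tangent_curvVec (b d : Fin n) :
    ∑ c, D.nvec x c * metricForm G (F x) (tangent F d x)
        (curvVec (christoffel G) (F x) (tangent F c x) (tangent F b x) (Z x))
      = ∑ c, D.nvec x c * covDerivTensor D.connection D.Y x c b d
        + ∑ c, D.nvec x c * covDerivTensor D.connection D.F x c b d
        - ∑ c, D.nvec x c * covDerivTensor D.connection D.Y x b c d
        - ∑ c, D.nvec x c * covDerivTensor D.connection D.F x b c d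
        + D.r x d * (D.r x b - D.s x b + (1 / 2) * D.n2 x * pd b D.ell2 x)
        - D.Y x b d * (-D.kappa x + (1 / 2) * D.n2 x * D.nell2 x)
        + (1 / 2) * (∑ c, D.nvec x c * D.U x c d) * pd b D.ell2 x
        - (1 / 2) * D.U x b d * D.nell2 x := by
  have k : -D.kappa x + 1 / 2 * D.n2 x * D.nell2 x
      = ∑ c, D.nvec x c * (D.r x c - D.s x c + 1 / 2 * D.n2 x * pd c D.ell2 x) := by
    simp only [mul_add, mul_sub, Finset.sum_add_distrib, Finset.sum_sub_distrib, sum_nvec_r,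
      sum_nvec_s, nell2, Finset.mul_sum, sub_zero]
    congr 1
    exact Finset.sum_congr rfl fun _ _ => by ring
  have k' : D.r x d = ∑ c, D.nvec x c * D.Y x c d := rfl
  rw [k, k']
  simp only [h.tangent_curvVec_rigging hx, nell2, Finset.mul_sum, Finset.sum_mul,
    ← Finset.sum_sub_distrib, ← Finset.sum_add_distrib]
  exact Finset.sum_congr rfl fun c _ => by ring

/-- The constraint tensor in coordinates. -/
theorem IsInducedOn.ricci_sub_riemann_eq_constraint (b d : Fin n) :
    ∑ μ, ∑ ν, ricci (christoffel G) (F x) μ ν * tangent F b x μ * tangent F d x ν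
        - D.n2 x * metricForm G (F x) (Z x)
          (curvVec (christoffel G) (F x) (Z x) (tangent F d x) (tangent F b x))
      = D.constraint x b d := by
  have hdiffY := fun a b => h.differentiableAt hx (h.contDiffOn_Y a b)
  have hdiffF := fun a b => h.differentiableAt hx (h.contDiffOn_F a b)
  have hdiffn := fun a => h.differentiableAt hx (h.contDiffOn_nvec a)
  have hr : ∀ f, DifferentiableAt ℝ (fun y => D.r y f) x := fun f =>
    DifferentiableAt.fun_sum fun c _ => (hdiffn c).fun_mul (hdiffY c f)
  have hs : ∀ f, DifferentiableAt ℝ (fun y => D.s y f) x := fun f =>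
    DifferentiableAt.fun_sum fun c _ => (hdiffn c).fun_mul (hdiffF c f)
  have hform : ∀ b d, covDerivForm D.connection (fun y f => D.s y f + 2 * D.r y f) x b d
      = covDerivForm D.connection D.s x b d + 2 * covDerivForm D.connection D.r x b d := by
    intro b d
    have hr2 : DifferentiableAt ℝ (fun y => 2 * D.r y d) x := (hr d).const_mul 2
    simp only [covDerivForm]
    rw [pd_add (hs d) hr2, pd_mul (by fun_prop) (hr d), pd_const]
    simp only [mul_add, Finset.sum_add_distrib]
    rw [Finset.sum_congr rfl fun c _ => mul_left_comm (D.connection x c b d) 2 (D.r x c),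
      ← Finset.mul_sum]
    ring
  -- the left-hand side is symmetric, so the formula obtained from the traces may be symmetrized
  have hcomm : ∑ μ, ∑ ν, ricci (christoffel G) (F x) μ ν * tangent F b x μ * tangent F d x ν
        - D.n2 x * metricForm G (F x) (Z x)
          (curvVec (christoffel G) (F x) (Z x) (tangent F d x) (tangent F b x))
      = ∑ μ, ∑ ν, ricci (christoffel G) (F x) μ ν * tangent F d x μ * tangent F b x ν
        - D.n2 x * metricForm G (F x) (Z x)
          (curvVec (christoffel G) (F x) (Z x) (tangent F b x) (tangent F d x)) := by
    rw [h.isMetricOn.metricForm_curvVec_pair (h.mapsTo hx), Finset.sum_comm]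
    congr 1
    exact Finset.sum_congr rfl fun μ _ => Finset.sum_congr rfl fun ν _ => by
      rw [h.isMetricOn.ricci_comm (h.mapsTo hx)]; ring
  -- `∇°_c F_{bd}` is skew in `b`, `d` and drops out of the symmetric part
  have hFskew : ∑ c, D.nvec x c * covDerivTensor D.connection D.F x c b d
      = -∑ c, D.nvec x c * covDerivTensor D.connection D.F x c d b := by
    rw [← Finset.sum_neg_distrib]
    refine Finset.sum_congr rfl fun c _ => ?_
    have k : pd c (fun y => D.F y b d) x = -pd c (fun y => D.F y d b) x := by
      simp only [pd]
      rw [show (fun y => D.F y b d) = fun y => -D.F y d b from funext fun y => F_skew D y b d,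
        fderiv_fun_neg]
      rfl
    simp only [covDerivTensor, k, F_skew D x b, F_skew D x _ d, Finset.sum_add_distrib, mul_neg,
      Finset.sum_neg_distrib]
    ring
  have hYsymm : ∑ c, D.nvec x c * covDerivTensor D.connection D.Y x c d b
      = ∑ c, D.nvec x c * covDerivTensor D.connection D.Y x c b d := by
    refine Finset.sum_congr rfl fun c _ => ?_
    have k : pd c (fun y => D.Y y d b) x = pd c (fun y => D.Y y b d) x :=
      pd_congr ((h.isOpen.eventually_mem hx).mono fun y hy => h.Y_symm hy d b) c
    simp only [covDerivTensor, k, h.Y_symm hx d, h.Y_symm hx _ b, Finset.sum_add_distrib]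
    ring
  have hDY : ∀ b d, ∑ c, D.nvec x c * covDerivTensor D.connection D.Y x b c d
      = covDerivForm D.connection D.r x b d
        - ∑ c, D.Y x c d * covDerivVec D.connection D.nvec x b c :=
    h.sum_nvec_covDerivTensor hx hdiffY
  have hDF : ∀ b d, ∑ c, D.nvec x c * covDerivTensor D.connection D.F x b c d
      = covDerivForm D.connection D.s x b d
        - ∑ c, D.F x c d * covDerivVec D.connection D.nvec x b c :=
    h.sum_nvec_covDerivTensor hx hdiffF
  have hYN : ∀ b d, ∑ c, D.Y x c d * covDerivVec D.connection D.nvec x b c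
      = D.contractP x (D.Y x) (D.U x) d b - D.n2 x * D.contractP x (D.Y x) (D.F x) d b
        + D.r x d * (D.s x b - D.n2 x * pd b D.ell2 x) := by
    intro b d
    have := h.sum_mul_covDerivVec_nvec hx (D.Y x) b d
    simp only [h.Y_symm hx d] at this
    exact this
  have hFN : ∀ b d, ∑ c, D.F x c d * covDerivVec D.connection D.nvec x b c
      = -D.contractP x (D.F x) (D.U x) d b + D.n2 x * D.contractP x (D.F x) (D.F x) d b
        + D.s x d * (D.s x b - D.n2 x * pd b D.ell2 x) := by
    intro b d
    have := h.sum_mul_covDerivVec_nvec hx (D.F x) b d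
    simp only [F_skew D x d, neg_mul, mul_neg, Finset.sum_neg_distrib] at this
    rw [show ∑ c, D.nvec x c * D.F x c d = D.s x d from rfl] at this
    linear_combination -this
  have hPU : ∑ a, ∑ c, D.P x a c * (D.U x a b * (2 * D.Y x d c + D.F x d c)
        + D.U x a d * (2 * D.Y x b c + D.F x b c))
      = 2 * D.contractP x (D.U x) (D.Y x) b d + D.contractP x (D.U x) (D.F x) b d
        + 2 * D.contractP x (D.U x) (D.Y x) d b + D.contractP x (D.U x) (D.F x) d b := by
    simp only [contractP_eq_sum, Finset.mul_sum, ← Finset.sum_add_distrib]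
    exact Finset.sum_congr rfl fun a _ => Finset.sum_congr rfl fun c _ => by
      rw [h.U_symm hx a b, h.U_symm hx a d]; ring
  have hPY : ∑ a, ∑ c, D.P x a c * ((D.Y x a b + D.F x a b) * (D.Y x c d + D.F x c d)
        - 2 * D.F x a b * D.F x c d)
      = D.contractP x (D.Y x) (D.Y x) b d - D.contractP x (D.Y x) (D.F x) b d
        - D.contractP x (D.F x) (D.Y x) b d - D.contractP x (D.F x) (D.F x) b d := by
    simp only [contractP_eq_sum, ← Finset.sum_sub_distrib]
    exact Finset.sum_congr rfl fun a _ => Finset.sum_congr rfl fun c _ => by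
      rw [h.Y_symm hx a b, h.Y_symm hx c d, F_skew D x a b, F_skew D x c d]; ring
  have E : ∀ b d, _ := fun b d => h.ricci_sub_riemann hx b d
  simp only [h.sum_dualTangent_curvVec hx, h.sum_nvec_tangent_curvVec hx, hDY, hDF, hYN, hFN] at E
  have E1 := E b d
  have E2 := E d b
  rw [← hcomm] at E2
  simp only [constraint, hform, hPU, hPY, h.lie2_nvec_Y hx, hYN]
  rw [hYsymm] at E1 E2
  rw [h.Y_symm hx d b, h.U_symm hx d b] at E1 E2
  have c1 := h.contractP_comm hx (D.Y x) (D.Y x) d b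
  have c2 := h.contractP_comm hx (D.Y x) (D.U x) d b
  have c3 := h.contractP_comm hx (D.Y x) (D.U x) b d
  have c4 := h.contractP_comm hx (D.F x) (D.U x) b d
  have c5 := h.contractP_comm hx (D.F x) (D.U x) d b
  have c6 := h.contractP_comm hx (D.F x) (D.F x) d b
  have c7 := h.contractP_comm hx (D.F x) (D.Y x) b d
  linear_combination (1 / 2) * E1 + (1 / 2) * E2 - (1 / 2) * hFskew + (1 / 2) * D.n2 x * c1
    + (3 / 2) * c2 + (3 / 2) * c3 + (1 / 2) * c4 + (1 / 2) * c5 - (1 / 2) * D.n2 x * c6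
    + D.n2 x * c7
end

end LocalData

/-! ### From manifolds to coordinates -/

section Coordinates

variable {m : ℕ} {M : Type*} [TopologicalSpace M] [ChartedSpace (Coord m) M]
  [IsManifold (𝓡 m) ∞ M]

theorem SymTensorField.val_eq_metricForm (T : SymTensorField m M)
    {e : OpenPartialHomeomorph M (Coord m)} {q : M} (he : IsChartAt e q)
    (v w : TangentSpace (𝓡 m) q) :
    T.val q v w = metricForm (T.inChart e) (e q) (fun a => comps e q v a)
      (fun a => comps e q w a) := by
  obtain ⟨he, hq⟩ := he
  obtain ⟨x, hx, rfl⟩ : ∃ x ∈ e.target, e.symm x = q := ⟨e q, e.map_source hq, e.left_inv hq⟩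
  rw [e.right_inv hx, metricForm_apply]
  conv_lhs => rw [← sum_comps_coordVec he hx v, ← sum_comps_coordVec he hx w]
  simp only [map_sum, map_smul, sum_apply, smul_apply,
    smul_eq_mul, inChart, Finset.mul_sum]
  rw [Finset.sum_comm]
  exact Finset.sum_congr rfl fun _ _ => Finset.sum_congr rfl fun _ _ => by ring

theorem SemiRiemannianMetric.isMetricOn (g : SemiRiemannianMetric m M)
    {e : OpenPartialHomeomorph M (Coord m)} (he : e ∈ IsManifold.maximalAtlas (𝓡 m) ∞ M) :
    IsMetricOn (g.inChart e) e.target where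
  isOpen := e.open_target
  contDiffOn a b := g.toSymTensorField.contDiffOn_inChart he a b
  symm _ _ _ _ := g.symm _ _ _
  nondegenerate x hx h0 := by
    obtain ⟨c, hc0, hc⟩ := Matrix.exists_mulVec_eq_zero_iff.2 h0
    have hcv : ∑ a, c a • coordVec e x a = 0 := by
      refine g.nondegenerate (e.symm x) _ fun w => ?_
      rw [← sum_comps_coordVec he hx w, map_sum]
      refine Finset.sum_eq_zero fun b _ => ?_
      rw [map_smul, g.symm, map_sum]
      have := congrFun hc b
      simp only [Matrix.mulVec, dotProduct, Matrix.of_apply, Pi.zero_apply] at this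
      rw [Finset.sum_congr rfl fun a _ => by rw [map_smul, smul_eq_mul, mul_comm]]
      change _ • ∑ a, g.inChart e x b a * c a = 0
      rw [this, smul_zero]
    refine hc0 (funext fun a => ?_)
    have h2 : (mfderiv (𝓡 m) (𝓡 m) e (e.symm x)) (∑ b, c b • coordVec e x b) = 0 := by
      rw [hcv, map_zero]
    rw [map_sum, Finset.sum_congr rfl fun b _ => by rw [map_smul]] at h2
    change (∑ b, c b • comps e (e.symm x) (coordVec e x b) : Coord m) = 0 at h2
    simp only [comps_coordVec he hx] at h2
    have h3 := congrArg (fun z : Coord m => z a) h2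
    simpa [Finset.sum_apply, Pi.single_apply] using h3

end Coordinates

section Charts

set_option linter.unusedSectionVars false

variable {n : ℕ} {N : Type*} [TopologicalSpace N] [ChartedSpace (Coord n) N]
  [IsManifold (𝓡 n) ∞ N] {M : Type*} [TopologicalSpace M] [ChartedSpace (Coord (n + 1)) M]
  [IsManifold (𝓡 (n + 1)) ∞ M]

/-- The map `φ` in charts. -/
def mapInCharts (φ : N → M) (e : OpenPartialHomeomorph N (Coord n))
    (e' : OpenPartialHomeomorph M (Coord (n + 1))) (y : Coord n) : Coord (n + 1) :=
  e' (φ (e.symm y))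

/-- The components of the rigging `ζ` in charts. -/
noncomputable def riggingInCharts (φ : N → M) (ζ : ∀ p : N, TangentSpace (𝓡 (n + 1)) (φ p))
    (e : OpenPartialHomeomorph N (Coord n)) (e' : OpenPartialHomeomorph M (Coord (n + 1)))
    (y : Coord n) (μ : Fin (n + 1)) : ℝ :=
  comps e' (φ (e.symm y)) (ζ (e.symm y)) μ

/-- The open set of coordinates on which `φ` can be written in charts. -/
def chartDomain (φ : N → M) (e : OpenPartialHomeomorph N (Coord n))
    (e' : OpenPartialHomeomorph M (Coord (n + 1))) : Set (Coord n) :=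
  e.target ∩ e.symm ⁻¹' (φ ⁻¹' e'.source)

variable {φ : N → M} {ζ : ∀ p : N, TangentSpace (𝓡 (n + 1)) (φ p)}
  {e : OpenPartialHomeomorph N (Coord n)} {e' : OpenPartialHomeomorph M (Coord (n + 1))}

theorem IsRigging.contMDiff_map (h : IsRigging φ ζ) : ContMDiff (𝓡 n) (𝓡 (n + 1)) ∞ φ :=
  (Bundle.contMDiff_proj (TangentSpace (𝓡 (n + 1)) (M := M))).comp h.contMDiff

theorem isOpen_chartDomain (hφ : Continuous φ) : IsOpen (chartDomain φ e e') :=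
  e.continuousOn_symm.isOpen_inter_preimage e.open_target (e'.open_source.preimage hφ)

theorem contDiffOn_mapInCharts (hφ : ContMDiff (𝓡 n) (𝓡 (n + 1)) ∞ φ)
    (he : e ∈ IsManifold.maximalAtlas (𝓡 n) ∞ N)
    (he' : e' ∈ IsManifold.maximalAtlas (𝓡 (n + 1)) ∞ M) :
    ContDiffOn ℝ ∞ (mapInCharts φ e e') (chartDomain φ e e') := by
  rw [← contMDiffOn_iff_contDiffOn]
  exact (contMDiffOn_of_mem_maximalAtlas he').comp
    (hφ.comp_contMDiffOn ((contMDiffOn_symm_of_mem_maximalAtlas he).mono Set.inter_subset_left))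
    fun y hy => hy.2

theorem contDiffOn_riggingInCharts (h : IsRigging φ ζ)
    (he : e ∈ IsManifold.maximalAtlas (𝓡 n) ∞ N)
    (he' : e' ∈ IsManifold.maximalAtlas (𝓡 (n + 1)) ∞ M) (μ : Fin (n + 1)) :
    ContDiffOn ℝ ∞ (fun y => riggingInCharts φ ζ e e' y μ) (chartDomain φ e e') := by
  have h1 := (contMDiffOn_of_mem_maximalAtlas he').contMDiffOn_tangentMapWithin (m := ∞) le_rfl
    e'.open_source.uniqueMDiffOn
  have h2 := h.contMDiff.comp_contMDiffOn
    ((contMDiffOn_symm_of_mem_maximalAtlas he).mono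
      (Set.inter_subset_left : chartDomain φ e e' ⊆ e.target))
  have h3 := (contMDiff_snd_tangentBundle_modelSpace (n := ∞) (Coord (n + 1))
    (𝓡 (n + 1))).comp_contMDiffOn (h1.comp h2 fun y hy => hy.2)
  rw [contMDiffOn_iff_contDiffOn] at h3
  refine (contDiffOn_euclidean.1 h3 μ).congr fun y hy => ?_
  simp only [Function.comp, tangentMapWithin, riggingInCharts, comps]
  rw [mfderivWithin_of_isOpen e'.open_source hy.2]

theorem comps_push_coordVec (hφ : ContMDiff (𝓡 n) (𝓡 (n + 1)) ∞ φ)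
    (he : e ∈ IsManifold.maximalAtlas (𝓡 n) ∞ N)
    (he' : e' ∈ IsManifold.maximalAtlas (𝓡 (n + 1)) ∞ M) {x : Coord n}
    (hx : x ∈ chartDomain φ e e') (a : Fin n) (μ : Fin (n + 1)) :
    comps e' (φ (e.symm x)) (push φ (e.symm x) (coordVec e x a)) μ
      = tangent (mapInCharts φ e e') a x μ := by
  have hF : DifferentiableAt ℝ (mapInCharts φ e e') x :=
    ((contDiffOn_mapInCharts hφ he he').contDiffAt
      ((isOpen_chartDomain hφ.continuous).mem_nhds hx)).differentiableAt (by simp)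
  have h1 : MDifferentiableAt (𝓡 n) (𝓡 n) e.symm x :=
    (mdifferentiable_chart he).mdifferentiableAt_symm hx.1
  have h2 : MDifferentiableAt (𝓡 n) (𝓡 (n + 1)) φ (e.symm x) :=
    (hφ (e.symm x)).mdifferentiableAt (by simp)
  have h3 : MDifferentiableAt (𝓡 (n + 1)) (𝓡 (n + 1)) e' (φ (e.symm x)) :=
    (mdifferentiable_chart he').mdifferentiableAt hx.2
  have h4 : mfderiv (𝓡 n) (𝓡 (n + 1)) (mapInCharts φ e e') x
      = (mfderiv (𝓡 (n + 1)) (𝓡 (n + 1)) e' (φ (e.symm x))).comp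
        ((mfderiv (𝓡 n) (𝓡 (n + 1)) φ (e.symm x)).comp (mfderiv (𝓡 n) (𝓡 n) e.symm x)) := by
    rw [← mfderiv_comp x h2 h1]
    exact mfderiv_comp x h3 (h2.comp x h1)
  rw [mfderiv_eq_fderiv] at h4
  have h5 : tangent (mapInCharts φ e e') a x μ
      = (fderiv ℝ (mapInCharts φ e e') x (EuclideanSpace.single a 1)) μ := by
    have := ((EuclideanSpace.proj (𝕜 := ℝ) μ : Coord (n + 1) →L[ℝ] ℝ).hasFDerivAt.comp x
      hF.hasFDerivAt).fderiv
    unfold tangent pd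
    rw [show (fun y => mapInCharts φ e e' y μ)
      = (EuclideanSpace.proj (𝕜 := ℝ) μ : Coord (n + 1) →L[ℝ] ℝ) ∘ mapInCharts φ e e' from rfl,
      this]
    rfl
  rw [h5, h4]
  rfl

theorem comps_push (hφ : ContMDiff (𝓡 n) (𝓡 (n + 1)) ∞ φ)
    (he : e ∈ IsManifold.maximalAtlas (𝓡 n) ∞ N)
    (he' : e' ∈ IsManifold.maximalAtlas (𝓡 (n + 1)) ∞ M) {x : Coord n}
    (hx : x ∈ chartDomain φ e e') (X : TangentSpace (𝓡 n) (e.symm x)) :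
    (fun μ => comps e' (φ (e.symm x)) (push φ (e.symm x) X) μ)
      = ∑ a, comps e (e.symm x) X a • tangent (mapInCharts φ e e') a x := by
  funext μ
  have h1 : comps e' (φ (e.symm x)) (push φ (e.symm x) X)
      = ∑ a, comps e (e.symm x) X a • comps e' (φ (e.symm x))
        (push φ (e.symm x) (coordVec e x a)) := by
    conv_lhs => rw [← sum_comps_coordVec he hx.1 X]
    let L : TangentSpace (𝓡 n) (e.symm x) →L[ℝ] Coord (n + 1) :=
      (mfderiv (𝓡 (n + 1)) (𝓡 (n + 1)) e' (φ (e.symm x))).comp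
        (mfderiv (𝓡 n) (𝓡 (n + 1)) φ (e.symm x))
    change L _ = ∑ a, comps e (e.symm x) X a • L _
    simp only [map_sum, map_smul]
  rw [h1]
  simp [Finset.sum_apply, comps_push_coordVec hφ he he' hx]

/-- Embedded hypersurface data, read in charts. -/
theorem HypersurfaceData.IsEmbedded.isInducedOn {D : HypersurfaceData n N}
    {g : SemiRiemannianMetric (n + 1) M} (hD : D.IsEmbedded g φ ζ)
    (he : e ∈ IsManifold.maximalAtlas (𝓡 n) ∞ N)
    (he' : e' ∈ IsManifold.maximalAtlas (𝓡 (n + 1)) ∞ M) :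
    (D.inChart e).IsInducedOn (chartDomain φ e e') e'.target (g.inChart e')
      (mapInCharts φ e e') (riggingInCharts φ ζ e e') where
  isMetricOn := g.isMetricOn he'
  isOpen := isOpen_chartDomain hD.isRigging.contMDiff_map.continuous
  contDiffOn_map := contDiffOn_mapInCharts hD.isRigging.contMDiff_map he he'
  mapsTo y hy := e'.map_source hy.2
  contDiffOn_rigging := contDiffOn_riggingInCharts hD.isRigging he he'
  γ_eq y hy a b := by
    change D.γ.val _ _ _ = _
    rw [← hD.pullback_γ, g.val_eq_metricForm ⟨he', hy.2⟩]
    simp only [comps_push_coordVec hD.isRigging.contMDiff_map he he' hy]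
    rfl
  ell_eq y hy a := by
    change D.ell _ _ = _
    rw [← hD.pullback_ell, g.val_eq_metricForm ⟨he', hy.2⟩]
    simp only [comps_push_coordVec hD.isRigging.contMDiff_map he he' hy]
    rfl
  ell2_eq y hy := by
    change D.ell2 _ = _
    rw [← hD.pullback_ell2, g.val_eq_metricForm ⟨he', hy.2⟩]
    rfl
  Y_eq y hy a b := by
    have := hD.pullback_Y (e.symm y) e e' ⟨he, e.map_target hy.1⟩ ⟨he', hy.2⟩ a b
    rw [e.right_inv hy.1] at this
    exact this.symm
  nondegenerate y hy := D.det_ne_zero he hy.1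

end Charts


/-! ### The normal covector and the normal vector -/

section Normal

variable {n : ℕ} {N : Type*} [TopologicalSpace N] [ChartedSpace (Coord n) N]
  [IsManifold (𝓡 n) ∞ N] {M : Type*} [TopologicalSpace M] [ChartedSpace (Coord (n + 1)) M]
  [IsManifold (𝓡 (n + 1)) ∞ M] {D : HypersurfaceData n N} {g : SemiRiemannianMetric (n + 1) M}
  {φ : N → M} {ζ : ∀ p : N, TangentSpace (𝓡 (n + 1)) (φ p)}

/-- The map `(X, a) ↦ φ_⋆ X + a ζ`. -/
noncomputable def frameMap (φ : N → M) (ζ : ∀ p : N, TangentSpace (𝓡 (n + 1)) (φ p)) (p : N) :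
    Coord n × ℝ →ₗ[ℝ] Coord (n + 1) :=
  let L : Coord n →L[ℝ] Coord (n + 1) := mfderiv (𝓡 n) (𝓡 (n + 1)) φ p
  L.toLinearMap.coprod (LinearMap.toSpanSingleton ℝ (Coord (n + 1)) (ζ p))

/-- By the non-degeneracy of `𝓐`, the rigging and the tangent space span `T_{φ(p)} M`. -/
theorem HypersurfaceData.IsEmbedded.frameMap_bijective (hD : D.IsEmbedded g φ ζ) (p : N) :
    Function.Bijective (frameMap φ ζ p) := by
  have hinj : Function.Injective (frameMap φ ζ p) := by
    rw [← LinearMap.ker_eq_bot, LinearMap.ker_eq_bot']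
    rintro ⟨(X : TangentSpace (𝓡 n) p), a⟩ h0
    replace h0 : (push φ p X + a • ζ p : TangentSpace (𝓡 (n + 1)) (φ p)) = 0 := h0
    obtain ⟨hX, ha⟩ := D.nondegenerate p X a fun W b => by
      have h1 : g.val (φ p) (push φ p X + a • ζ p) (push φ p W + b • ζ p) = 0 := by
        rw [h0]
        simp
      simp only [map_add, map_smul, add_apply, smul_apply, smul_eq_mul] at h1
      rw [g.symm _ (push φ p X) (ζ p), hD.pullback_γ, hD.pullback_ell, hD.pullback_ell,
        hD.pullback_ell2] at h1
      linear_combination h1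
    exact Prod.ext hX ha
  exact ⟨hinj, (LinearMap.injective_iff_surjective_of_finrank_eq_finrank (by simp)).1 hinj⟩

theorem HypersurfaceData.IsEmbedded.exists_eq_push_add (hD : D.IsEmbedded g φ ζ) (p : N)
    (v : TangentSpace (𝓡 (n + 1)) (φ p)) :
    ∃ (X : TangentSpace (𝓡 n) p) (a : ℝ), v = push φ p X + a • ζ p := by
  obtain ⟨⟨X, a⟩, h⟩ := (hD.frameMap_bijective p).2 v
  exact ⟨X, a, h.symm⟩

theorem HypersurfaceData.IsEmbedded.existsUnique_normalCovector (hD : D.IsEmbedded g φ ζ)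
    (p : N) : ∃! η, IsNormalCovector φ ζ p η := by
  set L := LinearEquiv.ofBijective (frameMap φ ζ p) (hD.frameMap_bijective p)
  have hL : ∀ (X : TangentSpace (𝓡 n) p) (a : ℝ),
      L.symm (push φ p X + a • ζ p : TangentSpace (𝓡 (n + 1)) (φ p)) = (X, a) := fun X a =>
    L.symm_apply_eq.2 rfl
  let η : Coord (n + 1) →L[ℝ] ℝ :=
    LinearMap.toContinuousLinearMap ((LinearMap.snd ℝ (Coord n) ℝ).comp L.symm.toLinearMap)
  refine ⟨η, ⟨fun X => ?_, ?_⟩, fun η' h => ?_⟩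
  · have := hL X 0
    rw [zero_smul, add_zero] at this
    exact congrArg Prod.snd this
  · have := hL 0 1
    rw [one_smul, show push φ p 0 = 0 from map_zero _, zero_add] at this
    exact congrArg Prod.snd this
  · refine ContinuousLinearMap.ext fun v => ?_
    obtain ⟨X, a, rfl⟩ := hD.exists_eq_push_add p v
    have : η (push φ p X + a • ζ p : TangentSpace (𝓡 (n + 1)) (φ p)) = a :=
      congrArg Prod.snd (hL X a)
    refine Eq.trans ?_ this.symm
    rw [map_add, map_smul, h.1, h.2]
    simp

theorem SemiRiemannianMetric.exists_val_eq {m : ℕ} {M : Type*} [TopologicalSpace M]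
    [ChartedSpace (Coord m) M] [IsManifold (𝓡 m) ∞ M] (g : SemiRiemannianMetric m M) (q : M)
    (η : TangentSpace (𝓡 m) q →L[ℝ] ℝ) :
    ∃ ν : TangentSpace (𝓡 m) q, ∀ v, g.val q ν v = η v := by
  let B : Coord m →L[ℝ] Coord m →L[ℝ] ℝ := g.val q
  let L : Coord m →ₗ[ℝ] Module.Dual ℝ (Coord m) :=
    { toFun := fun v => (B v).toLinearMap
      map_add' := fun v w => by simp
      map_smul' := fun c v => by simp }
  have hinj : Function.Injective L := by
    rw [← LinearMap.ker_eq_bot, LinearMap.ker_eq_bot']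
    intro v hv
    exact g.nondegenerate q v fun w => LinearMap.congr_fun hv w
  have hsurj := (LinearMap.injective_iff_surjective_of_finrank_eq_finrank
    (Subspace.dual_finrank_eq (K := ℝ) (V := Coord m)).symm).1 hinj
  let η₀ : Coord m →L[ℝ] ℝ := η
  obtain ⟨ν, hν⟩ := hsurj η₀.toLinearMap
  exact ⟨ν, fun v => LinearMap.congr_fun hν v⟩

/-- At a null point the normal vector is null: the radical of `γ` is spanned by a vector whose
push-forward is proportional to `ν`, which is therefore tangent to the hypersurface. -/
theorem HypersurfaceData.IsEmbedded.normal_null (hD : D.IsEmbedded g φ ζ) {p : N}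
    (hp : D.IsNullPoint p) {η : TangentSpace (𝓡 (n + 1)) (φ p) →L[ℝ] ℝ}
    (hη : IsNormalCovector φ ζ p η) {ν : TangentSpace (𝓡 (n + 1)) (φ p)}
    (hν : ∀ v, g.val (φ p) ν v = η v) : g.val (φ p) ν ν = 0 := by
  have hker : (D.γ.val p).toLinearMap.ker ≠ ⊥ := by
    intro h0
    unfold IsNullPoint at hp
    rw [h0, finrank_bot] at hp
    exact zero_ne_one hp
  obtain ⟨X, hX, hX0⟩ := Submodule.exists_mem_ne_zero_of_ne_bot hker
  have hγ : ∀ W, D.γ.val p X W = 0 := fun W => by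
    have : D.γ.val p X = 0 := hX
    rw [this]
    rfl
  have hpush : push φ p X = D.ell p X • ν := by
    rw [← sub_eq_zero]
    refine g.nondegenerate (φ p) _ fun v => ?_
    obtain ⟨W, b, rfl⟩ := hD.exists_eq_push_add p v
    simp only [map_add, map_sub, map_smul, sub_apply, smul_apply, smul_eq_mul, hν, hη.1, hη.2,
      hD.pullback_γ, hγ]
    rw [g.symm, hD.pullback_ell]
    ring
  have hell : D.ell p X ≠ 0 := by
    intro h0
    rw [h0, zero_smul] at hpush
    have h1 : frameMap φ ζ p (X, 0) = 0 := by
      change (push φ p X + (0 : ℝ) • ζ p : TangentSpace (𝓡 (n + 1)) (φ p)) = 0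
      rw [hpush]
      simp
    exact hX0 (congrArg Prod.fst ((hD.frameMap_bijective p).1 (h1.trans (map_zero _).symm)))
  have h2 : D.ell p X * g.val (φ p) ν ν = 0 := by
    rw [← smul_eq_mul, ← map_smul, ← hpush, hν, hη.1]
  exact (mul_eq_zero.1 h2).resolve_left hell

/-- A 2-covariant tensor is bilinear in the components of its arguments. -/
theorem sum_mul_sum_smul {m : ℕ} (K : Fin m → Fin m → ℝ) (c d : Fin n → ℝ)
    (v : Fin n → Fin m → ℝ) :
    ∑ μ, ∑ ν, K μ ν * (∑ a, c a • v a) μ * (∑ b, d b • v b) ν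
      = ∑ a, ∑ b, (∑ μ, ∑ ν, K μ ν * v a μ * v b ν) * c a * d b := by
  have h1 : ∀ u w : Fin m → ℝ, ∑ μ, ∑ ν, K μ ν * u μ * w ν
      = Matrix.toBilin' (Matrix.of K) u w := by
    intro u w
    rw [Matrix.toBilin'_apply]
    exact Finset.sum_congr rfl fun _ _ => Finset.sum_congr rfl fun _ _ => by
      rw [Matrix.of_apply]; ring
  simp only [h1, map_sum, LinearMap.sum_apply, map_smul, LinearMap.smul_apply, smul_eq_mul,
    Finset.mul_sum]
  rw [Finset.sum_comm]
  exact Finset.sum_congr rfl fun _ _ => Finset.sum_congr rfl fun _ _ => by ring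

theorem HypersurfaceData.IsEmbedded.ric_sub_riem (hD : D.IsEmbedded g φ ζ) {p : N}
    {η : TangentSpace (𝓡 (n + 1)) (φ p) →L[ℝ] ℝ} (hη : IsNormalCovector φ ζ p η)
    {ν : TangentSpace (𝓡 (n + 1)) (φ p)} (hν : ∀ v, g.val (φ p) ν v = η v)
    {e : OpenPartialHomeomorph N (Coord n)} {e' : OpenPartialHomeomorph M (Coord (n + 1))}
    (he : IsChartAt e p) (he' : IsChartAt e' (φ p)) (X W : TangentSpace (𝓡 n) p) :
    g.ric e' (φ p) (push φ p X) (push φ p W)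
        - g.val (φ p) ν ν * g.riem e' (φ p) (ζ p) (push φ p X) (ζ p) (push φ p W)
      = D.constraintTensor e p X W := by
  have hφ := hD.isRigging.contMDiff_map
  obtain ⟨x, hx, rfl⟩ : ∃ x ∈ e.target, e.symm x = p :=
    ⟨e p, e.map_source he.2, e.left_inv he.2⟩
  have hxs : x ∈ chartDomain φ e e' := ⟨hx, he'.2⟩
  have h := hD.isInducedOn he.1 he'.1
  set F := mapInCharts φ e e'
  set Z := riggingInCharts φ ζ e e'
  set G := g.inChart e'
  have hFx : e' (φ (e.symm x)) = F x := rfl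
  have hZx : ∀ μ, comps e' (φ (e.symm x)) (ζ (e.symm x)) μ = Z x μ := fun _ => rfl
  have hpush := fun X : TangentSpace (𝓡 n) (e.symm x) => comps_push hφ he.1 he'.1 hxs X
  -- the components of `ν` are those of the normal vector of the local data
  have hnormal : (fun μ => comps e' (φ (e.symm x)) ν μ) = (D.inChart e).normal F Z x := by
    refine h.ext_frame hxs (fun a => ?_) ?_
    · rw [h.tangent_normal hxs, h.metricForm_comm hxs]
      have h1 := hν (push φ (e.symm x) (coordVec e x a))
      rw [hη.1, g.val_eq_metricForm he'] at h1
      simp only [comps_push_coordVec hφ he.1 he'.1 hxs] at h1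
      exact h1
    · rw [h.rigging_normal hxs, h.metricForm_comm hxs]
      have h1 := hν (ζ (e.symm x))
      rw [hη.2, g.val_eq_metricForm he'] at h1
      exact h1
  have hn2 : g.val (φ (e.symm x)) ν ν = (D.inChart e).n2 x := by
    rw [g.val_eq_metricForm he', hnormal]
    exact h.normal_normal hxs
  have hric : ∀ v w : Fin (n + 1) → ℝ,
      ∑ b, ∑ d, ricci (christoffel G) (F x) b d * v b * w d - (D.inChart e).n2 x
        * ∑ a, ∑ b, ∑ c, ∑ d, riemannLow G (F x) a b c d * Z x a * v b * Z x c * w d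
      = ∑ b, ∑ d, (ricci (christoffel G) (F x) b d - (D.inChart e).n2 x
        * ∑ a, ∑ c, riemannLow G (F x) a b c d * Z x a * Z x c) * v b * w d := by
    intro v w
    rw [Finset.sum_comm (f := fun a b => ∑ c, ∑ d,
      riemannLow G (F x) a b c d * Z x a * v b * Z x c * w d), Finset.mul_sum,
      ← Finset.sum_sub_distrib]
    refine Finset.sum_congr rfl fun b _ => ?_
    have h1 : ∑ a, ∑ c, ∑ d, riemannLow G (F x) a b c d * Z x a * v b * Z x c * w d
        = ∑ d, ∑ a, ∑ c, riemannLow G (F x) a b c d * Z x a * v b * Z x c * w d := by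
      rw [Finset.sum_comm]
      rw [Finset.sum_congr rfl fun c _ => Finset.sum_comm, Finset.sum_comm]
      exact Finset.sum_congr rfl fun d _ => Finset.sum_comm
    rw [h1, Finset.mul_sum, ← Finset.sum_sub_distrib]
    refine Finset.sum_congr rfl fun d _ => ?_
    simp only [sub_mul, Finset.mul_sum, Finset.sum_mul]
    congr 1
    exact Finset.sum_congr rfl fun _ _ => Finset.sum_congr rfl fun _ _ => by ring
  have hframe : ∀ b d, ∑ μ, ∑ ν, (ricci (christoffel G) (F x) μ ν - (D.inChart e).n2 x
      * ∑ a, ∑ c, riemannLow G (F x) a μ c ν * Z x a * Z x c) * tangent F b x μ * tangent F d x ν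
      = (D.inChart e).constraint x b d := by
    intro b d
    rw [← hric, ← h.ricci_sub_riemann_eq_constraint hxs b d, metricForm_curvVec]
  rw [hn2]
  unfold SemiRiemannianMetric.ric SemiRiemannianMetric.riem HypersurfaceData.constraintTensor
  rw [e.right_inv hx, hFx]
  have hpX := fun μ => congrFun (hpush X) μ
  have hpW := fun μ => congrFun (hpush W) μ
  simp only [hpX, hpW, hZx, ← hframe]
  rw [← sum_mul_sum_smul]
  exact hric _ _

end Normal

end HypData

theorem proposition4p3 {n : ℕ}
    {N : Type*} [TopologicalSpace N] [ChartedSpace (EuclideanSpace ℝ (Fin n)) N]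
    [IsManifold (𝓡 n) ∞ N]
    {M : Type*} [TopologicalSpace M] [ChartedSpace (EuclideanSpace ℝ (Fin (n + 1))) M]
    [IsManifold (𝓡 (n + 1)) ∞ M]
    (D : HypersurfaceData n N) (g : SemiRiemannianMetric (n + 1) M)
    (φ : N → M) (ζ : ∀ p : N, TangentSpace (𝓡 (n + 1)) (φ p))
    (hD : D.IsEmbedded g φ ζ) (p : N) :
    (∃! η, IsNormalCovector φ ζ p η) ∧
    ∀ η, IsNormalCovector φ ζ p η →
      ∃ ν : TangentSpace (𝓡 (n + 1)) (φ p), (∀ v, g.val (φ p) ν v = η v) ∧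
        ∀ (e : OpenPartialHomeomorph N (EuclideanSpace ℝ (Fin n)))
          (e' : OpenPartialHomeomorph M (EuclideanSpace ℝ (Fin (n + 1)))),
          IsChartAt e p → IsChartAt e' (φ p) →
          ∀ X W : TangentSpace (𝓡 n) p,
            g.ric e' (φ p) (push φ p X) (push φ p W)
                - g.val (φ p) ν ν * g.riem e' (φ p) (ζ p) (push φ p X) (ζ p) (push φ p W)
              = D.constraintTensor e p X W ∧
            (D.IsNullPoint p →
              g.ric e' (φ p) (push φ p X) (push φ p W) = D.constraintTensor e p X W) := by
  refine ⟨hD.existsUnique_normalCovector p, fun η hη => ?_⟩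
  obtain ⟨ν, hν⟩ := g.exists_val_eq (φ p) η
  refine ⟨ν, hν, fun e e' he he' X W => ?_⟩
  have h := hD.ric_sub_riem hη hν he he' X W
  refine ⟨h, fun hp => ?_⟩
  rwa [hD.normal_null hp hη hν, zero_mul, sub_zero] at h
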